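/- Let $\Omega\subset\mathbb{C}$ be a polygon in the extended plane with $\infty\notin\Omega$, i.e. a domain whose boundary in $\mathbb{C}$ consists of finitely many (nondegenerate) line segments, rays or lines ($\Omega$ may be unbounded, with $\infty$ on its boundary, and may have slits), and let $f$ map the unit disk $\mathbb{D}$ conformally onto $\Omega$. Let $P_f(z)=z+2f'(z)/f''(z)\in\hat{\mathbb{C}}$ (with $P_f(z)=\infty$ if $f''(z)=0$) be the pole of the best Möbius approximation of $f$ at $z$. Vertices of $\Omega$ are counted as corners seen from inside $\Omega$, so a boundary point approached by $\Omega$ through several sectors carries several corners. A corner at a finite point is a convex vertex if its interior angle is $<\pi$ and a concave vertex if its interior angle is in $(\pi,2\pi]$. Each connected component of $\Omega\cap\{|w|>R\}$, $R$ large, is a vertex at infinity, and vertices at infinity count as convex. Then there are integers $k,m\ge 0$ such that $\Omega$ has exactly $k+1$ convex and exactly $m$ concave vertices, and there are finite Blaschke products $B_k,B_m$ of degrees $k$ and $m$, without common zeros in $\mathbb{D}$, such that $B_m(z)-zB_k(z)\neq 0$ for all $z\in\mathbb{D}$ and $$\frac{f''}{f'}(z)=\frac{2B_k(z)}{B_m(z)-zB_k(z)},\qquad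 P_f(z)=\frac{B_m(z)}{B_k(z)}\qquad(z\in\mathbb{D}),$$ where the last quotient is read as $\infty$ at the zeros of $B_k$. Moreover, counting multiplicities in $\mathbb{D}$: (i) $P_f$ takes each value $b\in\hat{\mathbb{C}}$ with $|b|>1$ (including $b=\infty$) exactly $k$ times; (ii) $P_f$ takes each value $a\in\mathbb{C}$ with $|a|<1$ exactly $m$ times. -/

import Mathlib

open Filter Topology

noncomputable section

/-- `f` maps the open unit disk conformally (holomorphically and bijectively) onto `Ω ⊆ ℂ`. -/
structure IsConformalFromDisk (f : ℂ → ℂ) (Ω : Set ℂ) : Prop where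
  differentiableOn : DifferentiableOn ℂ f (Metric.ball 0 1)
  injOn : Set.InjOn f (Metric.ball 0 1)
  image_eq : f '' Metric.ball 0 1 = Ω

/-- `S` is a nondegenerate closed line segment, a closed ray, or a full line in the plane. -/
def IsStraightPiece (S : Set ℂ) : Prop :=
  (∃ a b : ℂ, a ≠ b ∧ S = segment ℝ a b) ∨
  (∃ a v : ℂ, v ≠ 0 ∧ S = {w | ∃ t : ℝ, 0 ≤ t ∧ w = a + t * v}) ∨
  (∃ a v : ℂ, v ≠ 0 ∧ S = {w | ∃ t : ℝ, w = a + t * v})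

/-- A (possibly unbounded, possibly slit) polygon: a domain of the plane whose finite boundary
consists of finitely many line segments, rays and lines. -/
structure IsPolygon (Ω : Set ℂ) : Prop where
  isOpen : IsOpen Ω
  isConnected : IsConnected Ω
  frontier_eq : ∃ 𝒮 : Set (Set ℂ), 𝒮.Finite ∧ (∀ S ∈ 𝒮, IsStraightPiece S) ∧ frontier Ω = ⋃₀ 𝒮

/-- The point at distance `r` from `p` in the direction `e^{it}`. -/
def polarPoint (p : ℂ) (r t : ℝ) : ℂ := p + r * Complex.exp (t * Complex.I)

/-- The corners of `Ω` over finite boundary points, as triples `(p, θ, β)`: near `p`, the open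
sector with apex `p` swept counterclockwise from direction `θ` to direction `θ + β` lies in `Ω`,
while its two sides do not meet `Ω`. So `β` is the interior angle. A boundary point that is
approached from several sides of the boundary carries several corners. -/
def corners (Ω : Set ℂ) : Set (ℂ × ℝ × ℝ) :=
  {c | c.2.1 ∈ Set.Ico 0 (2 * Real.pi) ∧ c.2.2 ∈ Set.Ioc 0 (2 * Real.pi) ∧
    ∃ ε > 0, ∀ r ∈ Set.Ioo 0 ε,
      polarPoint c.1 r c.2.1 ∉ Ω ∧ polarPoint c.1 r (c.2.1 + c.2.2) ∉ Ω ∧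
      ∀ t ∈ Set.Ioo c.2.1 (c.2.1 + c.2.2), polarPoint c.1 r t ∈ Ω}

/-- Concave vertices: interior angle larger than `π` (up to `2π`, the tip of a slit). -/
def concaveVertices (Ω : Set ℂ) : Set (ℂ × ℝ × ℝ) := {c ∈ corners Ω | Real.pi < c.2.2}

/-- Convex vertices at finite points: interior angle smaller than `π`. -/
def finiteConvexVertices (Ω : Set ℂ) : Set (ℂ × ℝ × ℝ) := {c ∈ corners Ω | c.2.2 < Real.pi}

/-- The connected components of the part of `Ω` outside a closed disk. For a polygon and all large
radii these are the vertices at infinity; the interior angle at infinity is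
nonpositive by convention, so that all of them are convex. -/
abbrev OuterComponents (Ω : Set ℂ) (R : ℝ) : Type :=
  ConnectedComponents ↥{w : ℂ | w ∈ Ω ∧ R < ‖w‖}

/-- `Ω` has exactly `n` convex vertices, finite ones and those at infinity together. -/
def HasConvexVertexCount (Ω : Set ℂ) (n : ℕ) : Prop :=
  ∀ᶠ R : ℝ in atTop, (finiteConvexVertices Ω).encard + ENat.card (OuterComponents Ω R) = n

/-- `Ω` has exactly `n` concave vertices. -/
def HasConcaveVertexCount (Ω : Set ℂ) (n : ℕ) : Prop :=
  (concaveVertices Ω).encard = n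

/-- `B` is, on the unit disk, a finite Blaschke product of degree `n`. -/
def IsFiniteBlaschkeProduct (n : ℕ) (B : ℂ → ℂ) : Prop :=
  ∃ (c : ℂ) (a : Fin n → ℂ), ‖c‖ = 1 ∧ (∀ j, ‖a j‖ < 1) ∧
    ∀ z ∈ Metric.ball (0 : ℂ) 1, B z = c * ∏ j, (z - a j) / (1 - (starRingEnd ℂ) (a j) * z)

open Classical in
/-- The pole `P_f(ζ) = ζ + 2 f'(ζ) / f''(ζ)` of the best Möbius approximation of `f` at `ζ`, a point
of the Riemann sphere, equal to `∞` when `f''(ζ) = 0`. -/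
def bmaPole (f : ℂ → ℂ) (ζ : ℂ) : OnePoint ℂ :=
  if deriv (deriv f) ζ = 0 then OnePoint.infty
  else ((ζ + 2 * (deriv f ζ / deriv (deriv f) ζ) : ℂ) : OnePoint ℂ)

/-- The coordinate `w ↦ w` of the sphere, used near finite points (junk value `0` at `∞`). -/
def sphereChart (w : OnePoint ℂ) : ℂ := w.elim 0 id

/-- The coordinate `w ↦ 1/w` of the sphere, used near `∞`, which it maps to `0`. -/
def sphereChartInfty (w : OnePoint ℂ) : ℂ := w.elim 0 (fun u => u⁻¹)

open Classical in
/-- The multiplicity with which a sphere-valued holomorphic map `g` takes the value `b` at `z`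
(zero if `g z ≠ b`). -/
def valueMultiplicity (g : ℂ → OnePoint ℂ) (b : OnePoint ℂ) (z : ℂ) : ℕ∞ :=
  if g z = b then
    if b = OnePoint.infty then analyticOrderAt (fun w => sphereChartInfty (g w)) z
    else analyticOrderAt (fun w => sphereChart (g w) - sphereChart b) z
  else 0

/-- In `U`, the map `g` takes the value `b` exactly `n` times, counted with multiplicity. -/
def TakesValueExactly (g : ℂ → OnePoint ℂ) (U : Set ℂ) (b : OnePoint ℂ) (n : ℕ) : Prop :=
  {z ∈ U | g z = b}.Finite ∧ ∑ᶠ z ∈ U, valueMultiplicity g b z = n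

end

/-! The analytic half is the Schwarz-Christoffel formula, proved for all polygons at once, slit or
unbounded. Put F = f''/f'. Since the boundary of Ω is straight off its corners, Schwarz reflection
makes 1 + zF purely imaginary on the unit circle, except at finitely many points a. There, in the
coordinate z = a e^{is}, the function i(1 + zF) has principal part γ(a)/s with γ(a) real. Over a
corner of angle β, f is a power map after a change of variable that is real on the axis, and γ = β/π
- 1 (`exists_isPrevertex`, `IsPrevertex.tendsto_curvatureFn`).

At a point where f tends to ∞ no local model of Ω is used. A Koebe type bound limits the growth of F
(`norm_deriv_deriv_div_deriv_le`), so that the singularity is at most a simple pole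
(`exists_hasAngleIndex`), and growth along the radius forces γ < 0 (`HasAngleIndex.neg_of_tendsto`).
Only this sign is needed. Such points are finite in number, since accumulating ones would put a
whole line free of exceptional points into the boundary (`finite_poleSet`). Subtracting the kernels
γ(a)(z + a)/(2(z - a)) leaves a constant, whence F = ∑ γ(a)/(z - a) and ∑ γ(a) = -2
(`schwarzChristoffel`).

The rest is algebra. Write F = N/D with D = ∏ (z - a). Then P_f = q/N with q = zN + 2D, and on the
circle q is a unimodular multiple of the conjugate of N (`exists_reflectedNumerator_eq`). Hence q/N
is a quotient of Blaschke products, with zeros and poles at the zeros of q and N in the disk. To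
count these, zN = H - D where H/D = ½ ∑ γ(a)(z + a)/(z - a) has real part 0 on the circle. Moving
the nodes with γ > 0 outwards while fading their terms keeps the real part of the corresponding
function minus 1 negative, and leaves one root in the disk for each node with γ < 0
(`diskRootCount_herglotz`). By degree, q has one root for each node with γ > 0. As |q| = |N| on the
circle, Rouché's theorem for q - bN counts the values b.

Finally, corners biject with their points on the circle (`encard_corners_eq`) and vertices at
infinity with the points where f tends to ∞ (`eventually_card_outerComponents`). So γ < 0 marks the
convex and γ > 0 the concave vertices. -/

/-! ### Gluing holomorphic functions across the real axis -/

/-- Morera's theorem with rectangles. A rectangle that straddles the axis is cut along it; each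
piece has its interior off the axis, where Cauchy's theorem for functions merely continuous up to
the boundary applies. -/
theorem differentiableOn_ball_of_continuousOn_of_off_real {F : ℂ → ℂ} {c : ℂ} {r : ℝ}
    (hc : ContinuousOn F (Metric.ball c r))
    (hd : ∀ s ∈ Metric.ball c r, s.im ≠ 0 → DifferentiableAt ℂ F s) :
    DifferentiableOn ℂ F (Metric.ball c r) := by
  refine (Complex.IsConservativeOn.isExactOn_ball hc ?_).differentiableOn Metric.isOpen_ball
  have key : ∀ z w : ℂ, Complex.Rectangle z w ⊆ Metric.ball c r →
      (0 : ℝ) ∉ Set.Ioo (min z.im w.im) (max z.im w.im) →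
      (∫ x : ℝ in z.re..w.re, F (x + z.im * Complex.I)) -
      (∫ x : ℝ in z.re..w.re, F (x + w.im * Complex.I)) +
      Complex.I • (∫ y : ℝ in z.im..w.im, F (w.re + y * Complex.I)) -
      Complex.I • (∫ y : ℝ in z.im..w.im, F (z.re + y * Complex.I)) = 0 := by
    intro z w hzw h0
    refine Complex.integral_boundary_rect_eq_zero_of_continuousOn_of_differentiableOn F z w
      (hc.mono hzw) ?_
    intro s hs
    rw [Complex.mem_reProdIm] at hs
    refine (hd s (hzw ?_) ?_).differentiableWithinAt
    · rw [Complex.Rectangle, Complex.mem_reProdIm]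
      exact ⟨Set.Ioo_subset_Icc_self hs.1, Set.Ioo_subset_Icc_self hs.2⟩
    · intro h
      exact h0 (h ▸ hs.2)
  intro z w hzw
  rw [← add_eq_zero_iff_eq_neg, Complex.wedgeIntegral_add_wedgeIntegral_eq]
  by_cases h0 : (0 : ℝ) ∉ Set.Ioo (min z.im w.im) (max z.im w.im)
  · exact key z w hzw h0
  push Not at h0
  have h0' : (0 : ℝ) ∈ Set.uIcc z.im w.im := Set.Ioo_subset_Icc_self h0
  have s1 : Set.uIcc z.im 0 ⊆ Set.uIcc z.im w.im := Set.uIcc_subset_uIcc_left h0'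
  have s2 : Set.uIcc 0 w.im ⊆ Set.uIcc z.im w.im := Set.uIcc_subset_uIcc_right h0'
  have r1 : Complex.Rectangle z (w.re : ℂ) ⊆ Complex.Rectangle z w := by
    intro s hs
    simp only [Complex.Rectangle, Complex.mem_reProdIm, Complex.ofReal_re, Complex.ofReal_im] at hs ⊢
    exact ⟨hs.1, s1 hs.2⟩
  have r2 : Complex.Rectangle (z.re : ℂ) w ⊆ Complex.Rectangle z w := by
    intro s hs
    simp only [Complex.Rectangle, Complex.mem_reProdIm, Complex.ofReal_re, Complex.ofReal_im] at hs ⊢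
    exact ⟨hs.1, s2 hs.2⟩
  have k1 := key z (w.re : ℂ) (r1.trans hzw) (by
    simp only [Complex.ofReal_im, Set.mem_Ioo, not_and, not_lt]
    intro h
    rcases min_lt_iff.1 h with h | h
    · exact max_le h.le le_rfl
    · exact absurd h (lt_irrefl _))
  have k2 := key (z.re : ℂ) w (r2.trans hzw) (by
    simp only [Complex.ofReal_im, Set.mem_Ioo, not_and, not_lt]
    intro h
    rcases min_lt_iff.1 h with h | h
    · exact absurd h (lt_irrefl _)
    · exact max_le le_rfl h.le)
  simp only [Complex.ofReal_im, Complex.ofReal_re] at k1 k2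
  have int : ∀ x : ℝ, x ∈ Set.uIcc z.re w.re → ∀ a b : ℝ, Set.uIcc a b ⊆ Set.uIcc z.im w.im →
      IntervalIntegrable (fun y : ℝ => F (x + y * Complex.I)) MeasureTheory.volume a b := by
    intro x hx a b hab
    apply ContinuousOn.intervalIntegrable
    refine hc.comp (by fun_prop) ?_
    intro y hy
    apply hzw
    simp only [Complex.Rectangle, Complex.mem_reProdIm]
    exact ⟨by simpa using hx, by simpa using hab hy⟩
  rw [← intervalIntegral.integral_add_adjacent_intervals
      (int w.re Set.right_mem_uIcc z.im 0 s1) (int w.re Set.right_mem_uIcc 0 w.im s2),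
    ← intervalIntegral.integral_add_adjacent_intervals
      (int z.re Set.left_mem_uIcc z.im 0 s1) (int z.re Set.left_mem_uIcc 0 w.im s2)]
  simp only [smul_eq_mul] at *
  linear_combination k1 + k2

theorem convex_upper_ball (c : ℂ) (r : ℝ) : Convex ℝ (Metric.ball c r ∩ {s : ℂ | 0 < s.im}) :=
  (convex_ball c r).inter (convex_halfSpace_im_gt 0)

theorem convex_lower_ball (c : ℂ) (r : ℝ) : Convex ℝ (Metric.ball c r ∩ {s : ℂ | s.im < 0}) :=
  (convex_ball c r).inter (convex_halfSpace_im_lt 0)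

theorem isOpen_upper_ball (c : ℂ) (r : ℝ) : IsOpen (Metric.ball c r ∩ {s : ℂ | 0 < s.im}) :=
  Metric.isOpen_ball.inter (isOpen_lt continuous_const Complex.continuous_im)

theorem isOpen_lower_ball (c : ℂ) (r : ℝ) : IsOpen (Metric.ball c r ∩ {s : ℂ | s.im < 0}) :=
  Metric.isOpen_ball.inter (isOpen_lt Complex.continuous_im continuous_const)

/-- A bounded holomorphic function on an open convex set has a primitive there which extends to a
Lipschitz function on the plane. -/
theorem exists_lipschitz_primitive {G : ℂ → ℂ} {U : Set ℂ} (hU : Convex ℝ U) (hUo : IsOpen U)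
    (hG : DifferentiableOn ℂ G U) {M : ℝ} (hM : ∀ s ∈ U, ‖G s‖ ≤ M) :
    ∃ P : ℂ → ℂ, Continuous P ∧ ∀ s ∈ U, HasDerivAt P (G s) s := by
  obtain ⟨Q, hQ⟩ := hU.exists_forall_hasDerivWithinAt hG
  have hL : LipschitzOnWith (Real.toNNReal M) Q U :=
    hU.lipschitzOnWith_of_nnnorm_hasDerivWithin_le (f' := G) hQ (fun s hs => by
      rw [← NNReal.coe_le_coe]
      exact (hM s hs).trans (Real.le_coe_toNNReal M))
  obtain ⟨P, hP, hPQ⟩ := hL.extend_finite_dimension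
  refine ⟨P, hP.continuous, fun s hs => ?_⟩
  have h1 : HasDerivAt Q (G s) s := (hQ s hs).hasDerivAt (hUo.mem_nhds hs)
  exact h1.congr_of_eventuallyEq (Filter.eventuallyEq_of_mem (hUo.mem_nhds hs) hPQ.symm)

/-- Neither function needs boundary values: only the difference at conjugate points must tend to 0.
The primitives, being Lipschitz, do extend to the axis, and their jump is constant there. After a
shift by that constant they glue to a continuous function, which is holomorphic by the Morera
argument; `H` is its derivative. -/
theorem exists_holomorphic_glue {x₀ r M : ℝ} {Gp Gm : ℂ → ℂ}
    (hp : DifferentiableOn ℂ Gp (Metric.ball (x₀ : ℂ) r ∩ {s | 0 < s.im}))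
    (hm : DifferentiableOn ℂ Gm (Metric.ball (x₀ : ℂ) r ∩ {s | s.im < 0}))
    (bp : ∀ s ∈ Metric.ball (x₀ : ℂ) r ∩ {s | 0 < s.im}, ‖Gp s‖ ≤ M)
    (bm : ∀ s ∈ Metric.ball (x₀ : ℂ) r ∩ {s | s.im < 0}, ‖Gm s‖ ≤ M)
    (h : ∀ x : ℝ, (x : ℂ) ∈ Metric.ball (x₀ : ℂ) r →
      Tendsto (fun s => Gp s - Gm ((starRingEnd ℂ) s)) (𝓝[{s | 0 < s.im}] (x : ℂ)) (𝓝 0)) :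
    ∃ H : ℂ → ℂ, DifferentiableOn ℂ H (Metric.ball (x₀ : ℂ) r) ∧
      (∀ s ∈ Metric.ball (x₀ : ℂ) r, 0 < s.im → H s = Gp s) ∧
      (∀ s ∈ Metric.ball (x₀ : ℂ) r, s.im < 0 → H s = Gm s) := by
  obtain ⟨P, hPc, hP⟩ := exists_lipschitz_primitive (convex_upper_ball _ r) (isOpen_upper_ball _ r) hp bp
  obtain ⟨Q, hQc, hQ⟩ := exists_lipschitz_primitive (convex_lower_ball _ r) (isOpen_lower_ball _ r) hm bm
  set I := Set.Ioo (x₀ - r) (x₀ + r) with hI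
  have memI : ∀ x : ℝ, x ∈ I ↔ (x : ℂ) ∈ Metric.ball (x₀ : ℂ) r := by
    intro x
    rw [Metric.mem_ball, Complex.dist_eq, ← Complex.ofReal_sub, Complex.norm_real, Real.norm_eq_abs,
      abs_lt, hI, Set.mem_Ioo]
    constructor <;> rintro ⟨h1, h2⟩ <;> constructor <;> linarith
  -- the jump of the primitives has zero derivative along the axis
  have hD : ∀ x ∈ I, HasDerivAt (fun x : ℝ => P x - Q x) 0 x := by
    intro x hx
    rw [hasDerivAt_iff_isLittleO, Asymptotics.isLittleO_iff]
    intro η hη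
    have h1 := (h x ((memI x).1 hx)).eventually (Metric.ball_mem_nhds 0 hη)
    rw [eventually_nhdsWithin_iff] at h1
    have h2 := h1.and (Metric.isOpen_ball.mem_nhds ((memI x).1 hx))
    obtain ⟨ρ, hρ, hρ'⟩ := Metric.eventually_nhds_iff_ball.1 h2
    filter_upwards [Metric.ball_mem_nhds x (half_pos hρ)] with y hy
    -- The mean value inequality is applied at heights ε and -ε, where the primitives are
    -- differentiable; then ε tends to 0.
    have hbd : ∀ ε ∈ Set.Ioo 0 (ρ / 2), ‖(P (y + ε * Complex.I) - Q (y - ε * Complex.I)) -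
        (P (x + ε * Complex.I) - Q (x - ε * Complex.I))‖ ≤ η * ‖y - x‖ := by
      intro ε hε
      have hmem : ∀ t ∈ Metric.ball x (ρ / 2), ((t : ℂ) + ε * Complex.I) ∈ Metric.ball (x : ℂ) ρ := by
        intro t ht
        rw [Metric.mem_ball, Complex.dist_eq] at *
        rw [Real.dist_eq] at ht
        calc ‖(t : ℂ) + ε * Complex.I - x‖ = ‖((t - x : ℝ) : ℂ) + ε * Complex.I‖ := by
              push_cast; congr 1; ring
          _ ≤ ‖((t - x : ℝ) : ℂ)‖ + ‖(ε : ℂ) * Complex.I‖ := norm_add_le _ _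
          _ < ρ / 2 + ρ / 2 := by
              rw [Complex.norm_real, norm_mul, Complex.norm_I, mul_one, Complex.norm_real,
                Real.norm_eq_abs, Real.norm_eq_abs, abs_of_pos hε.1]
              exact add_lt_add ht hε.2
          _ = ρ := by ring
      have hder : ∀ t ∈ Metric.ball x (ρ / 2), HasDerivWithinAt
          (fun t : ℝ => P (t + ε * Complex.I) - Q (t - ε * Complex.I))
          (Gp (t + ε * Complex.I) - Gm (t - ε * Complex.I)) (Metric.ball x (ρ / 2)) t := by
        intro t ht
        have hb := (hρ' _ (hmem t ht)).2
        have hconj : (starRingEnd ℂ) ((t : ℂ) + ε * Complex.I) = t - ε * Complex.I := by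
          simp [sub_eq_add_neg]
        have hb' : ((t : ℂ) - ε * Complex.I) ∈ Metric.ball (x₀ : ℂ) r := by
          rw [← hconj, Metric.mem_ball, Complex.dist_eq]
          have hb1 : ‖(t : ℂ) + ε * Complex.I - x₀‖ < r := by
            rw [← Complex.dist_eq]; exact hb
          rw [← Complex.norm_conj]
          simpa using hb1
        have d1 := (hP _ ⟨hb, by simpa using hε.1⟩)
        have d2 := (hQ _ ⟨hb', by simpa using hε.1⟩)
        have e1 : HasDerivAt (fun t : ℝ => (t : ℂ) + ε * Complex.I) 1 t :=
          (Complex.ofRealCLM.hasDerivAt (x := t)).add_const _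
        have e2 : HasDerivAt (fun t : ℝ => (t : ℂ) - ε * Complex.I) 1 t :=
          (Complex.ofRealCLM.hasDerivAt (x := t)).sub_const _
        have := (d1.comp t e1).sub (d2.comp t e2)
        rw [mul_one, mul_one] at this
        exact this.hasDerivWithinAt
      have := (convex_ball x (ρ / 2)).norm_image_sub_le_of_norm_hasDerivWithin_le (C := η) hder
        (fun t ht => by
          have hb := (hρ' _ (hmem t ht)).1 (by simpa using hε.1)
          have hconj : (starRingEnd ℂ) ((t : ℂ) + ε * Complex.I) = t - ε * Complex.I := by
            simp [sub_eq_add_neg]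
          rw [hconj, dist_zero_right] at hb
          exact hb.le) (Metric.mem_ball_self (half_pos hρ)) hy
      simpa using this
    have hlim : Tendsto (fun ε : ℝ => ‖(P (y + ε * Complex.I) - Q (y - ε * Complex.I)) -
        (P (x + ε * Complex.I) - Q (x - ε * Complex.I))‖) (𝓝[>] 0)
        (𝓝 ‖(P y - Q y) - (P x - Q x)‖) := by
      have : Continuous (fun ε : ℝ => ‖(P (y + ε * Complex.I) - Q (y - ε * Complex.I)) -
        (P (x + ε * Complex.I) - Q (x - ε * Complex.I))‖) := by fun_prop
      have := (this.tendsto 0).mono_left (nhdsWithin_le_nhds (s := Set.Ioi 0))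
      simpa using this
    have := le_of_tendsto hlim (by
      filter_upwards [Ioo_mem_nhdsGT (half_pos hρ)] with ε hε using hbd ε hε)
    simpa using this
  set d := P x₀ - Q x₀ with hd
  have hconst : ∀ x ∈ I, P x - Q x = d := by
    intro x hx
    have hr : 0 < r := by have := hx.1; have := hx.2; linarith
    have hx₀ : x₀ ∈ I := ⟨by linarith, by linarith⟩
    have := (convex_Ioo (x₀ - r) (x₀ + r)).norm_image_sub_le_of_norm_hasDerivWithin_le (C := 0)
      (fun t ht => (hD t ht).hasDerivWithinAt) (fun t _ => by simp) hx₀ hx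
    rw [zero_mul, norm_le_zero_iff, sub_eq_zero] at this
    exact this
  set T : ℂ → ℂ := fun s => if 0 ≤ s.im then P s else Q s + d with hT
  have hTc : ContinuousOn T (Metric.ball (x₀ : ℂ) r) := by
    apply ContinuousOn.if
    · rintro s ⟨hs1, hs2⟩
      have : s.im = 0 := by
        have := frontier_le_subset_eq continuous_const Complex.continuous_im hs2
        exact this.symm
      have hs : s = ((s.re : ℝ) : ℂ) := by apply Complex.ext <;> simp [this]
      rw [hs] at hs1 ⊢
      rw [← hconst _ ((memI _).2 hs1)]
      ring
    · exact hPc.continuousOn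
    · exact (hQc.add continuous_const).continuousOn
  have hTp : ∀ s ∈ Metric.ball (x₀ : ℂ) r, 0 < s.im → HasDerivAt T (Gp s) s := by
    intro s hs h0
    refine (hP s ⟨hs, h0⟩).congr_of_eventuallyEq ?_
    filter_upwards [(isOpen_lt continuous_const Complex.continuous_im).mem_nhds h0] with z hz
    exact if_pos (le_of_lt hz)
  have hTm : ∀ s ∈ Metric.ball (x₀ : ℂ) r, s.im < 0 → HasDerivAt T (Gm s) s := by
    intro s hs h0
    refine ((hQ s ⟨hs, h0⟩).add_const d).congr_of_eventuallyEq ?_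
    filter_upwards [(isOpen_lt Complex.continuous_im continuous_const).mem_nhds h0] with z hz
    exact if_neg (not_le.2 hz)
  have hTd := differentiableOn_ball_of_continuousOn_of_off_real hTc (fun s hs h0 => by
    rcases lt_or_gt_of_ne h0 with h0 | h0
    · exact (hTm s hs h0).differentiableAt
    · exact (hTp s hs h0).differentiableAt)
  exact ⟨deriv T, hTd.deriv Metric.isOpen_ball, fun s hs h0 => (hTp s hs h0).deriv,
    fun s hs h0 => (hTm s hs h0).deriv⟩


/-! ### Injective holomorphic functions -/

/-- At a critical point, f - f(z) is a constant times φⁿ with n ≥ 2 and φ locally invertible. Points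
where φ equals u and ζu, for a primitive n-th root of unity ζ, then have the same image. -/
theorem deriv_ne_zero_of_injOn {f : ℂ → ℂ} {U : Set ℂ} (hU : IsOpen U)
    (hf : DifferentiableOn ℂ f U) (hi : Set.InjOn f U) {z : ℂ} (hz : z ∈ U) : deriv f z ≠ 0 := by
  intro h0
  have hUz : U ∈ 𝓝 z := hU.mem_nhds hz
  have hfa : AnalyticAt ℂ f z := hf.analyticAt hUz
  have hF : AnalyticAt ℂ (fun w => f w - f z) z := hfa.sub analyticAt_const
  have hne : analyticOrderAt (fun w => f w - f z) z ≠ ⊤ := by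
    intro htop
    rw [analyticOrderAt_eq_top] at htop
    have h1 : ∀ᶠ w in 𝓝[≠] z, f w - f z = 0 ∧ w ∈ U :=
      (htop.and hUz).filter_mono nhdsWithin_le_nhds
    obtain ⟨w, ⟨hw, hwU⟩, hwz⟩ := (h1.and self_mem_nhdsWithin).exists
    exact hwz (hi hwU hz (sub_eq_zero.1 hw))
  obtain ⟨n, hn⟩ := WithTop.ne_top_iff_exists.mp hne
  obtain ⟨h, han, hhne, heq⟩ := hF.analyticOrderAt_eq_natCast.mp hn.symm
  have hn2 : 2 ≤ n := by
    by_contra hlt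
    interval_cases n
    · have := heq.self_of_nhds
      simp at this
      exact hhne this.symm
    · have h1 : (fun w => f w - f z) =ᶠ[𝓝 z] fun w => (w - z) * h w := by
        filter_upwards [heq] with w hw
        simpa using hw
      have h2 : HasDerivAt (fun w => (w - z) * h w) (1 * h z + (z - z) * deriv h z) z :=
        ((hasDerivAt_id z).sub_const z).mul han.differentiableAt.hasDerivAt
      have h3 := (h2.congr_of_eventuallyEq h1).deriv
      rw [deriv_sub_const, h0] at h3
      simp at h3
      exact hhne h3.symm
  -- an `n`-th root of `h`
  set q : ℂ → ℂ := fun w => (h w / h z) ^ ((1 : ℂ) / n) with hq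
  have hqa : AnalyticAt ℂ q z := by
    refine (han.div analyticAt_const hhne).cpow analyticAt_const ?_
    simp [div_self hhne]
  have hq0 : q z = 1 := by simp [hq, div_self hhne]
  have hqn : ∀ w, q w ^ n = h w / h z := by
    intro w
    rw [hq]
    simp only [one_div]
    exact Complex.cpow_nat_inv_pow _ (by omega)
  set φ : ℂ → ℂ := fun w => (w - z) * q w with hφ
  have hφa : AnalyticAt ℂ φ z := (analyticAt_id.sub analyticAt_const).mul hqa
  have hφd : HasDerivAt φ 1 z := by
    have h2 : HasDerivAt φ (1 * q z + (z - z) * deriv q z) z :=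
      ((hasDerivAt_id z).sub_const z).mul hqa.differentiableAt.hasDerivAt
    simpa [hq0] using h2
  have hφz : φ z = 0 := by simp [hφ]
  have hmap : Filter.map φ (𝓝 z) = 𝓝 0 := by
    have := hφa.hasStrictDerivAt.map_nhds_eq (by rw [hφd.deriv]; exact one_ne_zero)
    rwa [hφz] at this
  have hev : ∀ᶠ w in 𝓝 z, w ∈ U ∧ f w - f z = φ w ^ n * h z := by
    filter_upwards [hUz, heq] with w hw1 hw2
    refine ⟨hw1, ?_⟩
    rw [hw2, hφ, mul_pow, hqn, smul_eq_mul]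
    field_simp
  have himg : ∀ᶠ u in 𝓝 (0 : ℂ), ∃ w, φ w = u ∧ w ∈ U ∧ f w - f z = u ^ n * h z := by
    rw [← hmap, eventually_map]
    filter_upwards [hev] with w hw
    exact ⟨w, rfl, hw.1, hw.2⟩
  obtain ⟨ζ, hζ⟩ : ∃ ζ : ℂ, IsPrimitiveRoot ζ n := ⟨_, Complex.isPrimitiveRoot_exp n (by omega)⟩
  have himg2 : ∀ᶠ u in 𝓝 (0 : ℂ), ∃ w, φ w = ζ * u ∧ w ∈ U ∧ f w - f z = (ζ * u) ^ n * h z := by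
    have : Tendsto (fun u : ℂ => ζ * u) (𝓝 0) (𝓝 0) := by
      simpa using (continuous_const_mul ζ).tendsto 0
    exact this.eventually himg
  have h1 := ((himg.and himg2).filter_mono (nhdsWithin_le_nhds (s := {0}ᶜ))).and self_mem_nhdsWithin
  obtain ⟨u, ⟨⟨w, hw, hwU, hwf⟩, ⟨w', hw', hwU', hwf'⟩⟩, hu⟩ := h1.exists
  have : w = w' := by
    apply hi hwU hwU'
    rw [mul_pow, hζ.pow_eq_one, one_mul] at hwf'
    have := hwf.trans hwf'.symm
    exact sub_left_injective this
  rw [← this, hw] at hw'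
  have hζ1 : ζ = 1 := by
    have h3 : (ζ - 1) * u = 0 := by linear_combination -hw'
    rcases mul_eq_zero.1 h3 with h | h
    · exact sub_eq_zero.1 h
    · exact absurd h hu
  have := hζ.eq_orderOf
  rw [hζ1, orderOf_one] at this
  omega

/-- Values of an injective holomorphic function near a point fill a neighbourhood. -/
theorem map_nhds_eq_of_injOn {f : ℂ → ℂ} {U : Set ℂ} (hU : IsOpen U)
    (hf : DifferentiableOn ℂ f U) (hi : Set.InjOn f U) {z : ℂ} (hz : z ∈ U) :
    Filter.map f (𝓝 z) = 𝓝 (f z) :=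
  (hf.analyticAt (hU.mem_nhds hz)).hasStrictDerivAt.map_nhds_eq
    (deriv_ne_zero_of_injOn hU hf hi hz)

/-! ### Reflection in the unit circle -/

/-- The reflection is 1/conj(G(conj s)). Only the modulus of G is known to converge, but that
suffices for the gluing lemma, since G - 1/conj G is small when |G| is close to 1. -/
theorem exists_reflection {G : ℂ → ℂ} {r : ℝ} (hr : 0 < r)
    (hG : DifferentiableOn ℂ G (Metric.ball 0 r ∩ {s | 0 < s.im}))
    (hi : Set.InjOn G (Metric.ball 0 r ∩ {s | 0 < s.im}))
    (hlt : ∀ s ∈ Metric.ball (0 : ℂ) r ∩ {s | 0 < s.im}, ‖G s‖ < 1)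
    (hlim : ∀ x : ℝ, (x : ℂ) ∈ Metric.ball (0 : ℂ) r →
      Tendsto (fun s => ‖G s‖) (𝓝[{s | 0 < s.im}] (x : ℂ)) (𝓝 1)) :
    ∃ ρ > 0, ρ ≤ r ∧ ∃ H : ℂ → ℂ, DifferentiableOn ℂ H (Metric.ball 0 ρ) ∧
      Set.InjOn H (Metric.ball 0 ρ) ∧
      (∀ s ∈ Metric.ball (0 : ℂ) ρ, 0 < s.im → H s = G s ∧ ‖H s‖ < 1) ∧
      (∀ s ∈ Metric.ball (0 : ℂ) ρ, s.im = 0 → ‖H s‖ = 1) ∧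
      (∀ s ∈ Metric.ball (0 : ℂ) ρ, s.im < 0 → 1 < ‖H s‖) := by
  -- The radius is shrunk until |G| > 1/2, so that the reflected function is bounded by 2.
  have h0 := (hlim 0 (by simpa using hr)).eventually (lt_mem_nhds (by norm_num : (1 / 2 : ℝ) < 1))
  rw [eventually_nhdsWithin_iff, Complex.ofReal_zero] at h0
  obtain ⟨ρ', hρ', hρ''⟩ := Metric.eventually_nhds_iff_ball.1 h0
  set ρ := min ρ' r with hρdef
  have hρ : 0 < ρ := lt_min hρ' hr
  have hρr : ρ ≤ r := min_le_right _ _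
  have sub : Metric.ball (0 : ℂ) ρ ⊆ Metric.ball 0 r := Metric.ball_subset_ball hρr
  have half : ∀ s ∈ Metric.ball (0 : ℂ) ρ, 0 < s.im → 1 / 2 < ‖G s‖ := fun s hs h =>
    hρ'' s (Metric.ball_subset_ball (min_le_left _ _) hs) h
  set c := starRingEnd ℂ with hc
  have hcb : ∀ s ∈ Metric.ball (0 : ℂ) ρ, c s ∈ Metric.ball (0 : ℂ) ρ := by
    intro s hs
    rw [mem_ball_zero_iff] at *
    rwa [hc, Complex.norm_conj]
  have hcim : ∀ s : ℂ, (c s).im = - s.im := fun s => Complex.conj_im s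
  set Gm : ℂ → ℂ := fun s => (c (G (c s)))⁻¹ with hGm
  have hGmd : DifferentiableOn ℂ Gm (Metric.ball ((0 : ℝ) : ℂ) ρ ∩ {s | s.im < 0}) := by
    rw [Complex.ofReal_zero]
    rintro s ⟨hs, hs'⟩
    have hm : 0 < (c s).im := by rw [hcim]; simpa using hs'
    have h1 : DifferentiableAt ℂ G (c s) :=
      hG.differentiableAt ((isOpen_upper_ball 0 r).mem_nhds ⟨sub (hcb s hs), hm⟩)
    have h2 : DifferentiableAt ℂ (c ∘ G ∘ c) s := by
      rw [hc, differentiableAt_conj_conj_iff]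
      exact h1
    refine (h2.inv ?_).differentiableWithinAt
    have := half _ (hcb s hs) hm
    intro h
    simp only [Function.comp_apply, map_eq_zero] at h
    rw [h] at this
    norm_num at this
  obtain ⟨H, hHd, hHp, hHm⟩ := exists_holomorphic_glue (x₀ := 0) (r := ρ) (M := 2) (Gp := G) (Gm := Gm)
    (hG.mono (by rw [Complex.ofReal_zero]; exact Set.inter_subset_inter_left _ sub)) hGmd
    (fun s hs => by
      rw [Complex.ofReal_zero] at hs
      linarith [hlt s ⟨sub hs.1, hs.2⟩])
    (fun s hs => by
      rw [Complex.ofReal_zero] at hs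
      have hm : 0 < (c s).im := by rw [hcim]; simpa using hs.2
      have := half _ (hcb s hs.1) hm
      rw [hGm]
      simp only [norm_inv, hc, Complex.norm_conj]
      rw [inv_le_comm₀ (by linarith) (by norm_num)]
      linarith)
    (fun x hx => by
      rw [Complex.ofReal_zero] at hx
      have hl := hlim x (sub hx)
      have hev : ∀ᶠ s in 𝓝[{s : ℂ | 0 < s.im}] (x : ℂ), s ∈ Metric.ball (0 : ℂ) ρ ∧ 0 < s.im := by
        filter_upwards [nhdsWithin_le_nhds (Metric.isOpen_ball.mem_nhds hx), self_mem_nhdsWithin]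
          with s h1 h2 using ⟨h1, h2⟩
      have hz : Tendsto (fun s => 2 * (1 - ‖G s‖ ^ 2)) (𝓝[{s : ℂ | 0 < s.im}] (x : ℂ)) (𝓝 0) := by
        have := ((hl.pow 2).const_sub 1).const_mul 2
        simpa using this
      refine squeeze_zero_norm' ?_ hz
      filter_upwards [hev] with s hs
      have h12 := half s hs.1 hs.2
      have h1 := hlt s ⟨sub hs.1, hs.2⟩
      have hne : c (G s) ≠ 0 := by
        intro h
        rw [map_eq_zero] at h
        rw [h] at h12
        norm_num at h12
      have e : G s - Gm (c s) = -(((1 - ‖G s‖ ^ 2 : ℝ) : ℂ) * (c (G s))⁻¹) := by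
        simp only [hGm, hc, Complex.conj_conj] at *
        have h3 := Complex.mul_conj' (G s)
        push_cast
        rw [← h3]
        field_simp
        ring
      rw [e, norm_neg, norm_mul, Complex.norm_real, norm_inv, hc, Complex.norm_conj,
        Real.norm_eq_abs, abs_of_nonneg (by nlinarith [norm_nonneg (G s)]), mul_comm]
      refine mul_le_mul_of_nonneg_right ?_ (by nlinarith [norm_nonneg (G s)])
      rw [inv_le_comm₀ (by linarith) (by norm_num)]
      linarith)
  rw [Complex.ofReal_zero] at hHd hHp hHm
  have up : ∀ s ∈ Metric.ball (0 : ℂ) ρ, 0 < s.im → H s = G s ∧ ‖H s‖ < 1 := fun s hs h =>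
    ⟨hHp s hs h, by rw [hHp s hs h]; exact hlt s ⟨sub hs, h⟩⟩
  have low : ∀ s ∈ Metric.ball (0 : ℂ) ρ, s.im < 0 → 1 < ‖H s‖ := by
    intro s hs h
    have hm : 0 < (c s).im := by rw [hcim]; linarith
    rw [hHm s hs h, hGm]
    simp only [norm_inv, hc, Complex.norm_conj]
    exact (one_lt_inv₀ (by have := half _ (hcb s hs) hm; simp only [hc] at this; linarith)).2
      (hlt _ ⟨sub (hcb s hs), hm⟩)
  have mid : ∀ s ∈ Metric.ball (0 : ℂ) ρ, s.im = 0 → ‖H s‖ = 1 := by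
    intro s hs h
    have hsr : s = ((s.re : ℝ) : ℂ) := by apply Complex.ext <;> simp [h]
    have hl := hlim s.re (by rw [← hsr]; exact sub hs)
    rw [← hsr] at hl
    have hcont : Tendsto (fun w => ‖H w‖) (𝓝[{s : ℂ | 0 < s.im}] s) (𝓝 ‖H s‖) :=
      ((hHd.continuousOn.continuousAt (Metric.isOpen_ball.mem_nhds hs)).norm.tendsto).mono_left
        nhdsWithin_le_nhds
    have hnb : (𝓝[{s : ℂ | 0 < s.im}] s).NeBot := by
      rw [← mem_closure_iff_nhdsWithin_neBot, Complex.closure_setOfPred_lt_im]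
      simp [h]
    refine tendsto_nhds_unique (hcont.congr' ?_) hl
    filter_upwards [nhdsWithin_le_nhds (Metric.isOpen_ball.mem_nhds hs), self_mem_nhdsWithin]
      with w h1 h2
    rw [(up w h1 h2).1]
  have gm_inj : ∀ s ∈ Metric.ball (0 : ℂ) ρ, s.im < 0 → ∀ t ∈ Metric.ball (0 : ℂ) ρ, t.im < 0 →
      H s = H t → s = t := by
    intro s hs h1 t ht h2 e
    rw [hHm s hs h1, hHm t ht h2] at e
    have e2 : G (c s) = G (c t) := by
      have := inv_injective e
      exact (starRingEnd ℂ).injective this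
    have := hi ⟨sub (hcb s hs), by simpa [hcim] using h1⟩ ⟨sub (hcb t ht), by simpa [hcim] using h2⟩ e2
    exact (starRingEnd ℂ).injective this
  have hHa : AnalyticOnNhd ℂ H (Metric.ball 0 ρ) := hHd.analyticOnNhd Metric.isOpen_ball
  have hopen : ∀ s ∈ Metric.ball (0 : ℂ) ρ, 𝓝 (H s) ≤ Filter.map H (𝓝 s) := by
    intro s hs
    rcases (hHa s hs).eventually_constant_or_nhds_le_map_nhds with h | h
    · exfalso
      have hconst := hHa.eqOn_of_preconnected_of_eventuallyEq analyticOnNhd_const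
        (convex_ball 0 ρ).isPreconnected hs h
      have m1 : (Complex.I * (ρ / 2 : ℝ)) ∈ Metric.ball (0 : ℂ) ρ := by
        rw [mem_ball_zero_iff, norm_mul, Complex.norm_I, one_mul, Complex.norm_real,
          Real.norm_eq_abs, abs_of_pos (half_pos hρ)]
        linarith
      have e1 := hconst m1
      have e2 := hconst (Metric.mem_ball_self hρ)
      have u1 := (up _ m1 (by simpa using hρ)).2
      have u2 := mid 0 (Metric.mem_ball_self hρ) rfl
      rw [e1] at u1
      rw [e2] at u2
      linarith
    · exact h
  refine ⟨ρ, hρ, hρr, H, hHd, ?_, up, mid, low⟩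
  intro s hs t ht e
  rcases lt_trichotomy s.im 0 with h1 | h1 | h1 <;> rcases lt_trichotomy t.im 0 with h2 | h2 | h2
  · exact gm_inj s hs h1 t ht h2 e
  · have a := low s hs h1; have b := mid t ht h2; rw [e] at a; linarith
  · have a := low s hs h1; have b := (up t ht h2).2; rw [e] at a; linarith
  · have a := mid s hs h1; have b := low t ht h2; rw [e] at a; linarith
  -- Suppose two real points share a value. Disjoint neighbourhoods of them both cover a
  -- neighbourhood of it, hence a common value of modulus less than 1. Such values come only from
  -- the upper half, where G is injective.
  · by_contra hst
    obtain ⟨U, V, hU, hV, hsU, htV, hUV⟩ := t2_separation hst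
    have a1 : H '' (U ∩ Metric.ball 0 ρ) ∈ 𝓝 (H s) :=
      hopen s hs (Filter.image_mem_map ((hU.inter Metric.isOpen_ball).mem_nhds ⟨hsU, hs⟩))
    have a2 : H '' (V ∩ Metric.ball 0 ρ) ∈ 𝓝 (H s) := by
      rw [e]
      exact hopen t ht (Filter.image_mem_map ((hV.inter Metric.isOpen_ball).mem_nhds ⟨htV, ht⟩))
    have hcl : H s ∈ closure (Metric.ball (0 : ℂ) 1) := by
      rw [closure_ball _ one_ne_zero, mem_closedBall_zero_iff, mid s hs h1]
    obtain ⟨w, ⟨⟨u, ⟨huU, huB⟩, hu⟩, ⟨v, ⟨hvV, hvB⟩, hv⟩⟩, hw⟩ :=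
      mem_closure_iff_nhds.1 hcl _ (Filter.inter_mem a1 a2)
    have inup : ∀ x ∈ Metric.ball (0 : ℂ) ρ, H x = w → 0 < x.im := by
      intro x hx hxw
      rw [mem_ball_zero_iff, ← hxw] at hw
      rcases lt_trichotomy x.im 0 with h | h | h
      · linarith [low x hx h]
      · linarith [mid x hx h]
      · exact h
    have iu := inup u huB hu
    have iv := inup v hvB hv
    have : u = v := by
      apply hi ⟨sub huB, iu⟩ ⟨sub hvB, iv⟩
      rw [← (up u huB iu).1, ← (up v hvB iv).1, hu, hv]
    exact Set.disjoint_left.1 hUV huU (this ▸ hvV)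
  · have a := mid s hs h1; have b := (up t ht h2).2; rw [e] at a; linarith
  · have a := (up s hs h1).2; have b := low t ht h2; rw [e] at a; linarith
  · have a := (up s hs h1).2; have b := mid t ht h2; rw [e] at a; linarith
  · apply hi ⟨sub hs, h1⟩ ⟨sub ht, h2⟩
    rw [← (up s hs h1).1, ← (up t ht h2).1, e]


/-! ### Inverses of injective holomorphic functions and Koebe type distortion bounds -/

theorem invFunOn_mem_ball {f : ℂ → ℂ} {U : Set ℂ} {w : ℂ} (hw : w ∈ f '' U) :
    Function.invFunOn f U w ∈ U ∧ f (Function.invFunOn f U w) = w :=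
  ⟨Function.invFunOn_mem hw, Function.invFunOn_eq hw⟩

theorem hasDerivAt_invFunOn {f : ℂ → ℂ} {U : Set ℂ} (hU : IsOpen U)
    (hf : DifferentiableOn ℂ f U) (hi : Set.InjOn f U) {z : ℂ} (hz : z ∈ U) :
    HasDerivAt (Function.invFunOn f U) (deriv f z)⁻¹ (f z) := by
  have hleft : ∀ v ∈ U, Function.invFunOn f U (f v) = v := fun v hv =>
    hi.leftInvOn_invFunOn hv
  have hc : ContinuousAt (Function.invFunOn f U) (f z) := by
    rw [ContinuousAt, hleft z hz]
    rw [← map_nhds_eq_of_injOn hU hf hi hz, tendsto_map'_iff]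
    refine Tendsto.congr' ?_ tendsto_id
    filter_upwards [hU.mem_nhds hz] with v hv
    exact (hleft v hv).symm
  refine HasDerivAt.of_local_left_inverse hc (f := f) ?_ (deriv_ne_zero_of_injOn hU hf hi hz) ?_
  · rw [hleft z hz]
    exact (hf.differentiableAt (hU.mem_nhds hz)).hasDerivAt
  · rw [← map_nhds_eq_of_injOn hU hf hi hz, eventually_map]
    filter_upwards [hU.mem_nhds hz] with v hv
    rw [hleft v hv]

theorem differentiableOn_invFunOn {f : ℂ → ℂ} {U : Set ℂ} (hU : IsOpen U)
    (hf : DifferentiableOn ℂ f U) (hi : Set.InjOn f U) :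
    DifferentiableOn ℂ (Function.invFunOn f U) (f '' U) := by
  rintro _ ⟨z, hz, rfl⟩
  exact (hasDerivAt_invFunOn hU hf hi hz).differentiableAt.differentiableWithinAt

/-- A nonvanishing holomorphic function on a convex open set has a holomorphic logarithm. -/
theorem exists_log_of_convex {f : ℂ → ℂ} {U : Set ℂ} (hU : IsOpen U) (hc : Convex ℝ U)
    (hf : DifferentiableOn ℂ f U) (h0 : ∀ z ∈ U, f z ≠ 0) :
    ∃ l : ℂ → ℂ, (∀ z ∈ U, HasDerivAt l (deriv f z / f z) z) ∧ ∀ z ∈ U, Complex.exp (l z) = f z := by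
  rcases U.eq_empty_or_nonempty with rfl | ⟨z₀, hz₀⟩
  · exact ⟨id, by simp, by simp⟩
  obtain ⟨P, hP⟩ := hc.exists_forall_hasDerivWithinAt ((hf.deriv hU).div hf h0)
  have hP' : ∀ z ∈ U, HasDerivAt P (deriv f z / f z) z := fun z hz =>
    (hP z hz).hasDerivAt (hU.mem_nhds hz)
  have hk : ∀ z ∈ U, f z * Complex.exp (-P z) = f z₀ * Complex.exp (-P z₀) := by
    intro z hz
    have hd : ∀ x ∈ U, HasDerivWithinAt (fun z => f z * Complex.exp (-P z)) 0 U x := by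
      intro x hx
      have h1 : HasDerivAt (fun z => f z * Complex.exp (-P z)) (deriv f x * Complex.exp (-P x) +
          f x * (Complex.exp (-P x) * -(deriv f x / f x))) x :=
        (hf.differentiableAt (hU.mem_nhds hx)).hasDerivAt.mul ((hP' x hx).neg.cexp)
      have h2 : deriv f x * Complex.exp (-P x) +
        f x * (Complex.exp (-P x) * -(deriv f x / f x)) = 0 := by
        have := h0 x hx
        field_simp
        ring
      rw [h2] at h1
      exact h1.hasDerivWithinAt
    have := hc.norm_image_sub_le_of_norm_hasDerivWithin_le (C := 0) hd (fun x _ => by simp) hz₀ hz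
    rw [zero_mul, norm_le_zero_iff, sub_eq_zero] at this
    exact this
  set k := f z₀ * Complex.exp (-P z₀) with hkd
  have hk0 : k ≠ 0 := mul_ne_zero (h0 z₀ hz₀) (Complex.exp_ne_zero _)
  refine ⟨fun z => P z + Complex.log k, fun z hz => (hP' z hz).add_const _, fun z hz => ?_⟩
  rw [Complex.exp_add, Complex.exp_log hk0, ← hk z hz, mul_comm (f z), ← mul_assoc,
    ← Complex.exp_add, add_neg_cancel, Complex.exp_zero, one_mul]

/-- A Bloch type argument: the image of l contains a disk whose radius is comparable to ‖l'(c)‖ρ. A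
disk of radius larger than π contains two points that differ by 2πi, contradicting injectivity of
exp ∘ l. -/
theorem norm_deriv_mul_le_of_injOn_exp {l : ℂ → ℂ} {c : ℂ} {ρ : ℝ} (hρ : 0 < ρ)
    (hl : DifferentiableOn ℂ l (Metric.ball c ρ))
    (hi : Set.InjOn (fun z => Complex.exp (l z)) (Metric.ball c ρ)) :
    ‖deriv l c‖ * ρ ≤ 128 * Real.pi := by
  set R := ρ / 2 with hR
  have hR0 : 0 < R := half_pos hρ
  have hsub : Metric.closedBall c R ⊆ Metric.ball c ρ := Metric.closedBall_subset_ball (by linarith)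
  have hl' : DifferentiableOn ℂ (deriv l) (Metric.ball c ρ) := hl.deriv Metric.isOpen_ball
  -- At the maximum a of |l'| times the distance to the boundary circle, |l'| at most doubles on the
  -- disk about a with half that distance as radius.
  obtain ⟨a, ha, hmax⟩ := (isCompact_closedBall c R).exists_isMaxOn
    (f := fun z => ‖deriv l z‖ * (R - dist z c)) ⟨c, Metric.mem_closedBall_self hR0.le⟩
    (((hl'.continuousOn.mono hsub).norm).mul (by fun_prop))
  rw [isMaxOn_iff] at hmax
  set m := ‖deriv l a‖ with hm
  suffices h : m * (R - dist a c) ≤ 64 * Real.pi by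
    have := hmax c (Metric.mem_closedBall_self hR0.le)
    rw [dist_self, sub_zero] at this
    have h2 : ‖deriv l c‖ * R ≤ 64 * Real.pi := this.trans h
    rw [hR] at h2
    linarith
  by_contra! hcon
  have hpi := Real.pi_pos
  have hm0 : 0 ≤ m := norm_nonneg _
  rw [Metric.mem_closedBall] at ha
  have hr0 : 0 < R - dist a c := by
    by_contra! h
    nlinarith
  have hm1 : 0 < m := by
    by_contra! h
    nlinarith
  set r := (R - dist a c) / 2 with hr
  have hrpos : 0 < r := half_pos hr0
  have hball : ∀ z, dist z a ≤ r → z ∈ Metric.closedBall c R ∧ ‖deriv l z‖ ≤ 2 * m := by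
    intro z hz
    have h1 : dist z c ≤ r + dist a c := (dist_triangle z a c).trans (by linarith)
    have hmem : z ∈ Metric.closedBall c R := by
      rw [Metric.mem_closedBall]; linarith
    refine ⟨hmem, ?_⟩
    have h2 := hmax z hmem
    have h3 : ‖deriv l z‖ * r ≤ m * (2 * r) := by
      calc ‖deriv l z‖ * r ≤ ‖deriv l z‖ * (R - dist z c) :=
            mul_le_mul_of_nonneg_left (by linarith) (norm_nonneg _)
        _ ≤ m * (R - dist a c) := h2
        _ = m * (2 * r) := by rw [hr]; ring
    nlinarith
  have hsub2 : Metric.closedBall a r ⊆ Metric.ball c ρ := fun z hz => hsub (hball z hz).1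
  have h2nd : ∀ z ∈ Metric.ball a (r / 2), ‖deriv (deriv l) z‖ ≤ 4 * m / r := by
    intro z hz
    have hs : Metric.closedBall z (r / 2) ⊆ Metric.closedBall a r := by
      intro w hw
      rw [Metric.mem_closedBall] at *
      rw [Metric.mem_ball] at hz
      linarith [dist_triangle w z a]
    have h1 := Complex.norm_deriv_le_of_forall_mem_sphere_norm_le (half_pos hrpos) (c := z)
      (f := deriv l) (C := 2 * m) (DifferentiableOn.diffContOnCl (by
        rw [closure_ball _ (half_pos hrpos).ne']
        exact hl'.mono (hs.trans hsub2)))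
      (fun w hw => (hball w (hs (Metric.sphere_subset_closedBall hw))).2)
    refine h1.trans (le_of_eq ?_)
    field_simp
    ring
  -- With |l''| ≤ 4m/r this keeps l' within m/2 of l'(a), so |l - l(a)| ≥ mδ/2 on the circle of
  -- radius δ.
  set δ := r / 8 with hδ
  have hδ0 : 0 < δ := by positivity
  have hder : ∀ z ∈ Metric.closedBall a δ, ‖deriv l z - deriv l a‖ ≤ m / 2 := by
    intro z hz
    have hin : ∀ w ∈ Metric.closedBall a δ, w ∈ Metric.ball a (r / 2) := fun w hw =>
      Metric.closedBall_subset_ball (by rw [hδ]; linarith) hw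
    have h1 := (convex_closedBall a δ).norm_image_sub_le_of_norm_deriv_le (f := deriv l)
      (fun w hw => hl'.differentiableAt (Metric.isOpen_ball.mem_nhds (hsub2
        (Metric.closedBall_subset_closedBall (by rw [hδ]; linarith) hw))))
      (fun w hw => h2nd w (hin w hw)) (Metric.mem_closedBall_self hδ0.le) hz
    refine h1.trans ?_
    rw [Metric.mem_closedBall, dist_eq_norm] at hz
    calc 4 * m / r * ‖z - a‖ ≤ 4 * m / r * δ := mul_le_mul_of_nonneg_left hz (by positivity)
      _ = m / 2 := by rw [hδ]; field_simp; ring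
  have hlow : ∀ z ∈ Metric.sphere a δ, m * δ / 2 ≤ ‖l z - l a‖ := by
    intro z hz
    have hdl : ∀ w ∈ Metric.closedBall a δ, DifferentiableAt ℂ l w := fun w hw =>
      hl.differentiableAt (Metric.isOpen_ball.mem_nhds (hsub2
        (Metric.closedBall_subset_closedBall (by rw [hδ]; linarith) hw)))
    have h1 := (convex_closedBall a δ).norm_image_sub_le_of_norm_hasDerivWithin_le
      (f := fun w => l w - deriv l a * w) (f' := fun w => deriv l w - deriv l a) (C := m / 2)
      (fun w hw => by
        have := ((hdl w hw).hasDerivAt.sub ((hasDerivAt_id w).const_mul (deriv l a)))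
        rw [mul_one] at this
        exact this.hasDerivWithinAt)
      hder (Metric.mem_closedBall_self hδ0.le) (Metric.sphere_subset_closedBall hz)
    rw [mem_sphere_iff_norm] at hz
    have e : l z - l a = (l z - deriv l a * z - (l a - deriv l a * a)) + deriv l a * (z - a) := by ring
    have h2 : ‖deriv l a * (z - a)‖ = m * δ := by rw [norm_mul, hz]
    have h3 := norm_sub_norm_le (deriv l a * (z - a))
      (-(l z - deriv l a * z - (l a - deriv l a * a)))
    rw [norm_neg, sub_neg_eq_add, add_comm (deriv l a * (z - a)), ← e, h2] at h3
    rw [hz] at h1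
    linarith
  have himg := DiffContOnCl.ball_subset_image_closedBall (f := l) (z₀ := a) (r := δ)
    (DifferentiableOn.diffContOnCl (by
      rw [closure_ball _ hδ0.ne']
      exact hl.mono ((Metric.closedBall_subset_closedBall (by rw [hδ]; linarith)).trans hsub2)))
    hδ0 hlow (by
      have hda : HasDerivAt l (deriv l a) a := (hl.differentiableAt
        (Metric.isOpen_ball.mem_nhds (hsub2 (Metric.mem_closedBall_self hrpos.le)))).hasDerivAt
      have := hda.eventually_ne (c := l a) (norm_pos_iff.1 hm1)
      exact (this.frequently).filter_mono nhdsWithin_le_nhds)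
  have hbig : Real.pi < m * δ / 2 / 2 := by
    rw [hδ]
    have : m * (R - dist a c) = 2 * (m * r) := by rw [hr]; ring
    rw [this] at hcon
    linarith
  have hp1 : l a + Real.pi * Complex.I ∈ Metric.ball (l a) (m * δ / 2 / 2) := by
    rw [Metric.mem_ball, dist_eq_norm, add_sub_cancel_left, norm_mul, Complex.norm_I, mul_one,
      Complex.norm_real, Real.norm_eq_abs, abs_of_pos hpi]
    exact hbig
  have hp2 : l a - Real.pi * Complex.I ∈ Metric.ball (l a) (m * δ / 2 / 2) := by
    rw [Metric.mem_ball, dist_eq_norm, sub_sub_cancel_left, norm_neg, norm_mul, Complex.norm_I,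
      mul_one, Complex.norm_real, Real.norm_eq_abs, abs_of_pos hpi]
    exact hbig
  obtain ⟨z₁, hz₁, e₁⟩ := himg hp1
  obtain ⟨z₂, hz₂, e₂⟩ := himg hp2
  have hss : Metric.closedBall a δ ⊆ Metric.ball c ρ :=
    (Metric.closedBall_subset_closedBall (by rw [hδ]; linarith)).trans hsub2
  have : z₁ = z₂ := by
    apply hi (hss hz₁) (hss hz₂)
    simp only
    rw [e₁, e₂, Complex.exp_add, Complex.exp_sub, Complex.exp_pi_mul_I]
    ring
  rw [this, e₂] at e₁
  have h2 : (Real.pi : ℂ) * Complex.I = 0 := by linear_combination -e₁ / 2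
  simp [hpi.ne'] at h2

/-- A weak form of the Koebe quarter theorem. -/
theorem ball_subset_image_of_injOn {f : ℂ → ℂ} {c : ℂ} {ρ : ℝ} (hρ : 0 < ρ)
    (hf : DifferentiableOn ℂ f (Metric.ball c ρ)) (hi : Set.InjOn f (Metric.ball c ρ)) :
    Metric.ball (f c) (‖deriv f c‖ * ρ / (128 * Real.pi)) ⊆ f '' Metric.ball c ρ := by
  intro w hw
  by_contra hcon
  have h0 : ∀ z ∈ Metric.ball c ρ, f z - w ≠ 0 := fun z hz h =>
    hcon ⟨z, hz, sub_eq_zero.1 h⟩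
  -- If w is omitted, f - w has a logarithm l, to which the preceding bound applies with l' = f'/(f
  -- - w).
  obtain ⟨l, hl1, hl2⟩ := exists_log_of_convex Metric.isOpen_ball (convex_ball c ρ)
    (hf.sub_const w) h0
  have h1 := norm_deriv_mul_le_of_injOn_exp hρ
    (fun z hz => (hl1 z hz).differentiableAt.differentiableWithinAt)
    (fun z hz z' hz' e => by
      simp only [hl2 z hz, hl2 z' hz'] at e
      exact hi hz hz' (sub_left_injective e))
  have hcm : c ∈ Metric.ball c ρ := Metric.mem_ball_self hρ
  rw [(hl1 c hcm).deriv, deriv_sub_const, norm_div] at h1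
  have hpos : 0 < ‖f c - w‖ := norm_pos_iff.2 (h0 c hcm)
  have hpi := Real.pi_pos
  rw [Metric.mem_ball, dist_comm, dist_eq_norm, lt_div_iff₀ (by positivity)] at hw
  rw [div_mul_eq_mul_div, div_le_iff₀ hpos] at h1
  linarith

/-- The inverse ψ is defined on a disk about f(c) of radius comparable to ‖f'(c)‖ρ, with values
within ρ of c. Cauchy's estimate bounds ψ''(f(c)), which determines f''(c)/f'(c). -/
theorem norm_deriv_deriv_div_deriv_le {f : ℂ → ℂ} {c : ℂ} {ρ : ℝ} (hρ : 0 < ρ)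
    (hf : DifferentiableOn ℂ f (Metric.ball c ρ)) (hi : Set.InjOn f (Metric.ball c ρ)) :
    ‖deriv (deriv f) c / deriv f c‖ ≤ 8 * (128 * Real.pi) ^ 2 / ρ := by
  have hpi := Real.pi_pos
  have hcm : c ∈ Metric.ball c ρ := Metric.mem_ball_self hρ
  have hne : ∀ z ∈ Metric.ball c ρ, deriv f z ≠ 0 := fun z hz =>
    deriv_ne_zero_of_injOn Metric.isOpen_ball hf hi hz
  set δ := ‖deriv f c‖ * ρ / (128 * Real.pi) with hδ
  have hd0 : 0 < ‖deriv f c‖ := norm_pos_iff.2 (hne c hcm)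
  have hδ0 : 0 < δ := by positivity
  have hsub := ball_subset_image_of_injOn hρ hf hi
  set ψ := Function.invFunOn f (Metric.ball c ρ) with hψ
  have hψd : DifferentiableOn ℂ ψ (Metric.ball (f c) δ) :=
    (differentiableOn_invFunOn Metric.isOpen_ball hf hi).mono hsub
  have hψ' : ∀ z ∈ Metric.ball c ρ, HasDerivAt ψ (deriv f z)⁻¹ (f z) := fun z hz =>
    hasDerivAt_invFunOn Metric.isOpen_ball hf hi hz
  have hcl : Metric.closedBall (f c) (δ / 2) ⊆ Metric.ball (f c) δ :=
    Metric.closedBall_subset_ball (by linarith)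
  have hest := Complex.norm_iteratedDeriv_le_of_forall_mem_sphere_norm_le (c := f c) (R := δ / 2)
    (C := ρ) (f := fun w => ψ w - c) 2 (half_pos hδ0)
    (DifferentiableOn.diffContOnCl (by
      rw [closure_ball _ (half_pos hδ0).ne']
      exact (hψd.sub_const c).mono hcl))
    (fun w hw => by
      have h1 := (invFunOn_mem_ball (hsub (hcl (Metric.sphere_subset_closedBall hw)))).1
      rw [Metric.mem_ball, dist_eq_norm] at h1
      exact h1.le)
  have hit : iteratedDeriv 2 (fun w => ψ w - c) (f c) = deriv (deriv ψ) (f c) := by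
    rw [iteratedDeriv_succ, iteratedDeriv_one]
    congr 1
    funext w
    exact deriv_sub_const _
  rw [hit] at hest
  -- differentiate `ψ' (f z) * f' z = 1`
  have hfd : DifferentiableAt ℂ f c := hf.differentiableAt (Metric.isOpen_ball.mem_nhds hcm)
  have hf2 : DifferentiableAt ℂ (deriv f) c :=
    (hf.deriv Metric.isOpen_ball).differentiableAt (Metric.isOpen_ball.mem_nhds hcm)
  have hψ2 : DifferentiableAt ℂ (deriv ψ) (f c) :=
    (hψd.deriv Metric.isOpen_ball).differentiableAt
      (Metric.isOpen_ball.mem_nhds (Metric.mem_ball_self hδ0))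
  have h1 : HasDerivAt (fun z => deriv ψ (f z) * deriv f z)
      (deriv (deriv ψ) (f c) * deriv f c * deriv f c + deriv ψ (f c) * deriv (deriv f) c) c :=
    (hψ2.hasDerivAt.comp c hfd.hasDerivAt).mul hf2.hasDerivAt
  have h2 : (fun z => deriv ψ (f z) * deriv f z) =ᶠ[𝓝 c] fun _ => 1 := by
    filter_upwards [Metric.isOpen_ball.mem_nhds hcm] with z hz
    rw [(hψ' z hz).deriv, inv_mul_cancel₀ (hne z hz)]
  have h3 : deriv (deriv ψ) (f c) * deriv f c * deriv f c + deriv ψ (f c) * deriv (deriv f) c = 0 := by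
    rw [← h1.deriv, h2.deriv_eq, deriv_const]
  rw [(hψ' c hcm).deriv] at h3
  have h4 : deriv (deriv f) c / deriv f c = -(deriv (deriv ψ) (f c) * deriv f c ^ 2) := by
    rw [div_eq_inv_mul]
    linear_combination h3
  rw [h4, norm_neg, norm_mul, norm_pow]
  calc ‖deriv (deriv ψ) (f c)‖ * ‖deriv f c‖ ^ 2
      ≤ (Nat.factorial 2 * ρ / (δ / 2) ^ 2) * ‖deriv f c‖ ^ 2 :=
        mul_le_mul_of_nonneg_right hest (by positivity)
    _ = 8 * (128 * Real.pi) ^ 2 / ρ := by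
        rw [hδ]
        simp only [Nat.factorial]
        push_cast
        field_simp
        ring

/-- An isolated singularity on the real axis, at which a holomorphic function grows at most like
the inverse distance to the axis, is at most a simple pole. -/
theorem exists_analyticAt_eq_mul_of_le_div_im {F : ℂ → ℂ} {r C : ℝ} (hr : 0 < r) (hC : 0 ≤ C)
    (hF : DifferentiableOn ℂ F (Metric.ball 0 r \ {0}))
    (hb : ∀ s ∈ Metric.ball (0 : ℂ) r, s.im ≠ 0 → ‖F s‖ ≤ C / |s.im|) :
    ∃ φ : ℂ → ℂ, AnalyticAt ℂ φ 0 ∧ ∀ᶠ s in 𝓝[≠] (0 : ℂ), φ s = s * F s := by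
  -- Since s² - |s|² = 2i s Im s, the holomorphic factor s² - t² absorbs the blow-up 1/|Im s| on the
  -- whole circle |s| = t.
  have hcircle : ∀ s : ℂ, s ∈ Metric.ball (0 : ℂ) r → ‖F s * (s ^ 2 - (‖s‖ : ℂ) ^ 2)‖ ≤ 2 * C * ‖s‖ := by
    intro s hs
    have e : s ^ 2 - (‖s‖ : ℂ) ^ 2 = s * (2 * Complex.I * s.im) := by
      rw [← Complex.mul_conj' s]
      have h : s - (starRingEnd ℂ) s = 2 * Complex.I * s.im := by
        rw [Complex.sub_conj]
        push_cast
        ring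
      linear_combination s * h
    have e2 : ‖F s * (s ^ 2 - (‖s‖ : ℂ) ^ 2)‖ = ‖F s‖ * |s.im| * (2 * ‖s‖) := by
      rw [e]
      simp only [norm_mul, Complex.norm_I, Complex.norm_real, Real.norm_eq_abs, Complex.norm_two]
      ring
    rw [e2]
    by_cases h : s.im = 0
    · rw [h, abs_zero, mul_zero, zero_mul]; positivity
    · have := hb s hs h
      rw [le_div_iff₀ (abs_pos.2 h)] at this
      nlinarith [norm_nonneg s]
  set R := r / 2 with hR
  have hR0 : 0 < R := half_pos hr
  -- Maximum principle on the annulus ρ < |s| < R, with one such factor for each bounding circle.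
  -- The bound does not depend on ρ, so ρ can tend to 0, which bounds z²F.
  have hmean : ∀ z : ℂ, z ≠ 0 → ‖z‖ < R → ∀ ρ ∈ Set.Ioo 0 ‖z‖,
      ‖F z * (z ^ 2 - (ρ : ℂ) ^ 2) * (z ^ 2 - (R : ℂ) ^ 2)‖ ≤ 4 * C * R ^ 3 := by
    intro z hz hzR ρ hρ
    have hρR : ρ < R := hρ.2.trans hzR
    set U : Set ℂ := {s | ρ < ‖s‖ ∧ ‖s‖ < R} with hU
    have hcl : closure U ⊆ {s | ρ ≤ ‖s‖ ∧ ‖s‖ ≤ R} := by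
      refine closure_minimal (fun s hs => ⟨hs.1.le, hs.2.le⟩) ?_
      exact (isClosed_le continuous_const continuous_norm).inter
        (isClosed_le continuous_norm continuous_const)
    have hUo : IsOpen U := (isOpen_lt continuous_const continuous_norm).inter
      (isOpen_lt continuous_norm continuous_const)
    have hbd : Bornology.IsBounded U := by
      refine Metric.isBounded_ball.subset (s := U) (t := Metric.ball 0 R) ?_
      intro s hs
      rw [mem_ball_zero_iff]
      exact hs.2
    refine Complex.norm_le_of_forall_mem_frontier_norm_le hbd
      (f := fun s => F s * (s ^ 2 - (ρ : ℂ) ^ 2) * (s ^ 2 - (R : ℂ) ^ 2)) ?_ ?_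
      (subset_closure ⟨hρ.2, hzR⟩)
    · apply DifferentiableOn.diffContOnCl
      have hFc : DifferentiableOn ℂ F (closure U) := by
        refine hF.mono fun s hs => ?_
        have := hcl hs
        refine ⟨?_, ?_⟩
        · rw [mem_ball_zero_iff]; linarith [this.2]
        · intro h
          rw [Set.mem_singleton_iff] at h
          have h1 := this.1
          rw [h, norm_zero] at h1
          linarith [hρ.1]
      refine (hFc.mul ?_).mul ?_ <;> fun_prop
    · intro s hs
      have hs1 : s ∈ closure U := frontier_subset_closure hs
      have hs2 := hcl hs1
      have hs3 : s ∉ U := fun h => by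
        rw [hUo.frontier_eq] at hs
        exact hs.2 h
      have hsb : s ∈ Metric.ball (0 : ℂ) r := by
        rw [mem_ball_zero_iff]; linarith [hs2.2]
      have h1 := hcircle s hsb
      have hbound : ∀ t : ℝ, 0 ≤ t → t ≤ R → ‖s ^ 2 - (t : ℂ) ^ 2‖ ≤ 2 * R ^ 2 := by
        intro t ht htR
        refine (norm_sub_le _ _).trans ?_
        rw [norm_pow, norm_pow, Complex.norm_real, Real.norm_eq_abs, abs_of_nonneg ht]
        nlinarith [norm_nonneg s, hs2.2]
      have hsn : ‖s‖ = ρ ∨ ‖s‖ = R := by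
        by_contra! h
        exact hs3 ⟨lt_of_le_of_ne hs2.1 (Ne.symm h.1), lt_of_le_of_ne hs2.2 h.2⟩
      rcases hsn with h | h
      · rw [h] at h1
        rw [norm_mul]
        calc _ ≤ (2 * C * ρ) * (2 * R ^ 2) := mul_le_mul h1 (hbound R hR0.le le_rfl)
              (norm_nonneg _) (by have := hρ.1; positivity)
          _ ≤ (2 * C * R) * (2 * R ^ 2) := by
              apply mul_le_mul_of_nonneg_right _ (by positivity)
              apply mul_le_mul_of_nonneg_left hρR.le (by positivity)
          _ = 4 * C * R ^ 3 := by ring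
      · rw [h] at h1
        rw [mul_right_comm, norm_mul]
        calc _ ≤ (2 * C * R) * (2 * R ^ 2) := mul_le_mul h1 (hbound ρ hρ.1.le hρR.le)
              (norm_nonneg _) (by positivity)
          _ = 4 * C * R ^ 3 := by ring
  have hsq : ∀ z : ℂ, z ≠ 0 → ‖z‖ < R / 2 → ‖z ^ 2 * F z‖ ≤ 8 * C * R := by
    intro z hz hzR
    have hlim : Tendsto (fun ρ : ℝ => ‖F z * (z ^ 2 - (ρ : ℂ) ^ 2) * (z ^ 2 - (R : ℂ) ^ 2)‖) (𝓝[>] 0)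
        (𝓝 ‖F z * (z ^ 2 - ((0 : ℝ) : ℂ) ^ 2) * (z ^ 2 - (R : ℂ) ^ 2)‖) := by
      have : Continuous (fun ρ : ℝ => ‖F z * (z ^ 2 - (ρ : ℂ) ^ 2) * (z ^ 2 - (R : ℂ) ^ 2)‖) := by
        fun_prop
      exact (this.tendsto 0).mono_left nhdsWithin_le_nhds
    have h1 := le_of_tendsto hlim (by
      filter_upwards [Ioo_mem_nhdsGT (norm_pos_iff.2 hz)] with ρ hρ
      exact hmean z hz (by linarith) ρ hρ)
    have h2 : R ^ 2 / 2 ≤ ‖z ^ 2 - (R : ℂ) ^ 2‖ := by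
      have := norm_sub_norm_le ((R : ℂ) ^ 2) (z ^ 2)
      rw [norm_sub_rev] at this
      rw [norm_pow, norm_pow, Complex.norm_real, Real.norm_eq_abs, abs_of_pos hR0] at this
      nlinarith [norm_nonneg z]
    have e : F z * (z ^ 2 - ((0 : ℝ) : ℂ) ^ 2) * (z ^ 2 - (R : ℂ) ^ 2)
        = (z ^ 2 * F z) * (z ^ 2 - (R : ℂ) ^ 2) := by
      rw [Complex.ofReal_zero]; ring
    rw [e, norm_mul] at h1
    have h3 : ‖z ^ 2 * F z‖ * (R ^ 2 / 2) ≤ 4 * C * R ^ 3 :=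
      (mul_le_mul_of_nonneg_left h2 (norm_nonneg _)).trans h1
    have h4 : ‖z ^ 2 * F z‖ * (R ^ 2 / 2) ≤ (8 * C * R) * (R ^ 2 / 2) := by
      refine h3.trans (le_of_eq ?_); ring
    exact le_of_mul_le_mul_right h4 (by positivity)
  set f₂ : ℂ → ℂ := fun z => z ^ 2 * F z with hf₂
  have hnb : Metric.ball (0 : ℂ) (R / 2) ∈ 𝓝 (0 : ℂ) := Metric.ball_mem_nhds _ (by linarith)
  have hd2 : DifferentiableOn ℂ f₂ (Metric.ball (0 : ℂ) (R / 2) \ {0}) := by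
    refine DifferentiableOn.mul (by fun_prop) (hF.mono ?_)
    exact Set.sdiff_subset_sdiff_left (Metric.ball_subset_ball (by linarith))
  have hrem := Complex.differentiableOn_update_limUnder_of_bddAbove hnb hd2 (by
    refine ⟨8 * C * R, ?_⟩
    rintro _ ⟨z, hz, rfl⟩
    exact hsq z hz.2 (by simpa using hz.1))
  set φ₂ := Function.update f₂ 0 (limUnder (𝓝[≠] 0) f₂) with hφ₂
  have hφne : ∀ z ≠ 0, φ₂ z = f₂ z := fun z hz => Function.update_of_ne hz _ _
  have hφa : AnalyticAt ℂ φ₂ 0 := hrem.analyticAt hnb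
  -- Along the imaginary axis the hypothesis gives |z²F| ≤ C|z|. So the extension of z²F vanishes at
  -- 0 and a factor z can be divided out.
  have hφ0 : φ₂ 0 = 0 := by
    have htd : Tendsto (fun y : ℝ => φ₂ (y * Complex.I)) (𝓝[>] 0) (𝓝 (φ₂ 0)) := by
      have h1 : Tendsto (fun y : ℝ => (y : ℂ) * Complex.I) (𝓝[>] 0) (𝓝 0) := by
        have : Continuous (fun y : ℝ => (y : ℂ) * Complex.I) := by fun_prop
        have := (this.tendsto 0).mono_left (nhdsWithin_le_nhds (s := Set.Ioi 0))
        simpa using this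
      exact hφa.continuousAt.tendsto.comp h1
    refine tendsto_nhds_unique htd ?_
    have hz : Tendsto (fun y : ℝ => C * y) (𝓝[>] 0) (𝓝 0) := by
      have : Continuous (fun y : ℝ => C * y) := by fun_prop
      have := (this.tendsto 0).mono_left (nhdsWithin_le_nhds (s := Set.Ioi 0))
      simpa using this
    refine squeeze_zero_norm' ?_ hz
    filter_upwards [Ioo_mem_nhdsGT hr] with y hy
    have hy0 : (y : ℂ) * Complex.I ≠ 0 := by simp [hy.1.ne']
    have hn : ‖(y : ℂ) * Complex.I‖ = y := by
      rw [norm_mul, Complex.norm_I, mul_one, Complex.norm_real, Real.norm_eq_abs, abs_of_pos hy.1]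
    have him : ((y : ℂ) * Complex.I).im = y := by simp
    rw [hφne _ hy0, hf₂]
    simp only
    rw [norm_mul, norm_pow, hn]
    have := hb (y * Complex.I) (by rw [mem_ball_zero_iff, hn]; exact hy.2) (by rw [him]; exact hy.1.ne')
    rw [him, abs_of_pos hy.1, le_div_iff₀ hy.1] at this
    nlinarith [hy.1]
  refine ⟨dslope φ₂ 0, ?_, ?_⟩
  · have := (Complex.differentiableOn_dslope hnb).2 hrem
    exact this.analyticAt hnb
  · filter_upwards [self_mem_nhdsWithin] with s hs
    rw [dslope_of_ne _ hs, slope_def_field, hφ0, hφne s hs, hf₂]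
    have : s ≠ 0 := hs
    rw [sub_zero, sub_zero, div_eq_iff this]
    ring


/-! ### Local structure of the boundary of a polygon -/

theorem IsStraightPiece.exists_param {S : Set ℂ} (h : IsStraightPiece S) :
    ∃ a v : ℂ, v ≠ 0 ∧ ∃ I : Set ℝ, (I = Set.Icc 0 1 ∨ I = Set.Ici 0 ∨ I = Set.univ) ∧
      S = (fun t : ℝ => a + t * v) '' I := by
  rcases h with ⟨a, b, hab, rfl⟩ | ⟨a, v, hv, rfl⟩ | ⟨a, v, hv, rfl⟩
  · refine ⟨a, b - a, sub_ne_zero.2 hab.symm, _, Or.inl rfl, ?_⟩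
    rw [segment_eq_image']
    rfl
  · refine ⟨a, v, hv, _, Or.inr (Or.inl rfl), ?_⟩
    ext w
    constructor
    · rintro ⟨t, ht, rfl⟩; exact ⟨t, ht, rfl⟩
    · rintro ⟨t, ht, rfl⟩; exact ⟨t, ht, rfl⟩
  · refine ⟨a, v, hv, _, Or.inr (Or.inr rfl), ?_⟩
    ext w
    constructor
    · rintro ⟨t, rfl⟩; exact ⟨t, trivial, rfl⟩
    · rintro ⟨t, -, rfl⟩; exact ⟨t, rfl⟩

theorem isClosed_param {a v : ℂ} (hv : v ≠ 0) {I : Set ℝ}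
    (hI : I = Set.Icc 0 1 ∨ I = Set.Ici 0 ∨ I = Set.univ) :
    IsClosed ((fun t : ℝ => a + t * v) '' I) := by
  have hcl : IsClosed I := by
    rcases hI with rfl | rfl | rfl
    · exact isClosed_Icc
    · exact isClosed_Ici
    · exact isClosed_univ
  have e : Topology.IsClosedEmbedding (fun t : ℝ => a + t * v) := by
    have h1 : AntilipschitzWith (‖v‖₊⁻¹) (fun t : ℝ => a + t * v) := by
      apply AntilipschitzWith.of_le_mul_dist
      intro s t
      rw [dist_add_left, Complex.dist_eq, ← sub_mul, norm_mul, ← Complex.ofReal_sub,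
        Complex.norm_real, Real.dist_eq, Real.norm_eq_abs, NNReal.coe_inv, coe_nnnorm]
      have : ‖v‖ ≠ 0 := norm_ne_zero_iff.2 hv
      field_simp
      exact le_rfl
    have h2 : LipschitzWith ‖v‖₊ (fun t : ℝ => a + t * v) := by
      apply LipschitzWith.of_dist_le_mul
      intro s t
      rw [dist_add_left, Complex.dist_eq, ← sub_mul, norm_mul, ← Complex.ofReal_sub,
        Complex.norm_real, Real.dist_eq, Real.norm_eq_abs, coe_nnnorm, mul_comm]
    exact h1.isClosedEmbedding h2.uniformContinuous
  exact e.isClosedMap _ hcl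

theorem convex_param {a v : ℂ} {I : Set ℝ}
    (hI : I = Set.Icc 0 1 ∨ I = Set.Ici 0 ∨ I = Set.univ) :
    Convex ℝ ((fun t : ℝ => a + t * v) '' I) := by
  have hc : Convex ℝ I := by
    rcases hI with rfl | rfl | rfl
    · exact convex_Icc 0 1
    · exact convex_Ici 0
    · exact convex_univ
  rintro _ ⟨s, hs, rfl⟩ _ ⟨t, ht, rfl⟩ x y hx hy hxy
  refine ⟨x * s + y * t, hc hs ht hx hy hxy, ?_⟩
  have hxy' : (x : ℂ) + y = 1 := by exact_mod_cast hxy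
  simp only [Complex.real_smul]
  push_cast
  linear_combination (-a) * hxy'

/-- Near `p`, the set `X` consists of the points in the directions `u ∈ D`. -/
def DirectionsAt (X : Set ℂ) (p : ℂ) (D : Set ℂ) : Prop :=
  ∃ ε > 0, ∀ r ∈ Set.Ioo (0 : ℝ) ε, ∀ u : ℂ, ‖u‖ = 1 → (p + r * u ∈ X ↔ u ∈ D)

/-- By convexity, a direction in which S is met once is met at all smaller distances from p.
Finiteness of the set of directions yields a common radius. -/
theorem directionsAt_of_convex {S : Set ℂ} (hc : IsClosed S) (hS : Convex ℝ S) {p : ℂ}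
    (hD : {u : ℂ | ‖u‖ = 1 ∧ p ∈ S ∧ ∃ h : ℝ, 0 < h ∧ p + h * u ∈ S}.Finite) :
    DirectionsAt S p {u : ℂ | ‖u‖ = 1 ∧ p ∈ S ∧ ∃ h : ℝ, 0 < h ∧ p + h * u ∈ S} := by
  by_cases hp : p ∈ S
  · have h1 : ∀ᶠ ε : ℝ in 𝓝[>] 0, ∀ u ∈ {u : ℂ | ‖u‖ = 1 ∧ p ∈ S ∧ ∃ h : ℝ, 0 < h ∧ p + h * u ∈ S},
        p + ε * u ∈ S := by
      rw [Filter.eventually_all_finite hD]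
      rintro u ⟨hu, -, h, hh, hm⟩
      filter_upwards [Ioo_mem_nhdsGT hh] with ε hε
      have := hS.add_smul_sub_mem hp hm (t := (ε / h : ℝ))
        ⟨div_nonneg hε.1.le hh.le, (div_le_one hh).2 hε.2.le⟩
      have e : p + (ε / h) • (p + h * u - p) = p + ε * u := by
        rw [Complex.real_smul, add_sub_cancel_left]
        push_cast
        have : (h : ℂ) ≠ 0 := by exact_mod_cast hh.ne'
        field_simp
      rwa [e] at this
    obtain ⟨ε, hε, hε'⟩ := (mem_nhdsGT_iff_exists_Ioo_subset).1 h1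
    refine ⟨ε, hε, fun r hr u hu => ⟨fun h => ⟨hu, hp, r, hr.1, h⟩, fun h => hε' hr u h⟩⟩
  · obtain ⟨ε, hε, hε'⟩ := Metric.isOpen_iff.1 hc.isOpen_compl p hp
    refine ⟨ε, hε, fun r hr u hu => ⟨fun h => absurd h (hε' ?_), fun h => absurd h.2.1 hp⟩⟩
    rw [Metric.mem_ball, dist_eq_norm, add_sub_cancel_left, norm_mul, hu, mul_one,
      Complex.norm_real, Real.norm_eq_abs, abs_of_pos hr.1]
    exact hr.2

theorem eq_or_eq_neg_of_param {a v u p : ℂ} (hv : v ≠ 0) (hu : ‖u‖ = 1) {h s t : ℝ} (hh : 0 < h)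
    (hs : p = a + s * v) (ht : p + h * u = a + t * v) :
    (s < t ∧ u = v / ‖v‖) ∨ (t < s ∧ u = -(v / ‖v‖)) := by
  have e : (h : ℂ) * u = ((t - s : ℝ) : ℂ) * v := by
    push_cast
    linear_combination ht - hs
  have hv0 : 0 < ‖v‖ := norm_pos_iff.2 hv
  have hn : h = |t - s| * ‖v‖ := by
    have := congrArg norm e
    rw [norm_mul, norm_mul, hu, mul_one, Complex.norm_real, Complex.norm_real, Real.norm_eq_abs,
      Real.norm_eq_abs, abs_of_pos hh] at this
    exact this
  have hvc : ((‖v‖ : ℝ) : ℂ) ≠ 0 := by exact_mod_cast hv0.ne'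
  have hhc : (h : ℂ) ≠ 0 := by exact_mod_cast hh.ne'
  rcases lt_trichotomy s t with hst | hst | hst
  · refine Or.inl ⟨hst, ?_⟩
    rw [abs_of_pos (by linarith)] at hn
    rw [eq_div_iff hvc]
    apply mul_left_cancel₀ hhc
    have hnc : (h : ℂ) = ((t - s : ℝ) : ℂ) * (‖v‖ : ℝ) := by exact_mod_cast hn
    linear_combination (‖v‖ : ℂ) * e - v * hnc
  · rw [hst, sub_self, abs_zero, zero_mul] at hn
    exact absurd hn hh.ne'
  · refine Or.inr ⟨hst, ?_⟩
    rw [abs_of_neg (by linarith)] at hn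
    rw [eq_comm, neg_eq_iff_eq_neg, div_eq_iff hvc]
    apply mul_left_cancel₀ hhc
    have hnc : (h : ℂ) = ((-(t - s) : ℝ) : ℂ) * (‖v‖ : ℝ) := by exact_mod_cast hn
    have hts : ((-(t - s) : ℝ) : ℂ) + ((t - s : ℝ) : ℂ) = 0 := by push_cast; ring
    linear_combination v * hnc + (‖v‖ : ℂ) * e + v * ‖v‖ * hts

theorem directionsAt_param {a v : ℂ} (hv : v ≠ 0) {I : Set ℝ}
    (hI : I = Set.Icc 0 1 ∨ I = Set.Ici 0 ∨ I = Set.univ) (p : ℂ) :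
    ∃ D : Set ℂ, D ⊆ {v / ‖v‖, -(v / ‖v‖)} ∧ DirectionsAt ((fun t : ℝ => a + t * v) '' I) p D ∧
      (p ∈ (fun t : ℝ => a + t * v) '' I ↔ D.Nonempty) ∧
      (∀ t ∈ interior I, p = a + t * v → D = {v / ‖v‖, -(v / ‖v‖)}) := by
  have hv0 : 0 < ‖v‖ := norm_pos_iff.2 hv
  have hvc : ((‖v‖ : ℝ) : ℂ) ≠ 0 := by exact_mod_cast hv0.ne'
  set S := (fun t : ℝ => a + t * v) '' I with hS
  set D := {u : ℂ | ‖u‖ = 1 ∧ p ∈ S ∧ ∃ h : ℝ, 0 < h ∧ p + h * u ∈ S} with hD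
  have hsub : D ⊆ {v / ‖v‖, -(v / ‖v‖)} := by
    rintro u ⟨hu, ⟨s, hs, hs'⟩, h, hh, t, ht, ht'⟩
    rcases eq_or_eq_neg_of_param hv hu hh hs'.symm ht'.symm with h | h
    · exact Or.inl h.2
    · exact Or.inr h.2
  have hmem : ∀ s ∈ I, p = a + s * v → ∀ t ∈ I, (s < t → v / ‖v‖ ∈ D) ∧ (t < s → -(v / ‖v‖) ∈ D) := by
    intro s hs hp t ht
    have hn : ‖v / (‖v‖ : ℂ)‖ = 1 := by
      rw [norm_div, Complex.norm_real, norm_norm, div_self hv0.ne']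
    constructor
    · intro hst
      refine ⟨hn, ⟨s, hs, hp.symm⟩, ((t - s) * ‖v‖ : ℝ), mul_pos (by linarith) hv0, t, ht, ?_⟩
      simp only
      rw [hp]
      push_cast
      field_simp
      ring
    · intro hst
      refine ⟨by rw [norm_neg, hn], ⟨s, hs, hp.symm⟩, ((s - t) * ‖v‖ : ℝ), mul_pos (by linarith) hv0, t, ht, ?_⟩
      simp only
      rw [hp]
      push_cast
      field_simp
      ring
  refine ⟨D, hsub, directionsAt_of_convex (isClosed_param hv hI) (convex_param hI)
    ((Set.toFinite _).subset hsub), ?_, ?_⟩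
  · refine ⟨?_, fun ⟨u, hu⟩ => hu.2.1⟩
    rintro ⟨s, hs, hp⟩
    have : ∃ t ∈ I, t ≠ s := by
      rcases hI with rfl | rfl | rfl
      · by_cases h : s = 0
        · exact ⟨1, by simp, by rw [h]; norm_num⟩
        · exact ⟨0, by simp, Ne.symm h⟩
      · refine ⟨s + 1, ?_, by simp⟩
        have : 0 ≤ s := hs
        exact Set.mem_Ici.2 (by linarith)
      · exact ⟨s + 1, trivial, by simp⟩
    obtain ⟨t, ht, hts⟩ := this
    rcases lt_or_gt_of_ne hts with h | h
    · exact ⟨_, (hmem s hs hp.symm t ht).2 h⟩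
    · exact ⟨_, (hmem s hs hp.symm t ht).1 h⟩
  · intro s hs hp
    apply subset_antisymm hsub
    have hn := mem_interior_iff_mem_nhds.1 hs
    obtain ⟨δ, hδ, hδ'⟩ := Metric.mem_nhds_iff.1 hn
    have hsI : s ∈ I := interior_subset hs
    rintro u (rfl | rfl)
    · refine (hmem s hsI hp (s + δ / 2) (hδ' ?_)).1 (by linarith [show (0 : ℝ) < δ from hδ])
      rw [Metric.mem_ball, Real.dist_eq, add_sub_cancel_left, abs_of_pos (by linarith)]
      linarith
    · refine (hmem s hsI hp (s - δ / 2) (hδ' ?_)).2 (by linarith)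
      rw [Metric.mem_ball, Real.dist_eq, sub_sub_cancel_left, abs_neg, abs_of_pos (by linarith)]
      linarith

theorem DirectionsAt.sUnion {𝒮 : Set (Set ℂ)} (h𝒮 : 𝒮.Finite) {p : ℂ} {D : Set ℂ → Set ℂ}
    (h : ∀ S ∈ 𝒮, DirectionsAt S p (D S)) : DirectionsAt (⋃₀ 𝒮) p (⋃ S ∈ 𝒮, D S) := by
  have h1 : ∀ᶠ r : ℝ in 𝓝[>] 0, ∀ S ∈ 𝒮, ∀ u : ℂ, ‖u‖ = 1 → (p + r * u ∈ S ↔ u ∈ D S) := by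
    rw [Filter.eventually_all_finite h𝒮]
    intro S hS
    obtain ⟨ε, hε, hε'⟩ := h S hS
    filter_upwards [Ioo_mem_nhdsGT hε] with r hr using hε' r hr
  obtain ⟨ε, hε, hε'⟩ := (mem_nhdsGT_iff_exists_Ioo_subset).1 h1
  refine ⟨ε, hε, fun r hr u hu => ?_⟩
  simp only [Set.mem_sUnion, Set.mem_iUnion, exists_prop]
  exact exists_congr fun S => and_congr_right fun hS => hε' hr S hS u hu

theorem norm_div_norm_self {v : ℂ} (hv : v ≠ 0) : ‖v / (‖v‖ : ℂ)‖ = 1 := by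
  rw [norm_div, Complex.norm_real, norm_norm, div_self (norm_ne_zero_iff.2 hv)]

theorem IsPolygon.exists_directionsAt {Ω : Set ℂ} (hΩ : IsPolygon Ω) (p : ℂ) :
    ∃ D : Set ℂ, D.Finite ∧ (∀ u ∈ D, ‖u‖ = 1) ∧ DirectionsAt (frontier Ω) p D ∧
      (p ∈ frontier Ω → D.Nonempty) := by
  obtain ⟨𝒮, hfin, hpc, hfr⟩ := hΩ.frontier_eq
  have h : ∀ S : Set ℂ, ∃ D : Set ℂ, S ∈ 𝒮 → D.Finite ∧ (∀ u ∈ D, ‖u‖ = 1) ∧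
      DirectionsAt S p D ∧ (p ∈ S → D.Nonempty) := by
    intro S
    by_cases hS : S ∈ 𝒮
    · obtain ⟨a, v, hv, I, hI, rfl⟩ := (hpc S hS).exists_param
      obtain ⟨D, h1, h2, h3, -⟩ := directionsAt_param (a := a) hv hI p
      refine ⟨D, fun _ => ⟨(Set.toFinite _).subset h1, fun u hu => ?_, h2, h3.1⟩⟩
      rcases h1 hu with rfl | rfl
      · exact norm_div_norm_self hv
      · rw [norm_neg]; exact norm_div_norm_self hv
    · exact ⟨∅, fun h => absurd h hS⟩
  choose D hD using h
  refine ⟨⋃ S ∈ 𝒮, D S, hfin.biUnion fun S hS => (hD S hS).1, ?_, ?_, ?_⟩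
  · intro u hu
    simp only [Set.mem_iUnion, exists_prop] at hu
    obtain ⟨S, hS, hu⟩ := hu
    exact (hD S hS).2.1 u hu
  · rw [hfr]
    exact DirectionsAt.sUnion hfin fun S hS => (hD S hS).2.2.1
  · intro hp
    rw [hfr] at hp
    obtain ⟨S, hS, hpS⟩ := hp
    obtain ⟨u, hu⟩ := (hD S hS).2.2.2 hpS
    exact ⟨u, Set.mem_biUnion hS hu⟩

/-! ### Sectors and corners in polar coordinates -/

theorem norm_exp_real_mul_I (t : ℝ) : ‖Complex.exp (t * Complex.I)‖ = 1 :=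
  Complex.norm_exp_ofReal_mul_I t

theorem exp_add_two_pi_mul_int (t : ℝ) (n : ℤ) :
    Complex.exp (((t + n * (2 * Real.pi) : ℝ) : ℂ) * Complex.I) = Complex.exp (t * Complex.I) := by
  have : ((t + n * (2 * Real.pi) : ℝ) : ℂ) * Complex.I = t * Complex.I + n * (2 * Real.pi * Complex.I) := by
    push_cast; ring
  rw [this]
  exact Complex.exp_periodic.int_mul n _

theorem polarPoint_add_two_pi_mul_int (p : ℂ) (r t : ℝ) (n : ℤ) :
    polarPoint p r (t + n * (2 * Real.pi)) = polarPoint p r t := by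
  rw [polarPoint, polarPoint, exp_add_two_pi_mul_int]

theorem exp_eq_exp_iff_real {s t : ℝ} (h : Complex.exp (s * Complex.I) = Complex.exp (t * Complex.I)) :
    ∃ n : ℤ, s = t + n * (2 * Real.pi) := by
  obtain ⟨n, hn⟩ := Complex.exp_eq_exp_iff_exists_int.1 h
  refine ⟨n, ?_⟩
  have h2 : ((s : ℝ) : ℂ) * Complex.I = ((t + n * (2 * Real.pi) : ℝ) : ℂ) * Complex.I := by
    rw [hn]; push_cast; ring
  have := mul_right_cancel₀ Complex.I_ne_zero h2
  exact_mod_cast this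

theorem dist_polarPoint {p : ℂ} {r t : ℝ} (hr : 0 ≤ r) : dist (polarPoint p r t) p = r := by
  rw [polarPoint, dist_eq_norm, add_sub_cancel_left, norm_mul, norm_exp_real_mul_I, mul_one,
    Complex.norm_real, Real.norm_eq_abs, abs_of_nonneg hr]

theorem exists_eq_polarPoint (w p : ℂ) : ∃ t : ℝ, w = polarPoint p (dist w p) t := by
  refine ⟨(w - p).arg, ?_⟩
  rw [polarPoint, dist_eq_norm, Complex.norm_mul_exp_arg_mul_I]
  ring

theorem continuous_polarPoint (p : ℂ) : Continuous fun x : ℝ × ℝ => polarPoint p x.1 x.2 := by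
  unfold polarPoint
  fun_prop

/-- The sector of radius `ε` at the corner `c`. -/
def sectorSet (c : ℂ × ℝ × ℝ) (ε : ℝ) : Set ℂ :=
  (fun x : ℝ × ℝ => polarPoint c.1 x.1 x.2) '' (Set.Ioo 0 ε ×ˢ Set.Ioo c.2.1 (c.2.1 + c.2.2))

theorem isPreconnected_sectorSet (c : ℂ × ℝ × ℝ) (ε : ℝ) : IsPreconnected (sectorSet c ε) :=
  (isPreconnected_Ioo.prod isPreconnected_Ioo).image _ (continuous_polarPoint c.1).continuousOn

theorem sectorSet_mono {c : ℂ × ℝ × ℝ} {ε δ : ℝ} (h : ε ≤ δ) : sectorSet c ε ⊆ sectorSet c δ := by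
  rintro _ ⟨x, ⟨h1, h2⟩, rfl⟩
  exact ⟨x, ⟨⟨h1.1, h1.2.trans_le h⟩, h2⟩, rfl⟩

theorem exists_sectorSet_subset {Ω : Set ℂ} {c : ℂ × ℝ × ℝ} (hc : c ∈ corners Ω) :
    ∃ ε > 0, sectorSet c ε ⊆ Ω ∧ ∀ r ∈ Set.Ioo 0 ε,
      polarPoint c.1 r c.2.1 ∉ Ω ∧ polarPoint c.1 r (c.2.1 + c.2.2) ∉ Ω := by
  obtain ⟨ε, hε, h⟩ := hc.2.2
  refine ⟨ε, hε, ?_, fun r hr => ⟨(h r hr).1, (h r hr).2.1⟩⟩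
  rintro _ ⟨x, ⟨h1, h2⟩, rfl⟩
  exact (h x.1 h1).2.2 x.2 h2

theorem IsPolygon.notMem_of_mem_frontier {Ω : Set ℂ} (hΩ : IsPolygon Ω) {p : ℂ}
    (hp : p ∈ frontier Ω) : p ∉ Ω := by
  rw [hΩ.isOpen.frontier_eq] at hp
  exact hp.2

theorem IsPreconnected.subset_of_disjoint_frontier {Ω T : Set ℂ} (hΩ : IsOpen Ω)
    (hT : IsPreconnected T) (hd : Disjoint T (frontier Ω)) (hne : (T ∩ Ω).Nonempty) : T ⊆ Ω := by
  refine hT.subset_left_of_subset_union hΩ isClosed_closure.isOpen_compl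
    (Set.disjoint_left.2 fun x h1 h2 => h2 (subset_closure h1)) ?_ hne
  intro x hx
  by_cases h : x ∈ Ω
  · exact Or.inl h
  · right
    intro hcl
    refine Set.disjoint_left.1 hd hx ?_
    rw [hΩ.frontier_eq]
    exact ⟨hcl, h⟩

/-- Near p the frontier is a finite fan of radii. Their angles form a closed 2π-periodic set Θ, and
the gap of Θ around the angle of w is the angular interval of the corner. -/
theorem IsPolygon.exists_corner_of_mem {Ω : Set ℂ} (hΩ : IsPolygon Ω) {p : ℂ}
    (hp : p ∈ frontier Ω) : ∃ ε > 0, ∀ w ∈ Ω, dist w p < ε →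
      ∃ c ∈ corners Ω, c.1 = p ∧ w ∈ sectorSet c ε ∧ sectorSet c ε ⊆ Ω := by
  obtain ⟨D, hDf, hD1, ⟨ε, hε, hD⟩, hDn⟩ := hΩ.exists_directionsAt p
  obtain ⟨u, hu⟩ := hDn hp
  have hD' : ∀ r ∈ Set.Ioo 0 ε, ∀ t : ℝ, polarPoint p r t ∈ frontier Ω ↔ Complex.exp (t * Complex.I) ∈ D :=
    fun r hr t => hD r hr _ (norm_exp_real_mul_I t)
  refine ⟨ε, hε, fun w hw hwp => ?_⟩
  have hwne : w ≠ p := fun h => hΩ.notMem_of_mem_frontier hp (h ▸ hw)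
  have hpi := Real.two_pi_pos
  set r := dist w p with hr
  have hr0 : r ∈ Set.Ioo 0 ε := ⟨dist_pos.2 hwne, hwp⟩
  obtain ⟨t, ht⟩ := exists_eq_polarPoint w p
  rw [← hr] at ht
  set Θ : Set ℝ := {t | Complex.exp (t * Complex.I) ∈ D} with hΘ
  have hΘc : IsClosed Θ := hDf.isClosed.preimage (by fun_prop)
  have htΘ : t ∉ Θ := by
    intro h
    exact hΩ.notMem_of_mem_frontier ((hD' r hr0 t).2 h) (ht ▸ hw)
  have hper : ∀ s ∈ Θ, ∀ n : ℤ, s + n * (2 * Real.pi) ∈ Θ := by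
    intro s hs n
    rw [hΘ, Set.mem_ofPred_eq, exp_add_two_pi_mul_int]
    exact hs
  obtain ⟨s₀, hs₀⟩ : ∃ s₀ : ℝ, s₀ ∈ Θ := by
    refine ⟨u.arg, ?_⟩
    have := Complex.norm_mul_exp_arg_mul_I u
    rw [hD1 u hu, Complex.ofReal_one, one_mul] at this
    rw [hΘ, Set.mem_ofPred_eq, this]
    exact hu
  have hlow : (Θ ∩ Set.Iic t).Nonempty := by
    obtain ⟨n, hn, -⟩ := existsUnique_add_zsmul_mem_Ico hpi s₀ (t - 2 * Real.pi)
    rw [zsmul_eq_mul] at hn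
    exact ⟨_, hper s₀ hs₀ n, by have := hn.2; simp only [Set.mem_Iic]; linarith⟩
  have hup : (Θ ∩ Set.Ici t).Nonempty := by
    obtain ⟨n, hn, -⟩ := existsUnique_add_zsmul_mem_Ico hpi s₀ t
    rw [zsmul_eq_mul] at hn
    exact ⟨_, hper s₀ hs₀ n, hn.1⟩
  have hbl : BddAbove (Θ ∩ Set.Iic t) := ⟨t, fun x hx => hx.2⟩
  have hbu : BddBelow (Θ ∩ Set.Ici t) := ⟨t, fun x hx => hx.2⟩
  have h1 := (hΘc.inter isClosed_Iic).csSup_mem hlow hbl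
  have h2 := (hΘc.inter isClosed_Ici).csInf_mem hup hbu
  set θ₁ := sSup (Θ ∩ Set.Iic t) with hθ₁
  set θ₂ := sInf (Θ ∩ Set.Ici t) with hθ₂
  have h1t : θ₁ < t := lt_of_le_of_ne h1.2 (fun h => htΘ (h ▸ h1.1))
  have h2t : t < θ₂ := lt_of_le_of_ne h2.2 (fun h => htΘ (h ▸ h2.1))
  have hbetween : ∀ s ∈ Set.Ioo θ₁ θ₂, s ∉ Θ := by
    intro s hs hsΘ
    rcases le_total s t with h | h
    · exact absurd (le_csSup hbl ⟨hsΘ, h⟩) (not_le.2 hs.1)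
    · exact absurd (csInf_le hbu ⟨hsΘ, h⟩) (not_le.2 hs.2)
  -- Periodicity bounds the gap; equality is the tip of a slit.
  have hβ : θ₂ ≤ θ₁ + 2 * Real.pi := by
    by_contra! h
    have := hper θ₁ h1.1 1
    rw [Int.cast_one, one_mul] at this
    exact hbetween _ ⟨by linarith, h⟩ this
  obtain ⟨n, hn, -⟩ := existsUnique_add_zsmul_mem_Ico hpi θ₁ 0
  rw [zsmul_eq_mul, zero_add] at hn
  set c : ℂ × ℝ × ℝ := (p, θ₁ + n * (2 * Real.pi), θ₂ - θ₁) with hc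
  have hwc : w ∈ sectorSet c ε := by
    refine ⟨(r, t + n * (2 * Real.pi)), ⟨hr0, ?_⟩, ?_⟩
    · constructor <;> simp only [hc] <;> linarith
    · simp only [hc]
      rw [polarPoint_add_two_pi_mul_int]
      exact ht.symm
  have hnf : ∀ s ∈ Set.Ioo c.2.1 (c.2.1 + c.2.2), s ∉ Θ := by
    intro s hs hsΘ
    have := hper s hsΘ (-n)
    refine hbetween _ ?_ this
    have h1 := hs.1
    have h2 := hs.2
    simp only [hc] at h1 h2
    push_cast
    constructor <;> linarith
  have hsub : sectorSet c ε ⊆ Ω := by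
    refine (isPreconnected_sectorSet c ε).subset_of_disjoint_frontier hΩ.isOpen ?_ ⟨w, hwc, hw⟩
    rw [Set.disjoint_left]
    rintro _ ⟨x, ⟨hx1, hx2⟩, rfl⟩ hfr
    exact hnf x.2 hx2 ((hD' x.1 hx1 x.2).1 hfr)
  refine ⟨c, ⟨hn, ⟨by simp only [hc]; linarith, by simp only [hc]; linarith⟩, ε, hε, ?_⟩, rfl, hwc, hsub⟩
  intro s hs
  refine ⟨?_, ?_, fun t' ht' => hsub ⟨(s, t'), ⟨hs, ht'⟩, rfl⟩⟩
  · refine hΩ.notMem_of_mem_frontier ((hD' s hs _).2 ?_)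
    exact hper θ₁ h1.1 n
  · refine hΩ.notMem_of_mem_frontier ((hD' s hs _).2 ?_)
    have := hper θ₂ h2.1 n
    have e : c.2.1 + c.2.2 = θ₂ + n * (2 * Real.pi) := by simp only [hc]; ring
    rw [e]
    exact this

theorem IsPolygon.exists_radius_of_corner {Ω : Set ℂ} (hΩ : IsPolygon Ω) {c : ℂ × ℝ × ℝ}
    (hc : c ∈ corners Ω) : ∃ ε > 0, ∀ r ∈ Set.Ioo 0 ε,
      polarPoint c.1 r c.2.1 ∈ frontier Ω ∧ polarPoint c.1 r (c.2.1 + c.2.2) ∈ frontier Ω ∧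
      ∀ t ∈ Set.Ioo c.2.1 (c.2.1 + c.2.2), polarPoint c.1 r t ∈ Ω := by
  obtain ⟨ε, hε, h⟩ := hc.2.2
  have hβ := hc.2.1.1
  refine ⟨ε, hε, fun r hr => ?_⟩
  have hcl : ∀ t ∈ Set.Icc c.2.1 (c.2.1 + c.2.2), polarPoint c.1 r t ∈ closure Ω := by
    intro t ht
    have ht' : t ∈ closure (Set.Ioo c.2.1 (c.2.1 + c.2.2)) := by
      rw [closure_Ioo (by linarith)]
      exact ht
    have hcont : Continuous (fun t => polarPoint c.1 r t) :=
      (continuous_polarPoint c.1).comp (by fun_prop : Continuous fun t : ℝ => (r, t))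
    exact map_mem_closure hcont ht' (fun x hx => (h r hr).2.2 x hx)
  rw [hΩ.isOpen.frontier_eq]
  exact ⟨⟨hcl _ ⟨le_rfl, by linarith⟩, (h r hr).1⟩, ⟨hcl _ ⟨by linarith, le_rfl⟩, (h r hr).2.1⟩,
    (h r hr).2.2⟩

theorem IsPolygon.apex_mem_frontier {Ω : Set ℂ} (hΩ : IsPolygon Ω) {c : ℂ × ℝ × ℝ}
    (hc : c ∈ corners Ω) : c.1 ∈ frontier Ω := by
  obtain ⟨ε, hε, h⟩ := hΩ.exists_radius_of_corner hc
  refine isClosed_frontier.mem_of_tendsto (b := 𝓝[>] (0 : ℝ)) (f := fun r => polarPoint c.1 r c.2.1) ?_ ?_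
  · have hcont : Continuous (fun r => polarPoint c.1 r c.2.1) :=
      (continuous_polarPoint c.1).comp (by fun_prop : Continuous fun r : ℝ => (r, c.2.1))
    have := (hcont.tendsto 0).mono_left (nhdsWithin_le_nhds (s := Set.Ioi 0))
    simpa [polarPoint] using this
  · filter_upwards [Ioo_mem_nhdsGT hε] with r hr using (h r hr).1

/-- Two corners at the same point whose sectors have a common direction coincide. -/
theorem corners_eq_of_common_direction {Ω : Set ℂ} {c c' : ℂ × ℝ × ℝ} (hc : c ∈ corners Ω)
    (hc' : c' ∈ corners Ω) (hp : c.1 = c'.1) {t t' : ℝ} (ht : t ∈ Set.Ioo c.2.1 (c.2.1 + c.2.2))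
    (ht' : t' ∈ Set.Ioo c'.2.1 (c'.2.1 + c'.2.2))
    (htt : Complex.exp (t * Complex.I) = Complex.exp (t' * Complex.I)) : c = c' := by
  obtain ⟨n, hn⟩ := exp_eq_exp_iff_real htt
  obtain ⟨ε, hε, h⟩ := hc.2.2
  obtain ⟨ε', hε', h'⟩ := hc'.2.2
  obtain ⟨p, θ, β⟩ := c
  obtain ⟨p', θ', β'⟩ := c'
  simp only at *
  subst hp
  have hpi := Real.two_pi_pos
  set r := min ε ε' / 2 with hr
  have hm : 0 < min ε ε' := lt_min hε hε'
  have hr1 : r ∈ Set.Ioo 0 ε := ⟨half_pos hm, by have := min_le_left ε ε'; linarith⟩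
  have hr2 : r ∈ Set.Ioo 0 ε' := ⟨half_pos hm, by have := min_le_right ε ε'; linarith⟩
  obtain ⟨a1, a2, a3⟩ := h r hr1
  obtain ⟨b1, b2, b3⟩ := h' r hr2
  have a3' : ∀ s, s + n * (2 * Real.pi) ∈ Set.Ioo θ (θ + β) → polarPoint p r s ∈ Ω := by
    intro s hs
    rw [← polarPoint_add_two_pi_mul_int p r s n]
    exact a3 _ hs
  have b3' : ∀ s, s + ((-n : ℤ) : ℝ) * (2 * Real.pi) ∈ Set.Ioo θ' (θ' + β') → polarPoint p r s ∈ Ω := by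
    intro s hs
    rw [← polarPoint_add_two_pi_mul_int p r s (-n)]
    exact b3 _ hs
  push_cast at b3'
  set N : ℝ := n * (2 * Real.pi) with hN
  have e1 : θ = θ' + N := by
    rcases lt_trichotomy θ (θ' + N) with hlt | heq | hgt
    · exact absurd (a3' θ' ⟨hlt, by linarith [ht.2, ht'.1]⟩) b1
    · exact heq
    · exact absurd (b3' θ ⟨by linarith, by linarith [ht'.2, ht.1]⟩) a1
  have e2 : θ + β = θ' + β' + N := by
    rcases lt_trichotomy (θ + β) (θ' + β' + N) with hlt | heq | hgt
    · exact absurd (b3' (θ + β) ⟨by linarith [ht.2, ht'.1], by linarith⟩) a2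
    · exact heq
    · exact absurd (a3' (θ' + β') ⟨by linarith [ht.1, ht'.2], by linarith⟩) b2
  have hn0 : n = 0 := by
    have h1 := hc.1
    have h2 := hc'.1
    simp only [Set.mem_Ico] at h1 h2
    have h3 : (-1 : ℝ) < n := by
      by_contra! hle
      nlinarith
    have h4 : (n : ℝ) < 1 := by
      by_contra! hle
      nlinarith
    have h5 : -1 < n := by exact_mod_cast h3
    have h6 : n < 1 := by exact_mod_cast h4
    omega
  have hN0 : N = 0 := by rw [hN, hn0]; simp
  rw [hN0] at e1 e2
  have : θ = θ' := by linarith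
  subst this
  have : β = β' := by linarith
  rw [this]

/-- A corner at p is determined by its initial side, which is one of the finitely many directions of
the frontier at p. -/
theorem IsPolygon.finite_corners_at {Ω : Set ℂ} (hΩ : IsPolygon Ω) (p : ℂ) :
    {c ∈ corners Ω | c.1 = p}.Finite := by
  obtain ⟨D, hDf, hD1, ⟨ε, hε, hD⟩, hDn⟩ := hΩ.exists_directionsAt p
  refine Set.Finite.of_finite_image (f := fun c : ℂ × ℝ × ℝ => Complex.exp (c.2.1 * Complex.I))
    (hDf.subset ?_) ?_
  · rintro _ ⟨c, ⟨hc, rfl⟩, rfl⟩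
    obtain ⟨δ, hδ, h⟩ := hΩ.exists_radius_of_corner hc
    have hm : 0 < min ε δ := lt_min hε hδ
    have hr1 : min ε δ / 2 ∈ Set.Ioo 0 ε := ⟨half_pos hm, by have := min_le_left ε δ; linarith⟩
    have hr2 : min ε δ / 2 ∈ Set.Ioo 0 δ := ⟨half_pos hm, by have := min_le_right ε δ; linarith⟩
    exact (hD _ hr1 _ (norm_exp_real_mul_I _)).1 (h _ hr2).1
  · rintro c ⟨hc, hcp⟩ c' ⟨hc', hcp'⟩ e
    have hβ := hc.2.1.1
    have hβ' := hc'.2.1.1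
    obtain ⟨n, hn⟩ := exp_eq_exp_iff_real e
    set m := min c.2.2 c'.2.2 / 2 with hm
    have hmp : 0 < min c.2.2 c'.2.2 := lt_min hβ hβ'
    have m1 := min_le_left c.2.2 c'.2.2
    have m2 := min_le_right c.2.2 c'.2.2
    refine corners_eq_of_common_direction hc hc' (hcp.trans hcp'.symm) (t := c.2.1 + m)
      (t' := c'.2.1 + m) ⟨by linarith, by linarith⟩ ⟨by linarith, by linarith⟩ ?_
    rw [hn]
    have : c'.2.1 + n * (2 * Real.pi) + m = (c'.2.1 + m) + n * (2 * Real.pi) := by ring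
    rw [this, exp_add_two_pi_mul_int]

theorem exists_two_points_direction {a v x y : ℂ} (hv : v ≠ 0) {I : Set ℝ}
    (hx : x ∈ (fun t : ℝ => a + t * v) '' I) (hy : y ∈ (fun t : ℝ => a + t * v) '' I) (hxy : x ≠ y) :
    ({v / ‖v‖, -(v / ‖v‖)} : Set ℂ) = {(y - x) / ‖y - x‖, -((y - x) / ‖y - x‖)} := by
  obtain ⟨s, hs, hs'⟩ := hx
  obtain ⟨t, ht, ht'⟩ := hy
  have hne : y - x ≠ 0 := sub_ne_zero.2 hxy.symm
  have hn : ((‖y - x‖ : ℝ) : ℂ) ≠ 0 := by exact_mod_cast norm_ne_zero_iff.2 hne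
  rcases eq_or_eq_neg_of_param (p := x) (u := (y - x) / ‖y - x‖) (h := ‖y - x‖) hv
    (norm_div_norm_self hne) (norm_pos_iff.2 hne) hs'.symm (by
      rw [mul_div_cancel₀ _ hn, add_sub_cancel]; exact ht'.symm) with h | h
  · rw [h.2]
  · rw [h.2, neg_neg, Set.pair_comm]

/-- Outside a finite set `E` all corners are flat, and `E` meets every line in the boundary. -/
theorem IsPolygon.exists_exceptional_set {Ω : Set ℂ} (hΩ : IsPolygon Ω) :
    ∃ E : Set ℂ, E.Finite ∧ (∀ c ∈ corners Ω, c.2.2 ≠ Real.pi → c.1 ∈ E) ∧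
      ∀ q u : ℂ, u ≠ 0 → (∀ x : ℝ, q + x * u ∈ frontier Ω) → ∃ x : ℝ, q + x * u ∈ E := by
  obtain ⟨𝒮, hfin, hpc, hfr⟩ := hΩ.frontier_eq
  have hpar : ∀ S : Set ℂ, ∃ a v : ℂ, ∃ I : Set ℝ, S ∈ 𝒮 → v ≠ 0 ∧
      (I = Set.Icc 0 1 ∨ I = Set.Ici 0 ∨ I = Set.univ) ∧ S = (fun t : ℝ => a + t * v) '' I := by
    intro S
    by_cases hS : S ∈ 𝒮
    · obtain ⟨a, v, hv, I, hI, e⟩ := (hpc S hS).exists_param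
      exact ⟨a, v, I, fun _ => ⟨hv, hI, e⟩⟩
    · exact ⟨0, 0, ∅, fun h => absurd h hS⟩
  choose a v I hS using hpar
  -- The base points and the points a + v, which include all endpoints, together with the points
  -- where two pieces cross. Including a base point on full lines too is what lets E meet every line
  -- in the boundary.
  set E : Set ℂ := (⋃ S ∈ 𝒮, {a S, a S + v S}) ∪
    ⋃ S ∈ 𝒮, ⋃ T ∈ 𝒮, {x | x ∈ S ∩ T ∧ (S ∩ T).Subsingleton} with hE
  refine ⟨E, ?_, ?_, ?_⟩
  · refine (hfin.biUnion fun S _ => Set.toFinite _).union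
      (hfin.biUnion fun S _ => hfin.biUnion fun T _ => ?_)
    by_cases h : (S ∩ T).Subsingleton
    · exact h.finite.subset fun x hx => hx.1
    · exact (Set.finite_empty).subset fun x hx => absurd hx.2 h
  · intro c hc
    contrapose!
    intro hcE
    have hcf := hΩ.apex_mem_frontier hc
    have hend : ∀ S ∈ 𝒮, c.1 ≠ a S ∧ c.1 ≠ a S + v S := by
      intro S hSS
      constructor <;> intro h <;> apply hcE <;> left <;> refine Set.mem_biUnion hSS ?_ <;> simp [h]
    have hint : ∀ S ∈ 𝒮, ∀ T ∈ 𝒮, c.1 ∈ S → c.1 ∈ T → ∃ x ∈ S ∩ T, ∃ y ∈ S ∩ T, x ≠ y := by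
      intro S hSS T hTT h1 h2
      by_contra! hcon
      apply hcE
      right
      exact Set.mem_biUnion hSS (Set.mem_biUnion hTT ⟨⟨h1, h2⟩, fun x hx y hy => hcon x hx y hy⟩)
    obtain ⟨S₀, hS₀, hcS₀⟩ : ∃ S ∈ 𝒮, c.1 ∈ S := by
      rw [hfr] at hcf
      exact hcf
    set u := v S₀ / ‖v S₀‖ with hu
    have hu1 : ‖u‖ = 1 := norm_div_norm_self (hS S₀ hS₀).1
    have hdir : ∀ S : Set ℂ, ∃ D : Set ℂ, S ∈ 𝒮 → DirectionsAt S c.1 D ∧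
        (c.1 ∈ S → D = {u, -u}) ∧ (c.1 ∉ S → D = ∅) := by
      intro S
      by_cases hSS : S ∈ 𝒮
      · obtain ⟨hv, hI, e⟩ := hS S hSS
        obtain ⟨D, -, h2, h3, h4⟩ := directionsAt_param (a := a S) hv hI c.1
        rw [← e] at h2 h3
        refine ⟨D, fun _ => ⟨h2, fun hcS => ?_, fun hcS => ?_⟩⟩
        · have hcS' := hcS
          rw [e] at hcS'
          obtain ⟨t, ht, ht'⟩ := hcS'
          have ht0 : t ≠ 0 := by
            rintro rfl
            exact (hend S hSS).1 (by rw [← ht']; simp)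
          have ht1 : t ≠ 1 := by
            rintro rfl
            exact (hend S hSS).2 (by rw [← ht']; simp)
          have htI : t ∈ interior (I S) := by
            rcases hI with hI | hI | hI
            · rw [hI, interior_Icc]
              rw [hI] at ht
              exact ⟨lt_of_le_of_ne ht.1 (Ne.symm ht0), lt_of_le_of_ne ht.2 ht1⟩
            · rw [hI, interior_Ici]
              rw [hI] at ht
              exact lt_of_le_of_ne ht (Ne.symm ht0)
            · rw [hI, interior_univ]; trivial
          rw [h4 t htI ht'.symm]
          obtain ⟨x, hx, y, hy, hxy⟩ := hint S hSS S₀ hS₀ hcS hcS₀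
          rw [exists_two_points_direction hv (e ▸ hx.1) (e ▸ hy.1) hxy, hu,
            exists_two_points_direction (hS S₀ hS₀).1 ((hS S₀ hS₀).2.2 ▸ hx.2)
              ((hS S₀ hS₀).2.2 ▸ hy.2) hxy]
        · exact Set.not_nonempty_iff_eq_empty.1 fun h => hcS (h3.2 h)
      · exact ⟨∅, fun h => absurd h hSS⟩
    choose D hD using hdir
    -- Off E, every piece through the apex passes beyond it and shares a second point with `S₀`, so
    -- all these pieces lie along one line. Exactly two opposite directions remain, and the corner
    -- is flat.
    have hDU : (⋃ S ∈ 𝒮, D S) = {u, -u} := by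
      apply subset_antisymm
      · intro w hw
        simp only [Set.mem_iUnion, exists_prop] at hw
        obtain ⟨S, hSS, hw⟩ := hw
        by_cases hcS : c.1 ∈ S
        · rw [← (hD S hSS).2.1 hcS]; exact hw
        · rw [(hD S hSS).2.2 hcS] at hw; exact absurd hw (Set.notMem_empty _)
      · rw [← (hD S₀ hS₀).2.1 hcS₀]
        exact Set.subset_biUnion_of_mem (u := D) hS₀
    have hdirF : DirectionsAt (frontier Ω) c.1 {u, -u} := by
      rw [hfr, ← hDU]
      exact DirectionsAt.sUnion hfin fun S hSS => (hD S hSS).1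
    obtain ⟨ε, hε, h1⟩ := hdirF
    obtain ⟨δ, hδ, h2⟩ := hΩ.exists_radius_of_corner hc
    have hm : 0 < min ε δ := lt_min hε hδ
    have hr1 : min ε δ / 2 ∈ Set.Ioo 0 ε := ⟨half_pos hm, by have := min_le_left ε δ; linarith⟩
    have hr2 : min ε δ / 2 ∈ Set.Ioo 0 δ := ⟨half_pos hm, by have := min_le_right ε δ; linarith⟩
    set r := min ε δ / 2
    obtain ⟨s1, s2, s3⟩ := h2 r hr2
    have g1 := (h1 r hr1 _ (norm_exp_real_mul_I _)).1 s1
    have g2 := (h1 r hr1 _ (norm_exp_real_mul_I _)).1 s2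
    have hpi := Real.pi_pos
    have hβ := hc.2.1
    have hexpπ : Complex.exp (((c.2.1 + Real.pi : ℝ) : ℂ) * Complex.I) = - Complex.exp (c.2.1 * Complex.I) := by
      push_cast
      rw [add_mul, Complex.exp_add, Complex.exp_pi_mul_I]
      ring
    have hle : c.2.2 ≤ Real.pi := by
      by_contra! hlt
      have h3 := s3 (c.2.1 + Real.pi) ⟨by linarith, by linarith⟩
      refine hΩ.notMem_of_mem_frontier ((h1 r hr1 _ (norm_exp_real_mul_I _)).2 ?_) h3
      rw [hexpπ]
      rcases g1 with g | g
      · rw [g]; right; rfl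
      · rw [g, neg_neg]; left; rfl
    have hcase : Complex.exp (((c.2.1 + c.2.2 : ℝ) : ℂ) * Complex.I) = Complex.exp (c.2.1 * Complex.I) ∨
        Complex.exp (((c.2.1 + c.2.2 : ℝ) : ℂ) * Complex.I)
          = Complex.exp (((c.2.1 + Real.pi : ℝ) : ℂ) * Complex.I) := by
      rw [hexpπ]
      rcases g1 with g | g <;> rcases g2 with g' | g' <;> rw [g, g'] <;> simp
    rcases hcase with h | h
    · obtain ⟨n, hn⟩ := exp_eq_exp_iff_real h
      exfalso
      have hn' : c.2.2 = n * (2 * Real.pi) := by linarith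
      have hb := hβ.1
      have p1 : (0 : ℝ) < n := by
        by_contra! hle
        nlinarith
      have p2 : (n : ℝ) < 1 := by
        by_contra! hle
        nlinarith
      have q1 : 0 < n := by exact_mod_cast p1
      have q2 : n < 1 := by exact_mod_cast p2
      omega
    · obtain ⟨n, hn⟩ := exp_eq_exp_iff_real h
      have hn' : c.2.2 = Real.pi + n * (2 * Real.pi) := by linarith
      have hb := hβ.1
      have p1 : (-1 : ℝ) < n := by
        by_contra! hle
        nlinarith
      have p2 : (n : ℝ) < 1 := by
        by_contra! hle
        nlinarith
      have q1 : -1 < n := by exact_mod_cast p1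
      have q2 : n < 1 := by exact_mod_cast p2
      have : n = 0 := by omega
      rw [hn', this]
      simp
  -- Pigeonhole: two of the points q + nu lie on one piece. That piece is then parallel to u, and
  -- its base point lies on the given line and in E.
  · intro q u hu hline
    rw [hfr] at hline
    choose T hT hqT using fun x : ℝ => hline x
    have : Finite 𝒮 := hfin
    obtain ⟨m, n, hmn, e⟩ := Finite.exists_ne_map_eq_of_infinite
      (fun n : ℕ => (⟨T n, hT n⟩ : 𝒮))
    have e' : T m = T n := congrArg Subtype.val e
    have h1 := hqT m
    have h2 := hqT n
    rw [e'] at h1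
    obtain ⟨hv, hI, eS⟩ := hS (T n) (hT n)
    have h1' := h1
    have h2' := h2
    rw [eS] at h1' h2'
    obtain ⟨s, -, hs⟩ := h1'
    obtain ⟨t, -, ht⟩ := h2'
    simp only at hs ht
    push_cast at hs ht
    have hd : ((s - t : ℝ) : ℂ) * v (T n) = ((m - n : ℝ) : ℂ) * u := by
      push_cast
      linear_combination hs - ht
    have hst : s - t ≠ 0 := by
      intro h0
      rw [h0, Complex.ofReal_zero, zero_mul, eq_comm, mul_eq_zero] at hd
      rcases hd with h | h
      · rw [Complex.ofReal_eq_zero, sub_eq_zero] at h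
        exact hmn (by exact_mod_cast h)
      · exact hu h
    have hstc : ((s - t : ℝ) : ℂ) ≠ 0 := by exact_mod_cast hst
    refine ⟨m - s * ((m - n) / (s - t)), ?_⟩
    have hv' : v (T n) = ((m - n : ℝ) : ℂ) * u / ((s - t : ℝ) : ℂ) := by
      rw [eq_div_iff hstc, ← hd]; ring
    have ea : q + ((m - s * ((m - n) / (s - t)) : ℝ) : ℂ) * u = a (T n) := by
      have : a (T n) = q + m * u - s * v (T n) := by linear_combination hs
      rw [this, hv']
      push_cast
      ring
    rw [ea]
    left
    exact Set.mem_biUnion (hT n) (by simp)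


/-! ### The inverse of the conformal map -/

namespace IsConformalFromDisk

variable {f : ℂ → ℂ} {Ω : Set ℂ}

theorem mem_image (hf : IsConformalFromDisk f Ω) {z : ℂ} (hz : z ∈ Metric.ball (0 : ℂ) 1) : f z ∈ Ω := by
  rw [← hf.image_eq]; exact ⟨z, hz, rfl⟩

theorem inv_mem (hf : IsConformalFromDisk f Ω) {w : ℂ} (hw : w ∈ Ω) :
    Function.invFunOn f (Metric.ball 0 1) w ∈ Metric.ball (0 : ℂ) 1 := by
  rw [← hf.image_eq] at hw
  exact Function.invFunOn_mem hw

theorem apply_inv (hf : IsConformalFromDisk f Ω) {w : ℂ} (hw : w ∈ Ω) :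
    f (Function.invFunOn f (Metric.ball 0 1) w) = w := by
  rw [← hf.image_eq] at hw
  exact Function.invFunOn_eq hw

theorem inv_apply (hf : IsConformalFromDisk f Ω) {z : ℂ} (hz : z ∈ Metric.ball (0 : ℂ) 1) :
    Function.invFunOn f (Metric.ball 0 1) (f z) = z :=
  hf.injOn.leftInvOn_invFunOn hz

theorem differentiableOn_inv (hf : IsConformalFromDisk f Ω) :
    DifferentiableOn ℂ (Function.invFunOn f (Metric.ball 0 1)) Ω := by
  have := differentiableOn_invFunOn Metric.isOpen_ball hf.differentiableOn hf.injOn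
  rwa [hf.image_eq] at this

theorem injOn_inv (hf : IsConformalFromDisk f Ω) :
    Set.InjOn (Function.invFunOn f (Metric.ball 0 1)) Ω := by
  intro w hw w' hw' e
  rw [← hf.apply_inv hw, e, hf.apply_inv hw']

/-- Properness: f maps each smaller closed disk to a compact subset of Ω, which misses a
neighbourhood of w. -/
theorem tendsto_norm_inv (hf : IsConformalFromDisk f Ω) {w : ℂ} (hw : w ∉ Ω) :
    Tendsto (fun v => ‖Function.invFunOn f (Metric.ball 0 1) v‖) (𝓝[Ω] w) (𝓝 1) := by
  rw [Metric.tendsto_nhds]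
  intro ε hε
  set r := max 0 (1 - ε) with hr
  have hr1 : r < 1 := max_lt one_pos (by linarith)
  have hsub : Metric.closedBall (0 : ℂ) r ⊆ Metric.ball 0 1 := Metric.closedBall_subset_ball hr1
  have hK : IsCompact (f '' Metric.closedBall 0 r) :=
    (isCompact_closedBall 0 r).image_of_continuousOn (hf.differentiableOn.continuousOn.mono hsub)
  have hwK : w ∉ f '' Metric.closedBall 0 r := by
    rintro ⟨z, hz, rfl⟩
    exact hw (hf.mem_image (hsub hz))
  filter_upwards [nhdsWithin_le_nhds (hK.isClosed.isOpen_compl.mem_nhds hwK), self_mem_nhdsWithin]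
    with v hv hvΩ
  have h1 := hf.inv_mem hvΩ
  rw [mem_ball_zero_iff] at h1
  have h2 : r < ‖Function.invFunOn f (Metric.ball 0 1) v‖ := by
    by_contra! hle
    exact hv ⟨_, mem_closedBall_zero_iff.2 hle, hf.apply_inv hvΩ⟩
  rw [Real.dist_eq, abs_lt]
  have := le_max_right 0 (1 - ε)
  constructor <;> linarith

end IsConformalFromDisk

/-! ### Power maps of the half plane onto sectors -/

/-- The map of the upper half plane onto the sector at the corner `c`. -/
noncomputable def cornerMap (c : ℂ × ℝ × ℝ) (x : ℂ) : ℂ :=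
  c.1 + Complex.exp (((c.2.1 + c.2.2 / 2 : ℝ) : ℂ) * Complex.I) *
    (-Complex.I * x) ^ ((c.2.2 / Real.pi : ℝ) : ℂ)

/-- The factor -i turns the upper half plane into the right half plane, where the principal power is
holomorphic. The argument then ranges symmetrically about the bisector of the sector; the positive
axis goes to the initial side, the negative axis to the terminal one. -/
theorem cornerMap_eq_polarPoint (c : ℂ × ℝ × ℝ) (x : ℂ) :
    cornerMap c x = polarPoint c.1 (‖x‖ ^ (c.2.2 / Real.pi))
      (c.2.1 + c.2.2 / 2 + (-Complex.I * x).arg * (c.2.2 / Real.pi)) := by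
  rw [cornerMap, polarPoint, Complex.cpow_ofReal]
  have hn : ‖-Complex.I * x‖ = ‖x‖ := by rw [norm_mul, norm_neg, Complex.norm_I, one_mul]
  rw [hn, Complex.ofReal_cos, Complex.ofReal_sin, ← Complex.exp_mul_I]
  congr 1
  rw [mul_left_comm, ← Complex.exp_add]
  congr 2
  push_cast
  ring

theorem neg_I_mul_re (x : ℂ) : (-Complex.I * x).re = x.im := by simp

theorem neg_I_mul_im (x : ℂ) : (-Complex.I * x).im = -x.re := by simp

theorem neg_I_mul_mem_slitPlane {x : ℂ} (hx : 0 ≤ x.im) (h0 : x ≠ 0) :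
    -Complex.I * x ∈ Complex.slitPlane := by
  rw [Complex.mem_slitPlane_iff, neg_I_mul_re, neg_I_mul_im]
  rcases hx.lt_or_eq with h | h
  · exact Or.inl h
  · right
    intro h2
    exact h0 (Complex.ext (by simpa using h2) h.symm)

theorem continuousAt_cornerMap {c : ℂ × ℝ × ℝ} (hc : 0 < c.2.2) {x : ℂ} (hx : 0 ≤ x.im) :
    ContinuousAt (cornerMap c) x := by
  unfold cornerMap
  refine continuousAt_const.add (continuousAt_const.mul ?_)
  have hκ : 0 < c.2.2 / Real.pi := div_pos hc Real.pi_pos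
  by_cases h0 : x = 0
  · subst h0
    have h1 := Complex.continuousAt_cpow_zero_of_re_pos (z := ((c.2.2 / Real.pi : ℝ) : ℂ)) (by simpa using hκ)
    have h2 : ContinuousAt (fun x : ℂ => (-Complex.I * x, ((c.2.2 / Real.pi : ℝ) : ℂ))) 0 := by fun_prop
    have h3 : (fun x : ℂ × ℂ => x.1 ^ x.2) ∘ (fun x : ℂ => (-Complex.I * x, ((c.2.2 / Real.pi : ℝ) : ℂ)))
        = fun x : ℂ => (-Complex.I * x) ^ ((c.2.2 / Real.pi : ℝ) : ℂ) := rfl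
    rw [← h3]
    refine ContinuousAt.comp ?_ h2
    simpa using h1
  · exact ContinuousAt.cpow (by fun_prop) continuousAt_const (neg_I_mul_mem_slitPlane hx h0)

theorem hasDerivAt_cornerMap {c : ℂ × ℝ × ℝ} {x : ℂ} (hx : 0 < x.im) :
    HasDerivAt (cornerMap c) (Complex.exp (((c.2.1 + c.2.2 / 2 : ℝ) : ℂ) * Complex.I) *
      (((c.2.2 / Real.pi : ℝ) : ℂ) * (-Complex.I * x) ^ (((c.2.2 / Real.pi : ℝ) : ℂ) - 1) *
        -Complex.I)) x := by
  have h0 : x ≠ 0 := by rintro rfl; simp at hx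
  have h1 : HasDerivAt (fun x : ℂ => -Complex.I * x) (-Complex.I) x := by
    simpa using (hasDerivAt_id x).const_mul (-Complex.I)
  exact ((h1.cpow_const (neg_I_mul_mem_slitPlane hx.le h0)).const_mul _).const_add c.1

theorem abs_arg_neg_I_mul_lt {x : ℂ} (hx : 0 < x.im) : |(-Complex.I * x).arg| < Real.pi / 2 := by
  rw [Complex.abs_arg_lt_pi_div_two_iff]
  left
  rwa [neg_I_mul_re]

theorem cornerMap_mem_sectorSet {c : ℂ × ℝ × ℝ} (hc : 0 < c.2.2) {x : ℂ} (hx : 0 < x.im) {ε : ℝ}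
    (hε : ‖x‖ ^ (c.2.2 / Real.pi) < ε) : cornerMap c x ∈ sectorSet c ε := by
  have hpi := Real.pi_pos
  have hκ : 0 < c.2.2 / Real.pi := div_pos hc hpi
  have h0 : x ≠ 0 := by rintro rfl; simp at hx
  refine ⟨(‖x‖ ^ (c.2.2 / Real.pi), c.2.1 + c.2.2 / 2 + (-Complex.I * x).arg * (c.2.2 / Real.pi)),
    ⟨⟨Real.rpow_pos_of_pos (norm_pos_iff.2 h0) _, hε⟩, ?_⟩, (cornerMap_eq_polarPoint c x).symm⟩
  have h1 := abs_lt.1 (abs_arg_neg_I_mul_lt hx)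
  have e : Real.pi / 2 * (c.2.2 / Real.pi) = c.2.2 / 2 := by field_simp
  have h2 := mul_lt_mul_of_pos_right h1.1 hκ
  have h3 := mul_lt_mul_of_pos_right h1.2 hκ
  rw [neg_mul, e] at h2
  rw [e] at h3
  constructor <;> simp only <;> linarith

theorem cornerMap_notMem {Ω : Set ℂ} {c : ℂ × ℝ × ℝ} (hc : 0 < c.2.2) {ε : ℝ} (hp : c.1 ∉ Ω)
    (h : ∀ r ∈ Set.Ioo 0 ε, polarPoint c.1 r c.2.1 ∉ Ω ∧ polarPoint c.1 r (c.2.1 + c.2.2) ∉ Ω)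
    {x : ℝ} (hx : |x| ^ (c.2.2 / Real.pi) < ε) : cornerMap c x ∉ Ω := by
  have hpi := Real.pi_pos
  have hκ : 0 < c.2.2 / Real.pi := div_pos hc hpi
  have e : Real.pi / 2 * (c.2.2 / Real.pi) = c.2.2 / 2 := by field_simp
  rcases lt_trichotomy x 0 with h0 | h0 | h0
  · have harg : (-Complex.I * x).arg = Real.pi / 2 := by
      have : -Complex.I * (x : ℂ) = ((-x : ℝ) : ℂ) * Complex.I := by push_cast; ring
      rw [this, Complex.arg_real_mul _ (by linarith), Complex.arg_I]
    rw [cornerMap_eq_polarPoint, harg, e, Complex.norm_real, Real.norm_eq_abs]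
    have : c.2.1 + c.2.2 / 2 + c.2.2 / 2 = c.2.1 + c.2.2 := by ring
    rw [this]
    exact (h _ ⟨Real.rpow_pos_of_pos (abs_pos.2 h0.ne) _, hx⟩).2
  · subst h0
    rw [cornerMap, Complex.ofReal_zero, mul_zero, Complex.zero_cpow (by exact_mod_cast hκ.ne'), mul_zero,
      add_zero]
    exact hp
  · have harg : (-Complex.I * x).arg = -(Real.pi / 2) := by
      have : -Complex.I * (x : ℂ) = (x : ℂ) * (-Complex.I) := by ring
      rw [this, Complex.arg_real_mul _ h0, Complex.arg_neg_I]
    rw [cornerMap_eq_polarPoint, harg, neg_mul, e, Complex.norm_real, Real.norm_eq_abs]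
    have : c.2.1 + c.2.2 / 2 + -(c.2.2 / 2) = c.2.1 := by ring
    rw [this]
    exact (h _ ⟨Real.rpow_pos_of_pos (abs_pos.2 h0.ne') _, hx⟩).1

/-- An angle of at most 2π keeps the imaginary part of the exponent in (-π, π), where exp is
injective. -/
theorem injOn_cornerMap {c : ℂ × ℝ × ℝ} (hc : c.2.2 ∈ Set.Ioc 0 (2 * Real.pi)) :
    Set.InjOn (cornerMap c) {x | 0 < x.im} := by
  intro x hx y hy e
  have hpi := Real.pi_pos
  have hκ : 0 < c.2.2 / Real.pi := div_pos hc.1 hpi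
  have hκ2 : c.2.2 / Real.pi ≤ 2 := by rw [div_le_iff₀ hpi]; exact hc.2
  have hne : ∀ {x : ℂ}, 0 < x.im → -Complex.I * x ≠ 0 := by
    intro x hx h
    rw [mul_eq_zero] at h
    rcases h with h | h
    · simp at h
    · rw [h] at hx; simp at hx
  have e1 := mul_left_cancel₀ (Complex.exp_ne_zero _) (add_left_cancel e)
  rw [Complex.cpow_def_of_ne_zero (hne hx), Complex.cpow_def_of_ne_zero (hne hy)] at e1
  have hb : ∀ {x : ℂ}, 0 < x.im → |(Complex.log (-Complex.I * x) * ((c.2.2 / Real.pi : ℝ) : ℂ)).im| < Real.pi := by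
    intro x hx
    rw [Complex.im_mul_ofReal, Complex.log_im, abs_mul, abs_of_pos hκ]
    have := abs_arg_neg_I_mul_lt hx
    calc _ < Real.pi / 2 * (c.2.2 / Real.pi) := mul_lt_mul_of_pos_right this hκ
      _ ≤ Real.pi / 2 * 2 := mul_le_mul_of_nonneg_left hκ2 (by positivity)
      _ = Real.pi := by ring
  have hx' := abs_lt.1 (hb hx)
  have hy' := abs_lt.1 (hb hy)
  have e2 := Complex.exp_inj_of_neg_pi_lt_of_le_pi hx'.1 hx'.2.le hy'.1 hy'.2.le e1
  have e3 := mul_right_cancel₀ (by exact_mod_cast hκ.ne') e2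
  have e4 : -Complex.I * x = -Complex.I * y := by
    rw [← Complex.exp_log (hne hx), e3, Complex.exp_log (hne hy)]
  exact mul_left_cancel₀ (by simp) e4

theorem exists_cornerMap_eq {c : ℂ × ℝ × ℝ} (hc : 0 < c.2.2) {ε : ℝ} {w : ℂ} (hw : w ∈ sectorSet c ε) :
    ∃ x : ℂ, 0 < x.im ∧ ‖x‖ ^ (c.2.2 / Real.pi) < ε ∧ cornerMap c x = w := by
  obtain ⟨⟨r, t⟩, ⟨hr, ht⟩, rfl⟩ := hw
  have hpi := Real.pi_pos
  have hκ : 0 < c.2.2 / Real.pi := div_pos hc hpi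
  simp only at hr ht ⊢
  set κ := c.2.2 / Real.pi with hκd
  set τ := (t - c.2.1 - c.2.2 / 2) / κ with hτ
  have hβ : c.2.2 = κ * Real.pi := by rw [hκd]; field_simp
  have hτ1 : -(Real.pi / 2) < τ := by
    rw [hτ, lt_div_iff₀ hκ]; have := ht.1; nlinarith
  have hτ2 : τ < Real.pi / 2 := by
    rw [hτ, div_lt_iff₀ hκ]; have := ht.2; nlinarith
  set ρ := r ^ (1 / κ) with hρ
  have hρ0 : 0 < ρ := Real.rpow_pos_of_pos hr.1 _
  have hρκ : ρ ^ κ = r := by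
    rw [hρ, ← Real.rpow_mul hr.1.le, one_div, inv_mul_cancel₀ hκ.ne', Real.rpow_one]
  set x : ℂ := Complex.I * (ρ * Complex.exp (τ * Complex.I)) with hx
  have hIx : -Complex.I * x = ρ * Complex.exp (τ * Complex.I) := by
    rw [hx, ← mul_assoc, neg_mul, Complex.I_mul_I, neg_neg, one_mul]
  have hnx : ‖x‖ = ρ := by
    rw [hx, norm_mul, Complex.norm_I, one_mul, norm_mul, norm_exp_real_mul_I, mul_one,
      Complex.norm_real, Real.norm_eq_abs, abs_of_pos hρ0]
  have harg : (-Complex.I * x).arg = τ := by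
    rw [hIx, Complex.exp_mul_I]
    exact Complex.arg_mul_cos_add_sin_mul_I hρ0 ⟨by linarith, by linarith⟩
  refine ⟨x, ?_, by rw [hnx, hρκ]; exact hr.2, ?_⟩
  · rw [← neg_I_mul_re, hIx, Complex.re_ofReal_mul, Complex.exp_ofReal_mul_I_re]
    exact mul_pos hρ0 (Real.cos_pos_of_mem_Ioo ⟨hτ1, hτ2⟩)
  · rw [cornerMap_eq_polarPoint, harg, hnx, ← hκd, hρκ]
    congr 1
    rw [hτ]
    field_simp
    ring

/-! ### Charts at corners -/

/-- Difference quotients along the real axis are real, and those along the positive imaginary axis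
have nonnegative real part. -/
theorem hasDerivAt_pos_of_im {L : ℂ → ℂ} {L' : ℂ} (hL : HasDerivAt L L' 0) (h0 : L 0 = 0) (hne : L' ≠ 0)
    (hre : ∀ᶠ x in 𝓝 (0 : ℂ), x.im = 0 → (L x).im = 0)
    (hpos : ∀ᶠ x in 𝓝 (0 : ℂ), 0 < x.im → 0 < (L x).im) : ∃ m : ℝ, 0 < m ∧ L' = m := by
  have hsl := hasDerivAt_iff_tendsto_slope.1 hL
  have t1 : Tendsto (fun y : ℝ => (y : ℂ)) (𝓝[>] 0) (𝓝[≠] 0) := by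
    rw [tendsto_nhdsWithin_iff]
    constructor
    · have := (Complex.continuous_ofReal.tendsto 0).mono_left (nhdsWithin_le_nhds (s := Set.Ioi (0 : ℝ)))
      simpa using this
    · filter_upwards [self_mem_nhdsWithin] with y hy
      have : (y : ℝ) ≠ 0 := ne_of_gt hy
      simpa using this
  have t2 : Tendsto (fun y : ℝ => (y : ℂ) * Complex.I) (𝓝[>] 0) (𝓝[≠] 0) := by
    rw [tendsto_nhdsWithin_iff]
    constructor
    · have hc : Continuous fun y : ℝ => (y : ℂ) * Complex.I := by fun_prop
      have := (hc.tendsto 0).mono_left (nhdsWithin_le_nhds (s := Set.Ioi (0 : ℝ)))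
      simpa using this
    · filter_upwards [self_mem_nhdsWithin] with y hy
      have : (y : ℝ) ≠ 0 := ne_of_gt hy
      simpa using this
  have him : L'.im = 0 := by
    have h1 := (Complex.continuous_im.tendsto _).comp (hsl.comp t1)
    refine tendsto_nhds_unique (h1.congr' ?_) tendsto_const_nhds
    filter_upwards [(t1.mono_right nhdsWithin_le_nhds).eventually hre] with y hy
    simp only [Function.comp_apply, slope_def_field, h0, sub_zero]
    have := hy (by simp)
    rw [Complex.div_ofReal_im, this, zero_div]
  have hre' : 0 ≤ L'.re := by
    have h1 := (Complex.continuous_re.tendsto _).comp (hsl.comp t2)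
    refine ge_of_tendsto h1 ?_
    filter_upwards [(t2.mono_right nhdsWithin_le_nhds).eventually hpos, self_mem_nhdsWithin] with y hy hy0
    have hy0' : (0 : ℝ) < y := hy0
    simp only [Function.comp_apply, slope_def_field, h0, sub_zero]
    have := hy (by simpa using hy0')
    have e : L (y * Complex.I) / (y * Complex.I) = (-Complex.I * L (y * Complex.I)) / (y : ℂ) := by
      have : (y : ℂ) ≠ 0 := by exact_mod_cast hy0'.ne'
      field_simp
      rw [Complex.I_sq]
      ring
    rw [e, Complex.div_ofReal_re, neg_I_mul_re]
    exact div_nonneg this.le hy0'.le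
  have e : L' = (L'.re : ℂ) := Complex.ext (by simp) (by simpa using him)
  refine ⟨L'.re, lt_of_le_of_ne hre' ?_, e⟩
  intro h
  exact hne (by rw [e, ← h]; simp)

/-- The circle point `a` corresponds to the corner `c` under the conformal map `f`: in the
coordinate `s`, `z = a * exp (I * s)`, the map is `cornerMap c` after a local change of variables
preserving the real axis. -/
def IsPrevertex (f : ℂ → ℂ) (c : ℂ × ℝ × ℝ) (a : ℂ) : Prop :=
  ‖a‖ = 1 ∧
  (∃ σ : ℂ → ℂ, AnalyticAt ℂ σ 0 ∧ σ 0 = 0 ∧ (∃ m : ℝ, 0 < m ∧ deriv σ 0 = m) ∧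
    (∀ᶠ s in 𝓝 (0 : ℂ), 0 < s.im → 0 < (σ s).im) ∧ (∀ᶠ s in 𝓝 (0 : ℂ), s.im = 0 → (σ s).im = 0) ∧
    ∀ᶠ s in 𝓝 (0 : ℂ), 0 < s.im → f (a * Complex.exp (Complex.I * s)) = cornerMap c (σ s)) ∧
  ∀ V ∈ 𝓝 a, ∃ ε > 0, ∀ w ∈ sectorSet c ε, Function.invFunOn f (Metric.ball 0 1) w ∈ V

/-- The inverse of f composed with the sector map has modulus tending to 1 at the real axis, so it
reflects to an injective holomorphic H near 0. The prevertex is H(0), and H serves as a local chart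
of the circle. -/
theorem exists_isPrevertex {f : ℂ → ℂ} {Ω : Set ℂ} (hΩ : IsPolygon Ω) (hf : IsConformalFromDisk f Ω)
    {c : ℂ × ℝ × ℝ} (hc : c ∈ corners Ω) : ∃ a : ℂ, IsPrevertex f c a := by
  set g := Function.invFunOn f (Metric.ball 0 1) with hg
  obtain ⟨ε, hε, hsec, hside⟩ := exists_sectorSet_subset hc
  have hβ := hc.2.1.1
  have hpi := Real.pi_pos
  have hκ : 0 < c.2.2 / Real.pi := div_pos hβ hpi
  set κ := c.2.2 / Real.pi with hκd
  set δ := ε ^ (1 / κ) with hδ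
  have hδ0 : 0 < δ := Real.rpow_pos_of_pos hε _
  have hδκ : δ ^ κ = ε := by
    rw [hδ, ← Real.rpow_mul hε.le, one_div, inv_mul_cancel₀ hκ.ne', Real.rpow_one]
  have hpow : ∀ {x δ' : ℝ}, 0 ≤ x → x < δ' → x ^ κ < δ' ^ κ := fun h0 h => Real.rpow_lt_rpow h0 h hκ
  have hmemΩ : ∀ x ∈ Metric.ball (0 : ℂ) δ ∩ {s | 0 < s.im}, cornerMap c x ∈ Ω := by
    rintro x ⟨hx1, hx2⟩
    rw [mem_ball_zero_iff] at hx1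
    exact hsec (cornerMap_mem_sectorSet hβ hx2 (by rw [← hδκ]; exact hpow (norm_nonneg _) hx1))
  obtain ⟨ρ, hρ, hρδ, H, hHd, hHi, hHu, hHm, hHl⟩ := exists_reflection (G := fun x => g (cornerMap c x)) hδ0
    (hf.differentiableOn_inv.comp
      (fun x hx => (hasDerivAt_cornerMap hx.2).differentiableAt.differentiableWithinAt) hmemΩ)
    (hf.injOn_inv.comp ((injOn_cornerMap hc.2.1).mono Set.inter_subset_right) hmemΩ)
    (fun x hx => by
      have := hf.inv_mem (hmemΩ x hx)
      rwa [mem_ball_zero_iff] at this)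
    (fun x hx => by
      rw [mem_ball_zero_iff, Complex.norm_real, Real.norm_eq_abs] at hx
      have hnot : cornerMap c x ∉ Ω :=
        cornerMap_notMem hβ (hΩ.notMem_of_mem_frontier (hΩ.apex_mem_frontier hc)) hside
          (by rw [← hδκ]; exact hpow (abs_nonneg _) hx)
      refine (hf.tendsto_norm_inv hnot).comp ?_
      rw [tendsto_nhdsWithin_iff]
      refine ⟨(continuousAt_cornerMap hβ (by simp)).tendsto.mono_left nhdsWithin_le_nhds, ?_⟩
      have hxb : (x : ℂ) ∈ Metric.ball (0 : ℂ) δ := by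
        rw [mem_ball_zero_iff, Complex.norm_real, Real.norm_eq_abs]; exact hx
      filter_upwards [nhdsWithin_le_nhds (Metric.isOpen_ball.mem_nhds hxb), self_mem_nhdsWithin]
        with s h1 h2 using hmemΩ s ⟨h1, h2⟩)
  have h0m : (0 : ℂ) ∈ Metric.ball (0 : ℂ) ρ := Metric.mem_ball_self hρ
  have hbn : Metric.ball (0 : ℂ) ρ ∈ 𝓝 (0 : ℂ) := Metric.ball_mem_nhds _ hρ
  set a := H 0 with ha
  have ha1 : ‖a‖ = 1 := hHm 0 h0m rfl
  have ha0 : a ≠ 0 := by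
    intro h; rw [h, norm_zero] at ha1; norm_num at ha1
  have hHa : AnalyticAt ℂ H 0 := hHd.analyticAt hbn
  have hH'0 : deriv H 0 ≠ 0 := deriv_ne_zero_of_injOn Metric.isOpen_ball hHd hHi h0m
  -- Since Im L = -log |H|, the map L takes the real axis to itself and preserves the two sides. The
  -- change of variable σ is its local inverse.
  set L : ℂ → ℂ := fun x => -Complex.I * Complex.log (H x / a) with hL
  have hslit : H 0 / a ∈ Complex.slitPlane := by
    rw [← ha, div_self ha0]; exact Complex.one_mem_slitPlane
  have hLa : AnalyticAt ℂ L 0 := analyticAt_const.mul ((hHa.div analyticAt_const ha0).clog hslit)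
  have hL0 : L 0 = 0 := by simp [hL, ← ha, div_self ha0]
  have hLd : HasDerivAt L (-Complex.I * (deriv H 0 / a / (H 0 / a))) 0 :=
    ((hHa.differentiableAt.hasDerivAt.div_const a).clog hslit).const_mul _
  have hLd0 : -Complex.I * (deriv H 0 / a / (H 0 / a)) ≠ 0 := by
    rw [← ha, div_self ha0, div_one]
    exact mul_ne_zero (by simp) (div_ne_zero hH'0 ha0)
  have hHne : ∀ᶠ x in 𝓝 (0 : ℂ), H x ≠ 0 := hHa.continuousAt.eventually_ne (by rw [← ha]; exact ha0)
  have himL : ∀ x, (L x).im = -Real.log ‖H x‖ := by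
    intro x
    rw [hL]
    simp only
    rw [neg_I_mul_im, Complex.log_re, norm_div, ha1, div_one]
  have hLu : ∀ᶠ x in 𝓝 (0 : ℂ), 0 < x.im → 0 < (L x).im := by
    filter_upwards [hbn, hHne] with x hx hne h
    rw [himL]
    have := Real.log_neg (norm_pos_iff.2 hne) (hHu x hx h).2
    linarith
  have hLm : ∀ᶠ x in 𝓝 (0 : ℂ), x.im = 0 → (L x).im = 0 := by
    filter_upwards [hbn] with x hx h
    rw [himL, hHm x hx h, Real.log_one, neg_zero]
  have hLl : ∀ᶠ x in 𝓝 (0 : ℂ), x.im < 0 → (L x).im < 0 := by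
    filter_upwards [hbn] with x hx h
    rw [himL]
    have := Real.log_pos (hHl x hx h)
    linarith
  obtain ⟨m, hm, hm'⟩ := hasDerivAt_pos_of_im hLd hL0 hLd0 hLm hLu
  rw [hm'] at hLd hLd0
  have hLd' : deriv L 0 ≠ 0 := by rw [hLd.deriv]; exact hLd0
  set σ := hLa.hasStrictDerivAt.localInverse _ _ _ hLd' with hσ
  have hσa : AnalyticAt ℂ σ 0 := by
    have := hLa.analyticAt_localInverse hLd'
    rwa [hL0] at this
  have hσ0 : σ 0 = 0 := by
    have : σ (L 0) = 0 := HasStrictFDerivAt.localInverse_apply_image ..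
    rwa [hL0] at this
  have hLσ : ∀ᶠ s in 𝓝 (0 : ℂ), L (σ s) = s := by
    have := HasStrictDerivAt.eventually_right_inverse hLa.hasStrictDerivAt hLd'
    rwa [hL0] at this
  have hσt : Tendsto σ (𝓝 0) (𝓝 0) := by
    have := hσa.continuousAt.tendsto
    rwa [hσ0] at this
  have hσd : deriv σ 0 = ((m⁻¹ : ℝ) : ℂ) := by
    have h1 : HasDerivAt (fun s => L (σ s)) (m * deriv σ 0) 0 := by
      have h2 : HasDerivAt L m (σ 0) := by rw [hσ0]; exact hLd
      exact h2.comp 0 hσa.differentiableAt.hasDerivAt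
    have h2 := (h1.congr_of_eventuallyEq (f₁ := id) (hLσ.mono fun s hs => hs.symm)).unique (hasDerivAt_id 0)
    push_cast
    exact eq_inv_of_mul_eq_one_right h2
  refine ⟨a, ha1, ⟨σ, hσa, hσ0, ⟨m⁻¹, inv_pos.2 hm, hσd⟩, ?_, ?_, ?_⟩, ?_⟩
  · filter_upwards [hLσ, hσt.eventually hLm, hσt.eventually hLl] with s h1 h2 h3 hs
    by_contra! hle
    rcases hle.lt_or_eq with h | h
    · have := h3 h; rw [h1] at this; linarith
    · have := h2 h; rw [h1] at this; linarith
  · filter_upwards [hLσ, hσt.eventually hLu, hσt.eventually hLl] with s h1 h2 h3 hs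
    rcases lt_trichotomy (σ s).im 0 with h | h | h
    · have := h3 h; rw [h1] at this; linarith
    · exact h
    · have := h2 h; rw [h1] at this; linarith
  · filter_upwards [hLσ, hσt.eventually hLm, hσt.eventually hLl, hσt.eventually hHne, hσt.eventually hbn]
      with s h1 h2 h3 h4 h5 hs
    have hup : 0 < (σ s).im := by
      by_contra! hle
      rcases hle.lt_or_eq with h | h
      · have := h3 h; rw [h1] at this; linarith
      · have := h2 h; rw [h1] at this; linarith
    have e : a * Complex.exp (Complex.I * s) = H (σ s) := by
      have key : a * Complex.exp (Complex.I * L (σ s)) = H (σ s) := by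
        simp only [hL]
        rw [← mul_assoc, mul_neg, Complex.I_mul_I, neg_neg, one_mul,
          Complex.exp_log (div_ne_zero h4 ha0), mul_div_cancel₀ _ ha0]
      rwa [h1] at key
    rw [e, (hHu _ h5 hup).1]
    exact hf.apply_inv (hmemΩ _ ⟨Metric.ball_subset_ball hρδ h5, hup⟩)
  -- Small sectors are images of small half disks, on which the inverse of f is the continuous map
  -- H.
  · intro V hV
    have hpre : H ⁻¹' V ∩ Metric.ball 0 ρ ∈ 𝓝 (0 : ℂ) :=
      Filter.inter_mem (hHa.continuousAt.preimage_mem_nhds hV) hbn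
    obtain ⟨η, hη, hηV⟩ := Metric.mem_nhds_iff.1 hpre
    refine ⟨η ^ κ, Real.rpow_pos_of_pos hη _, fun w hw => ?_⟩
    obtain ⟨x, hx1, hx2, rfl⟩ := exists_cornerMap_eq hβ hw
    have hxη : x ∈ Metric.ball (0 : ℂ) η := by
      rw [mem_ball_zero_iff]
      by_contra! hle
      exact absurd hx2 (not_lt.2 (Real.rpow_le_rpow hη.le hle hκ.le))
    have h2 := hηV hxη
    have h3 := (hHu x h2.2 hx1).1
    have h4 : H x ∈ V := h2.1
    rwa [h3] at h4


/-! ### The exponential coordinate near a point of the circle -/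

theorem norm_mul_exp_I_mul {a : ℂ} (ha : ‖a‖ = 1) (s : ℂ) :
    ‖a * Complex.exp (Complex.I * s)‖ = Real.exp (-s.im) := by
  rw [norm_mul, ha, one_mul, Complex.norm_exp]
  simp

theorem mul_exp_I_mul_mem_ball {a : ℂ} (ha : ‖a‖ = 1) {s : ℂ} :
    a * Complex.exp (Complex.I * s) ∈ Metric.ball (0 : ℂ) 1 ↔ 0 < s.im := by
  rw [mem_ball_zero_iff, norm_mul_exp_I_mul ha, Real.exp_lt_one_iff]
  simp

theorem tendsto_strip {a : ℂ} (ha : ‖a‖ = 1) (t : ℂ) :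
    Tendsto (fun s => a * Complex.exp (Complex.I * s)) (𝓝[{s | 0 < s.im}] t)
      (𝓝[Metric.ball 0 1] (a * Complex.exp (Complex.I * t))) := by
  rw [tendsto_nhdsWithin_iff]
  constructor
  · have : Continuous fun s => a * Complex.exp (Complex.I * s) := by fun_prop
    exact (this.tendsto t).mono_left nhdsWithin_le_nhds
  · filter_upwards [self_mem_nhdsWithin] with s hs
    exact (mul_exp_I_mul_mem_ball ha).2 hs

theorem map_strip {a : ℂ} (ha : ‖a‖ = 1) :
    Filter.map (fun s => a * Complex.exp (Complex.I * s)) (𝓝[{s | 0 < s.im}] 0) =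
      𝓝[Metric.ball 0 1] a := by
  have ha0 : a ≠ 0 := by
    intro h; rw [h, norm_zero] at ha; norm_num at ha
  have hne : ∀ᶠ z in 𝓝[Metric.ball 0 1] a, z ≠ 0 :=
    nhdsWithin_le_nhds (isOpen_ne.mem_nhds ha0)
  have hinv : ∀ z, z ≠ 0 → a * Complex.exp (Complex.I * (-Complex.I * Complex.log (z / a))) = z := by
    intro z hz
    rw [← mul_assoc, mul_neg, Complex.I_mul_I, neg_neg, one_mul, Complex.exp_log (div_ne_zero hz ha0),
      mul_div_cancel₀ _ ha0]
  apply le_antisymm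
  · have := tendsto_strip ha 0
    rwa [mul_zero, Complex.exp_zero, mul_one] at this
  · have h1 : Tendsto (fun z => -Complex.I * Complex.log (z / a)) (𝓝[Metric.ball 0 1] a)
        (𝓝[{s | 0 < s.im}] 0) := by
      rw [tendsto_nhdsWithin_iff]
      constructor
      · have hc : ContinuousAt (fun z => -Complex.I * Complex.log (z / a)) a := by
          refine continuousAt_const.mul ((continuousAt_id.div_const a).clog ?_)
          rw [id, div_self ha0]
          exact Complex.one_mem_slitPlane
        have := hc.tendsto.mono_left (nhdsWithin_le_nhds (s := Metric.ball (0 : ℂ) 1))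
        rwa [div_self ha0, Complex.log_one, mul_zero] at this
      · filter_upwards [self_mem_nhdsWithin, hne] with z hz hz0
        rw [mem_ball_zero_iff] at hz
        rw [neg_I_mul_im, Complex.log_re, norm_div, ha, div_one]
        have := Real.log_neg (norm_pos_iff.2 hz0) hz
        linarith
    calc 𝓝[Metric.ball 0 1] a
        = Filter.map (fun z => a * Complex.exp (Complex.I * (-Complex.I * Complex.log (z / a))))
            (𝓝[Metric.ball 0 1] a) := by
          have h2 : (fun z => a * Complex.exp (Complex.I * (-Complex.I * Complex.log (z / a))))
              =ᶠ[𝓝[Metric.ball 0 1] a] id := by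
            filter_upwards [hne] with z hz using hinv z hz
          rw [Filter.map_congr h2, Filter.map_id]
      _ = Filter.map (fun s => a * Complex.exp (Complex.I * s))
            (Filter.map (fun z => -Complex.I * Complex.log (z / a)) (𝓝[Metric.ball 0 1] a)) := by
          rw [Filter.map_map]; rfl
      _ ≤ _ := Filter.map_mono h1

instance neBot_upper_zero (t : ℝ) : (𝓝[{s : ℂ | 0 < s.im}] (t : ℂ)).NeBot := by
  rw [← mem_closure_iff_nhdsWithin_neBot, Complex.closure_setOfPred_lt_im]
  simp

theorem neBot_nhdsWithin_ball {a : ℂ} (ha : ‖a‖ = 1) : (𝓝[Metric.ball (0 : ℂ) 1] a).NeBot := by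
  rw [← mem_closure_iff_nhdsWithin_neBot, closure_ball _ one_ne_zero, mem_closedBall_zero_iff, ha]

/-! ### Prevertices -/

theorem IsPrevertex.eventually_mem_sectorSet {f : ℂ → ℂ} {c : ℂ × ℝ × ℝ} {a : ℂ}
    (h : IsPrevertex f c a) (hc : 0 < c.2.2) {ε : ℝ} (hε : 0 < ε) :
    ∀ᶠ z in 𝓝[Metric.ball 0 1] a, f z ∈ sectorSet c ε := by
  obtain ⟨ha, ⟨σ, hσa, hσ0, -, hσu, -, hσf⟩, -⟩ := h
  rw [← map_strip ha, eventually_map]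
  have hκ : 0 < c.2.2 / Real.pi := div_pos hc Real.pi_pos
  have hsmall : ∀ᶠ s in 𝓝 (0 : ℂ), ‖σ s‖ ^ (c.2.2 / Real.pi) < ε := by
    have h1 : ContinuousAt (fun s => ‖σ s‖ ^ (c.2.2 / Real.pi)) 0 :=
      hσa.continuousAt.norm.rpow_const (Or.inr hκ.le)
    have h2 := h1.tendsto
    simp only [hσ0, norm_zero, Real.zero_rpow hκ.ne'] at h2
    exact h2.eventually (gt_mem_nhds hε)
  filter_upwards [nhdsWithin_le_nhds hσu, nhdsWithin_le_nhds hσf, nhdsWithin_le_nhds hsmall,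
    self_mem_nhdsWithin] with s h1 h2 h3 hs
  rw [h2 hs]
  exact cornerMap_mem_sectorSet hc (h1 hs) h3

theorem dist_lt_of_mem_sectorSet {c : ℂ × ℝ × ℝ} {ε : ℝ} {w : ℂ} (hw : w ∈ sectorSet c ε) :
    dist w c.1 < ε := by
  obtain ⟨x, ⟨h1, h2⟩, rfl⟩ := hw
  simp only
  rw [dist_polarPoint h1.1.le]
  exact h1.2

theorem mem_sectorSet_of_dist_lt {c : ℂ × ℝ × ℝ} {ε δ : ℝ} {w : ℂ} (hw : w ∈ sectorSet c ε)
    (h : dist w c.1 < δ) : w ∈ sectorSet c δ := by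
  obtain ⟨x, ⟨h1, h2⟩, rfl⟩ := hw
  simp only at h
  rw [dist_polarPoint h1.1.le] at h
  exact ⟨x, ⟨⟨h1.1, h⟩, h2⟩, rfl⟩

theorem IsPrevertex.tendsto_apex {f : ℂ → ℂ} {c : ℂ × ℝ × ℝ} {a : ℂ} (h : IsPrevertex f c a)
    (hc : 0 < c.2.2) : Tendsto f (𝓝[Metric.ball 0 1] a) (𝓝 c.1) := by
  rw [Metric.tendsto_nhds]
  intro ε hε
  filter_upwards [h.eventually_mem_sectorSet hc hε] with z hz using dist_lt_of_mem_sectorSet hz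

theorem corners_eq_of_mem_sectorSet {Ω : Set ℂ} {c c' : ℂ × ℝ × ℝ} (hc : c ∈ corners Ω)
    (hc' : c' ∈ corners Ω) (hp : c.1 = c'.1) {ε ε' : ℝ} {w : ℂ} (hw : w ∈ sectorSet c ε)
    (hw' : w ∈ sectorSet c' ε') : c = c' := by
  obtain ⟨x, ⟨h1, h2⟩, hx⟩ := hw
  obtain ⟨y, ⟨h1', h2'⟩, hy⟩ := hw'
  simp only at hx hy
  have d1 : x.1 = dist w c.1 := by rw [← hx, dist_polarPoint h1.1.le]
  have d2 : y.1 = dist w c.1 := by rw [hp, ← hy, dist_polarPoint h1'.1.le]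
  refine corners_eq_of_common_direction hc hc' hp h2 h2' ?_
  have e := hx.trans hy.symm
  rw [d1.trans d2.symm, hp, polarPoint, polarPoint] at e
  exact mul_left_cancel₀ (by exact_mod_cast h1'.1.ne') (add_left_cancel e)

theorem IsPrevertex.corner_unique {f : ℂ → ℂ} {Ω : Set ℂ} {c c' : ℂ × ℝ × ℝ} (hc : c ∈ corners Ω)
    (hc' : c' ∈ corners Ω) {a : ℂ} (h : IsPrevertex f c a) (h' : IsPrevertex f c' a) : c = c' := by
  have := neBot_nhdsWithin_ball h.1
  have hp : c.1 = c'.1 := tendsto_nhds_unique (h.tendsto_apex hc.2.1.1) (h'.tendsto_apex hc'.2.1.1)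
  obtain ⟨z, hz, hz'⟩ := ((h.eventually_mem_sectorSet hc.2.1.1 one_pos).and
    (h'.eventually_mem_sectorSet hc'.2.1.1 one_pos)).exists
  exact corners_eq_of_mem_sectorSet hc hc' hp hz hz'

theorem IsPrevertex.unique {f : ℂ → ℂ} {Ω : Set ℂ} {c : ℂ × ℝ × ℝ} (hc : c ∈ corners Ω)
    {a a' : ℂ} (h : IsPrevertex f c a) (h' : IsPrevertex f c a') : a = a' := by
  by_contra hne
  obtain ⟨U, V, hU, hV, haU, haV, hUV⟩ := t2_separation hne
  obtain ⟨ε, hε, h1⟩ := h.2.2 U (hU.mem_nhds haU)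
  obtain ⟨ε', hε', h1'⟩ := h'.2.2 V (hV.mem_nhds haV)
  have := neBot_nhdsWithin_ball h.1
  obtain ⟨z, hz⟩ := (h.eventually_mem_sectorSet hc.2.1.1 (lt_min hε hε')).exists
  exact Set.disjoint_left.1 hUV (h1 _ (sectorSet_mono (min_le_left _ _) hz))
    (h1' _ (sectorSet_mono (min_le_right _ _) hz))

/-- Every point of the circle is a prevertex of a corner, or a point at which `f` tends to `∞`. -/
theorem isPrevertex_or_tendsto_cobounded {f : ℂ → ℂ} {Ω : Set ℂ} (hΩ : IsPolygon Ω)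
    (hf : IsConformalFromDisk f Ω) {ζ : ℂ} (hζ : ‖ζ‖ = 1) :
    (∃ c ∈ corners Ω, IsPrevertex f c ζ) ∨
      Tendsto f (𝓝[Metric.ball 0 1] ζ) (Bornology.cobounded ℂ) := by
  rw [or_iff_not_imp_right]
  intro hnt
  set g := Function.invFunOn f (Metric.ball 0 1) with hg
  rw [← tendsto_norm_atTop_iff_cobounded, tendsto_atTop] at hnt
  push Not at hnt
  obtain ⟨R, hR⟩ := hnt
  have hne : (Filter.map f (𝓝[Metric.ball 0 1] ζ) ⊓ 𝓟 (Metric.closedBall 0 R)).NeBot := by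
    rw [← Filter.frequently_mem_iff_neBot, Filter.frequently_map]
    refine hR.mono fun z hz => ?_
    rw [mem_closedBall_zero_iff]
    exact hz.le
  obtain ⟨p, -, hp⟩ := (isCompact_closedBall (0 : ℂ) R) (f := Filter.map f (𝓝[Metric.ball 0 1] ζ) ⊓
    𝓟 (Metric.closedBall 0 R)) inf_le_right
  have hp' : ClusterPt p (Filter.map f (𝓝[Metric.ball 0 1] ζ)) := hp.mono inf_le_left
  -- If f does not tend to ∞, it has a finite cluster value p at ζ; along the filter F the points
  -- tend to ζ and their images to p.
  set F := 𝓝[Metric.ball 0 1] ζ ⊓ Filter.comap f (𝓝 p) with hF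
  have hFn : F.NeBot := by
    have h1 : (Filter.map f (𝓝[Metric.ball 0 1] ζ) ⊓ 𝓝 p).NeBot := by
      rw [inf_comm]; exact hp'
    rw [← Filter.push_pull] at h1
    exact Filter.map_neBot_iff f |>.1 h1
  have hFf : Tendsto f F (𝓝 p) := tendsto_comap.mono_left inf_le_right
  have hFz : Tendsto id F (𝓝 ζ) := tendsto_id.mono_left (inf_le_left.trans nhdsWithin_le_nhds)
  have hFb : ∀ᶠ z in F, z ∈ Metric.ball (0 : ℂ) 1 := Filter.mem_inf_of_left self_mem_nhdsWithin
  have hpΩ : p ∉ Ω := by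
    intro h
    have h1 : ContinuousAt g p := hf.differentiableOn_inv.continuousOn.continuousAt (hΩ.isOpen.mem_nhds h)
    have h2 : Tendsto (fun z => g (f z)) F (𝓝 (g p)) := h1.tendsto.comp hFf
    have h3 : ζ = g p := by
      refine tendsto_nhds_unique hFz (h2.congr' ?_)
      filter_upwards [hFb] with z hz using hf.inv_apply hz
    have h4 := hf.inv_mem h
    rw [← hg, ← h3, mem_ball_zero_iff, hζ] at h4
    exact lt_irrefl _ h4
  have hpf : p ∈ frontier Ω := by
    rw [hΩ.isOpen.frontier_eq]
    refine ⟨mem_closure_of_tendsto hFf ?_, hpΩ⟩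
    filter_upwards [hFb] with z hz using hf.mem_image hz
  obtain ⟨ε, hε, hloc⟩ := hΩ.exists_corner_of_mem hpf
  -- Finitely many corners lie over p, so the sector of one of them is visited frequently. Small
  -- sectors are pulled back close to its prevertex, which must therefore be ζ.
  have hex : ∃ c ∈ {c ∈ corners Ω | c.1 = p}, ∃ᶠ z in F, f z ∈ sectorSet c ε := by
    by_contra! hcon
    have h1 : ∀ c ∈ {c ∈ corners Ω | c.1 = p}, ∀ᶠ z in F, f z ∉ sectorSet c ε := fun c hc =>
      hcon c hc
    rw [← Filter.eventually_all_finite (hΩ.finite_corners_at p)] at h1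
    obtain ⟨z, hz1, hz2, hz3⟩ := (h1.and (hFb.and (hFf.eventually (Metric.ball_mem_nhds p hε)))).exists
    obtain ⟨c, hc, hcp, hm, -⟩ := hloc (f z) (hf.mem_image hz2) hz3
    exact hz1 c ⟨hc, hcp⟩ hm
  obtain ⟨c, ⟨hc, hcp⟩, hfreq⟩ := hex
  obtain ⟨a, ha⟩ := exists_isPrevertex hΩ hf hc
  refine ⟨c, hc, ?_⟩
  suffices h : a = ζ by rwa [← h]
  by_contra hne
  obtain ⟨U, V, hU, hV, haU, hζV, hUV⟩ := t2_separation hne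
  obtain ⟨δ, hδ, h1⟩ := ha.2.2 U (hU.mem_nhds haU)
  obtain ⟨z, hz1, hz2, hz3, hz4⟩ := (hfreq.and_eventually (hFb.and
    ((hFf.eventually (Metric.ball_mem_nhds p hδ)).and (hFz.eventually (hV.mem_nhds hζV))))).exists
  have h2 := h1 _ (mem_sectorSet_of_dist_lt hz1 (by rw [hcp]; exact hz3))
  rw [hf.inv_apply hz2] at h2
  exact Set.disjoint_left.1 hUV h2 hz4

theorem IsPrevertex.not_tendsto_cobounded {f : ℂ → ℂ} {c : ℂ × ℝ × ℝ} {a : ℂ} (h : IsPrevertex f c a)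
    (hc : 0 < c.2.2) : ¬ Tendsto f (𝓝[Metric.ball 0 1] a) (Bornology.cobounded ℂ) := by
  intro h'
  have := neBot_nhdsWithin_ball h.1
  exact not_tendsto_nhds_of_tendsto_atTop (tendsto_norm_atTop_iff_cobounded.2 h') _
    (h.tendsto_apex hc).norm

/-! ### The function `1 + z f'' / f'` -/

/-- The function `1 + z f''(z) / f'(z)`. -/
noncomputable def curvatureFn (f : ℂ → ℂ) (z : ℂ) : ℂ := 1 + z * (deriv (deriv f) z / deriv f z)

/-- In the coordinate s, the function i(1 + z f''/f') becomes h''/h' for h(s) = f(a e^{is}). This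
makes it accessible to reflection and to the distortion bound. -/
theorem deriv_strip {f : ℂ → ℂ} (hf : DifferentiableOn ℂ f (Metric.ball 0 1))
    (hi : Set.InjOn f (Metric.ball 0 1)) {a : ℂ} (ha : ‖a‖ = 1) {s : ℂ} (hs : 0 < s.im) :
    deriv (fun s => f (a * Complex.exp (Complex.I * s))) s ≠ 0 ∧
    deriv (deriv (fun s => f (a * Complex.exp (Complex.I * s)))) s =
      Complex.I * curvatureFn f (a * Complex.exp (Complex.I * s)) *
        deriv (fun s => f (a * Complex.exp (Complex.I * s))) s := by
  have ha0 : a ≠ 0 := by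
    intro h; rw [h, norm_zero] at ha; norm_num at ha
  have hE : ∀ s : ℂ, HasDerivAt (fun s => a * Complex.exp (Complex.I * s))
      (Complex.I * (a * Complex.exp (Complex.I * s))) s := by
    intro s
    have h1 : HasDerivAt (fun s : ℂ => Complex.I * s) (Complex.I * 1) s := (hasDerivAt_id s).const_mul _
    have h2 := (h1.cexp).const_mul a
    refine h2.congr_deriv ?_
    ring
  have hd1 : ∀ s : ℂ, 0 < s.im → HasDerivAt (fun s => f (a * Complex.exp (Complex.I * s)))
      (deriv f (a * Complex.exp (Complex.I * s)) * (Complex.I * (a * Complex.exp (Complex.I * s)))) s := by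
    intro s hs
    have h1 : HasDerivAt f _ (a * Complex.exp (Complex.I * s)) := (hf.differentiableAt
      (Metric.isOpen_ball.mem_nhds ((mul_exp_I_mul_mem_ball ha).2 hs))).hasDerivAt
    exact h1.comp s (hE s)
  have hne : deriv f (a * Complex.exp (Complex.I * s)) ≠ 0 :=
    deriv_ne_zero_of_injOn Metric.isOpen_ball hf hi ((mul_exp_I_mul_mem_ball ha).2 hs)
  have hev : deriv (fun s => f (a * Complex.exp (Complex.I * s))) =ᶠ[𝓝 s] fun s =>
      deriv f (a * Complex.exp (Complex.I * s)) * (Complex.I * (a * Complex.exp (Complex.I * s))) := by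
    filter_upwards [(isOpen_lt continuous_const Complex.continuous_im).mem_nhds hs] with w hw
    exact (hd1 w hw).deriv
  have hd2 : HasDerivAt (fun s => deriv f (a * Complex.exp (Complex.I * s)) *
      (Complex.I * (a * Complex.exp (Complex.I * s))))
      (deriv (deriv f) (a * Complex.exp (Complex.I * s)) * (Complex.I * (a * Complex.exp (Complex.I * s))) *
        (Complex.I * (a * Complex.exp (Complex.I * s))) +
        deriv f (a * Complex.exp (Complex.I * s)) *
          (Complex.I * (Complex.I * (a * Complex.exp (Complex.I * s))))) s := by
    have h1 : HasDerivAt (deriv f) _ (a * Complex.exp (Complex.I * s)) :=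
      ((hf.deriv Metric.isOpen_ball).differentiableAt
        (Metric.isOpen_ball.mem_nhds ((mul_exp_I_mul_mem_ball ha).2 hs))).hasDerivAt
    exact (h1.comp s (hE s)).mul ((hE s).const_mul Complex.I)
  have hE0 : a * Complex.exp (Complex.I * s) ≠ 0 := mul_ne_zero ha0 (Complex.exp_ne_zero _)
  rw [hev.deriv_eq, hd2.deriv, (hd1 s hs).deriv]
  refine ⟨mul_ne_zero hne (mul_ne_zero Complex.I_ne_zero hE0), ?_⟩
  rw [curvatureFn]
  field_simp
  ring

theorem deriv_im_eq_zero {h : ℂ → ℂ} (hd : DifferentiableAt ℂ h 0)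
    (hr : ∀ᶠ s in 𝓝 (0 : ℂ), s.im = 0 → (h s).im = 0) : (deriv h 0).im = 0 := by
  have hsl := hasDerivAt_iff_tendsto_slope.1 hd.hasDerivAt
  have t1 : Tendsto (fun y : ℝ => (y : ℂ)) (𝓝[>] 0) (𝓝[≠] 0) := by
    rw [tendsto_nhdsWithin_iff]
    constructor
    · have := (Complex.continuous_ofReal.tendsto 0).mono_left (nhdsWithin_le_nhds (s := Set.Ioi (0 : ℝ)))
      simpa using this
    · filter_upwards [self_mem_nhdsWithin] with y hy
      have : (y : ℝ) ≠ 0 := ne_of_gt hy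
      simpa using this
  have h1 := (Complex.continuous_im.tendsto _).comp (hsl.comp t1)
  refine tendsto_nhds_unique (h1.congr' ?_) tendsto_const_nhds
  have h00 := hr.self_of_nhds rfl
  filter_upwards [(t1.mono_right nhdsWithin_le_nhds).eventually hr] with y hy
  simp only [Function.comp_apply, slope_def_field, sub_zero]
  rw [Complex.div_ofReal_im, Complex.sub_im, h00, hy (by simp), sub_zero, zero_div]

/-- At a prevertex, `I * (1 + z f'' / f')` has, in the coordinate `s`, the principal part
`(β / π - 1) / s` and a real constant term. -/
theorem IsPrevertex.tendsto_curvatureFn {f : ℂ → ℂ} (hf : DifferentiableOn ℂ f (Metric.ball 0 1))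
    (hi : Set.InjOn f (Metric.ball 0 1)) {c : ℂ × ℝ × ℝ} {a : ℂ} (h : IsPrevertex f c a)
    (hc : 0 < c.2.2) :
    ∃ α : ℝ, Tendsto (fun s => Complex.I * curvatureFn f (a * Complex.exp (Complex.I * s)) -
      ((c.2.2 / Real.pi - 1 : ℝ) : ℂ) / s) (𝓝[{s | 0 < s.im}] 0) (𝓝 (α : ℂ)) := by
  obtain ⟨ha, ⟨σ, hσa, hσ0, ⟨m, hm, hm'⟩, hσu, hσr, hσf⟩, -⟩ := h
  have hκ : 0 < c.2.2 / Real.pi := div_pos hc Real.pi_pos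
  set κ := c.2.2 / Real.pi with hκd
  set τ := dslope σ 0 with hτ
  have hnb : ∀ᶠ s in 𝓝 (0 : ℂ), AnalyticAt ℂ σ s := hσa.eventually_analyticAt
  have hτa : AnalyticAt ℂ τ 0 := by
    obtain ⟨r, hr, hr'⟩ := Metric.eventually_nhds_iff_ball.1 hnb
    have h1 : DifferentiableOn ℂ σ (Metric.ball 0 r) := fun s hs =>
      (hr' s hs).differentiableAt.differentiableWithinAt
    exact ((Complex.differentiableOn_dslope (Metric.ball_mem_nhds 0 hr)).2 h1).analyticAt
      (Metric.ball_mem_nhds 0 hr)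
  have hτ0 : τ 0 = m := by rw [hτ, dslope_same, hm']
  have hστ : ∀ s, σ s = s * τ s := by
    intro s
    have := sub_smul_dslope σ 0 s
    rw [hσ0, sub_zero, sub_zero, smul_eq_mul] at this
    exact this.symm
  have hτr : ∀ᶠ s in 𝓝 (0 : ℂ), s.im = 0 → (τ s).im = 0 := by
    filter_upwards [hσr] with s hs h0
    by_cases hs0 : s = 0
    · rw [hs0, hτ0, Complex.ofReal_im]
    · have hsr : s = (s.re : ℂ) := Complex.ext (by simp) (by simpa using h0)
      have : τ s = σ s / (s.re : ℂ) := by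
        rw [← hsr, hστ]; field_simp
      rw [this, Complex.div_ofReal_im, hs h0, zero_div]
  have hτ'r := deriv_im_eq_zero hτa.differentiableAt hτr
  have hτd : ∀ᶠ s in 𝓝 (0 : ℂ), AnalyticAt ℂ τ s := hτa.eventually_analyticAt
  have hσ1 : ∀ᶠ s in 𝓝 (0 : ℂ), deriv σ s = τ s + s * deriv τ s := by
    filter_upwards [hτd] with s hs
    have h1 : HasDerivAt (fun s => s * τ s) (1 * τ s + s * deriv τ s) s :=
      (hasDerivAt_id s).mul hs.differentiableAt.hasDerivAt
    have h2 : σ = fun s => s * τ s := funext hστ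
    conv_lhs => rw [h2]
    rw [h1.deriv, one_mul]
  have hσ2 : ∀ᶠ s in 𝓝 (0 : ℂ), deriv (deriv σ) s = 2 * deriv τ s + s * deriv (deriv τ) s := by
    filter_upwards [hτd, hσ1.eventually_nhds] with s hs h1
    have h2 : deriv σ =ᶠ[𝓝 s] fun s => τ s + s * deriv τ s := h1
    have h3 : HasDerivAt (fun s => τ s + s * deriv τ s)
        (deriv τ s + (1 * deriv τ s + s * deriv (deriv τ) s)) s :=
      hs.differentiableAt.hasDerivAt.add ((hasDerivAt_id s).mul hs.deriv.differentiableAt.hasDerivAt)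
    rw [h2.deriv_eq, h3.deriv]
    ring
  have hτne : ∀ᶠ s in 𝓝 (0 : ℂ), τ s ≠ 0 :=
    hτa.continuousAt.eventually_ne (by rw [hτ0]; exact_mod_cast hm.ne')
  have hσne : ∀ᶠ s in 𝓝 (0 : ℂ), deriv σ s ≠ 0 :=
    hσa.deriv.continuousAt.eventually_ne (by rw [hm']; exact_mod_cast hm.ne')
  -- With f = const + C(-iσ)^κ, the function h''/h' equals (κ - 1)σ'/σ + σ''/σ'. Substituting σ = sτ
  -- splits off (κ - 1)/s and leaves E, which is continuous at 0 and real there because τ is real on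
  -- the axis.
  set E : ℂ → ℂ := fun s => ((κ - 1 : ℝ) : ℂ) * (deriv τ s / τ s) +
    (2 * deriv τ s + s * deriv (deriv τ) s) / (τ s + s * deriv τ s) with hE
  have hE0 : E 0 = (((κ + 1) * (deriv τ 0).re / m : ℝ) : ℂ) := by
    have e1 : deriv τ 0 = ((deriv τ 0).re : ℂ) := Complex.ext (by simp) (by simpa using hτ'r)
    have hmc : (m : ℂ) ≠ 0 := by exact_mod_cast hm.ne'
    simp only [hE, zero_mul, add_zero, hτ0]
    rw [e1]
    push_cast
    simp only [Complex.ofReal_re]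
    field_simp
    ring
  have hEc : ContinuousAt E 0 := by
    have c1 := hτa.continuousAt
    have c2 := hτa.deriv.continuousAt
    have c3 := hτa.deriv.deriv.continuousAt
    have n1 : τ 0 ≠ 0 := by rw [hτ0]; exact_mod_cast hm.ne'
    exact (continuousAt_const.mul (c2.div c1 n1)).add
      (((continuousAt_const.mul c2).add (continuousAt_id.mul c3)).div
        (c1.add (continuousAt_id.mul c2)) (by simpa using n1))
  refine ⟨(κ + 1) * (deriv τ 0).re / m, ?_⟩
  rw [← hE0]
  refine (hEc.tendsto.mono_left nhdsWithin_le_nhds).congr' ?_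
  have hup : ∀ᶠ s in 𝓝 (0 : ℂ), 0 < s.im → 0 < (σ s).im := hσu
  filter_upwards [nhdsWithin_le_nhds hσf.eventually_nhds, nhdsWithin_le_nhds hup.eventually_nhds,
    nhdsWithin_le_nhds hσ1, nhdsWithin_le_nhds hσ2, nhdsWithin_le_nhds hτne, nhdsWithin_le_nhds hσne,
    nhdsWithin_le_nhds hnb.eventually_nhds, self_mem_nhdsWithin] with s h1 h2 h3 h4 h5 h6 h7 hs
  have hs' : 0 < s.im := hs
  have hs0 : s ≠ 0 := by rintro rfl; simp at hs'
  set C := Complex.exp (((c.2.1 + c.2.2 / 2 : ℝ) : ℂ) * Complex.I) with hC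
  have hC0 : C ≠ 0 := Complex.exp_ne_zero _
  obtain ⟨hne, hder⟩ := deriv_strip hf hi ha hs'
  set k := fun s => f (a * Complex.exp (Complex.I * s)) with hk
  have hpos : ∀ᶠ w in 𝓝 s, 0 < w.im := (isOpen_lt continuous_const Complex.continuous_im).mem_nhds hs'
  have hk1 : k =ᶠ[𝓝 s] fun w => cornerMap c (σ w) := by
    filter_upwards [h1, hpos] with w hw hw' using hw hw'
  have hk2 : deriv k =ᶠ[𝓝 s] fun w => C * (((κ : ℝ) : ℂ) * (-Complex.I * σ w) ^ (((κ : ℝ) : ℂ) - 1) *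
        -Complex.I) * deriv σ w := by
    filter_upwards [hk1.eventually_nhds, h2, hpos, h7] with w hw hw2 hw3 hw4
    have e1 : k =ᶠ[𝓝 w] fun w => cornerMap c (σ w) := hw
    rw [e1.deriv_eq]
    exact ((hasDerivAt_cornerMap (c := c) (hw2 hw3)).comp w hw4.differentiableAt.hasDerivAt).deriv
  have hσs : 0 < (σ s).im := h2.self_of_nhds hs'
  have hσs0 : σ s ≠ 0 := by intro h; rw [h] at hσs; simp at hσs
  have hslit := neg_I_mul_mem_slitPlane hσs.le hσs0
  have hw0 : -Complex.I * σ s ≠ 0 := mul_ne_zero (by simp) hσs0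
  have hσan : AnalyticAt ℂ σ s := h7.self_of_nhds
  have hd2 : HasDerivAt (fun w => C * (((κ : ℝ) : ℂ) * (-Complex.I * σ w) ^ (((κ : ℝ) : ℂ) - 1) *
        -Complex.I) * deriv σ w)
      (C * (((κ : ℝ) : ℂ) * ((((κ : ℝ) : ℂ) - 1) * (-Complex.I * σ s) ^ (((κ : ℝ) : ℂ) - 1 - 1) *
        (-Complex.I * deriv σ s)) * -Complex.I) * deriv σ s +
        C * (((κ : ℝ) : ℂ) * (-Complex.I * σ s) ^ (((κ : ℝ) : ℂ) - 1) * -Complex.I) *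
          deriv (deriv σ) s) s := by
    have g1 : HasDerivAt (fun w => -Complex.I * σ w) (-Complex.I * deriv σ s) s :=
      hσan.differentiableAt.hasDerivAt.const_mul _
    have g2 := (((g1.cpow_const (c := ((κ : ℝ) : ℂ) - 1) hslit).const_mul ((κ : ℝ) : ℂ)).mul_const
      (-Complex.I)).const_mul C
    exact g2.mul hσan.deriv.differentiableAt.hasDerivAt
  have hcp : (-Complex.I * σ s) ^ (((κ : ℝ) : ℂ) - 1 - 1) =
      (-Complex.I * σ s) ^ (((κ : ℝ) : ℂ) - 1) / (-Complex.I * σ s) := by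
    rw [Complex.cpow_sub _ _ hw0, Complex.cpow_one]
  have hkv2 := hk2.deriv_eq.trans hd2.deriv
  rw [hcp] at hkv2
  set W := (-Complex.I * σ s) ^ (((κ : ℝ) : ℂ) - 1) with hW
  have hkv : deriv k s = C * (((κ : ℝ) : ℂ) * W * -Complex.I) * deriv σ s := hk2.self_of_nhds
  have hmain : Complex.I * curvatureFn f (a * Complex.exp (Complex.I * s)) =
      ((κ : ℂ) - 1) * (deriv σ s / σ s) + deriv (deriv σ) s / deriv σ s := by
    apply mul_right_cancel₀ hne
    rw [← hder, hkv2, hkv]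
    have := Complex.I_ne_zero
    field_simp
    ring
  rw [hmain, h3, h4, hστ s]
  simp only [hE]
  rw [h3] at h6
  push_cast
  set D := τ s + s * deriv τ s with hD
  have hD' : deriv τ s = (D - τ s) / s := by rw [hD]; field_simp; ring
  rw [hD']
  field_simp
  ring


/-! ### Points of the circle at which the map tends to infinity -/

theorem map_strip_real {a : ℂ} (ha : ‖a‖ = 1) (t : ℝ) :
    Filter.map (fun s => a * Complex.exp (Complex.I * s)) (𝓝[{s | 0 < s.im}] (t : ℂ)) =
      𝓝[Metric.ball 0 1] (a * Complex.exp (Complex.I * t)) := by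
  apply le_antisymm (tendsto_strip ha t)
  have ha' : ‖a * Complex.exp (Complex.I * t)‖ = 1 := by
    rw [norm_mul_exp_I_mul ha]; simp
  have h1 : Tendsto (fun s : ℂ => s + t) (𝓝[{s | 0 < s.im}] 0) (𝓝[{s | 0 < s.im}] (t : ℂ)) := by
    rw [tendsto_nhdsWithin_iff]
    constructor
    · have : Continuous fun s : ℂ => s + t := by fun_prop
      have h2 := (this.tendsto 0).mono_left (nhdsWithin_le_nhds (s := {s : ℂ | 0 < s.im}))
      rwa [zero_add] at h2
    · filter_upwards [self_mem_nhdsWithin] with s hs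
      have hs' : 0 < s.im := hs
      change 0 < (s + t).im
      simpa using hs'
  calc 𝓝[Metric.ball 0 1] (a * Complex.exp (Complex.I * t))
      = Filter.map (fun s => a * Complex.exp (Complex.I * t) * Complex.exp (Complex.I * s))
          (𝓝[{s | 0 < s.im}] 0) := (map_strip ha').symm
    _ = Filter.map (fun s => a * Complex.exp (Complex.I * s))
          (Filter.map (fun s : ℂ => s + t) (𝓝[{s | 0 < s.im}] 0)) := by
        rw [Filter.map_map]
        congr 1
        funext s
        simp only [Function.comp_apply, mul_add, Complex.exp_add]
        ring
    _ ≤ _ := Filter.map_mono h1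

/-- The points of the unit circle at which `f` tends to `∞`. -/
def poleSet (f : ℂ → ℂ) : Set ℂ :=
  {ζ | ‖ζ‖ = 1 ∧ Tendsto f (𝓝[Metric.ball 0 1] ζ) (Bornology.cobounded ℂ)}

theorem cornerMap_of_eq_pi {c : ℂ × ℝ × ℝ} (h : c.2.2 = Real.pi) (x : ℂ) :
    cornerMap c x = c.1 + Complex.exp (c.2.1 * Complex.I) * x := by
  rw [cornerMap, h, div_self Real.pi_ne_zero, Complex.ofReal_one, Complex.cpow_one, Complex.ofReal_add,
    add_mul, Complex.exp_add, Complex.ofReal_div, Complex.ofReal_ofNat, Complex.exp_pi_div_two_mul_I]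
  linear_combination (-Complex.exp (c.2.1 * Complex.I) * x) * Complex.I_mul_I

/-- Near a prevertex of a corner with angle `π` the boundary values move along a straight line. -/
theorem IsPrevertex.exists_boundary_param {f : ℂ → ℂ} {c : ℂ × ℝ × ℝ} {a : ℂ} (h : IsPrevertex f c a)
    (hc : c.2.2 = Real.pi) : ∃ ρ d : ℝ → ℝ, ∀ᶠ t in 𝓝 (0 : ℝ), 0 < d t ∧ HasDerivAt ρ (d t) t ∧
      Tendsto f (𝓝[Metric.ball 0 1] (a * Complex.exp (Complex.I * t)))
        (𝓝 (c.1 + Complex.exp (c.2.1 * Complex.I) * ρ t)) := by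
  obtain ⟨ha, ⟨σ, hσa, hσ0, ⟨m, hm, hm'⟩, hσu, hσr, hσf⟩, -⟩ := h
  have hof : Tendsto (fun t : ℝ => (t : ℂ)) (𝓝 0) (𝓝 0) := by
    simpa using Complex.continuous_ofReal.tendsto 0
  have hpos : ∀ᶠ t : ℝ in 𝓝 0, 0 < (deriv σ t).re := by
    have h1 : Tendsto (fun t : ℝ => (deriv σ t).re) (𝓝 0) (𝓝 (deriv σ 0).re) :=
      (Complex.continuous_re.tendsto _).comp (hσa.deriv.continuousAt.tendsto.comp hof)
    rw [hm', Complex.ofReal_re] at h1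
    exact h1.eventually (lt_mem_nhds hm)
  refine ⟨fun t => (σ t).re, fun t => (deriv σ t).re, ?_⟩
  filter_upwards [hpos, hof.eventually hσa.eventually_analyticAt, hof.eventually hσr,
    hof.eventually hσf.eventually_nhds] with t h1 h2 h3 h4
  refine ⟨h1, h2.differentiableAt.hasDerivAt.real_of_complex, ?_⟩
  rw [← map_strip_real ha, tendsto_map'_iff]
  have h5 : ((σ t).re : ℂ) = σ t := Complex.ext (by simp) (by simpa using (h3 (by simp)).symm)
  rw [h5]
  have h6 : ContinuousAt (fun s => c.1 + Complex.exp (c.2.1 * Complex.I) * σ s) t :=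
    continuousAt_const.add (continuousAt_const.mul h2.continuousAt)
  refine (h6.tendsto.mono_left nhdsWithin_le_nhds).congr' ?_
  filter_upwards [nhdsWithin_le_nhds h4, self_mem_nhdsWithin] with s hs hs'
  rw [Function.comp_apply, hs hs', cornerMap_of_eq_pi hc]

/-- Any other point of the circle is a prevertex, near which f is bounded. -/
theorem isClosed_poleSet {f : ℂ → ℂ} {Ω : Set ℂ} (hΩ : IsPolygon Ω) (hf : IsConformalFromDisk f Ω) :
    IsClosed (poleSet f) := by
  rw [← isOpen_compl_iff, isOpen_iff_mem_nhds]
  intro ζ hζ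
  by_cases hn : ‖ζ‖ = 1
  · rcases isPrevertex_or_tendsto_cobounded hΩ hf hn with ⟨c, hc, h⟩ | h
    · have h1 := h.eventually_mem_sectorSet hc.2.1.1 one_pos
      rw [eventually_nhdsWithin_iff] at h1
      filter_upwards [h1.eventually_nhds] with ξ hξ hξK
      have := neBot_nhdsWithin_ball hξK.1
      have h2 := (tendsto_norm_atTop_iff_cobounded.2 hξK.2).eventually_ge_atTop (‖c.1‖ + 1)
      obtain ⟨z, h3, h4⟩ := (h2.and (eventually_nhdsWithin_iff.2 hξ)).exists
      have h5 := dist_lt_of_mem_sectorSet h4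
      have h6 : ‖f z‖ ≤ dist (f z) c.1 + ‖c.1‖ := by
        rw [dist_eq_norm]; exact norm_le_norm_sub_add _ _
      linarith
    · exact absurd ⟨hn, h⟩ hζ
  · have : ∀ᶠ ξ in 𝓝 ζ, ‖ξ‖ ≠ 1 := continuous_norm.continuousAt.eventually_ne hn
    filter_upwards [this] with ξ h1 h2 using h1 h2.1

theorem norm_exp_I_mul_real (t : ℝ) : ‖Complex.exp (Complex.I * t)‖ = 1 := by
  rw [mul_comm]; exact norm_exp_real_mul_I t

theorem eventually_le_norm_near {f : ℂ → ℂ} {ζ : ℂ}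
    (h : Tendsto f (𝓝[Metric.ball 0 1] ζ) (Bornology.cobounded ℂ)) (M : ℝ) :
    ∀ᶠ ξ in 𝓝 ζ, ξ ∈ Metric.ball (0 : ℂ) 1 → M ≤ ‖f ξ‖ :=
  eventually_nhdsWithin_iff.1 ((tendsto_norm_atTop_iff_cobounded.2 h).eventually_ge_atTop M)

/-- If f tended to ∞ on a whole arc, 1/f would continue by 0 across the arc, against the identity
theorem. -/
theorem exists_notMem_poleSet {f : ℂ → ℂ} (hf : DifferentiableOn ℂ f (Metric.ball 0 1)) {α β : ℝ}
    (hαβ : α < β) : ∃ t ∈ Set.Ioo α β, Complex.exp (Complex.I * t) ∉ poleSet f := by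
  by_contra! hcon
  set x₀ := (α + β) / 2 with hx₀
  have hx₀m : x₀ ∈ Set.Ioo α β := ⟨by linarith, by linarith⟩
  set E : ℂ → ℂ := fun s => 1 * Complex.exp (Complex.I * s) with hE
  have hEc : Continuous E := by fun_prop
  have hEd : Differentiable ℂ E := by fun_prop
  have hE1 : ∀ s : ℂ, 0 < s.im → E s ∈ Metric.ball (0 : ℂ) 1 := fun s hs =>
    (mul_exp_I_mul_mem_ball norm_one).2 hs
  have h1 : ∀ᶠ s in 𝓝 (x₀ : ℂ), E s ∈ Metric.ball (0 : ℂ) 1 → 1 ≤ ‖f (E s)‖ := by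
    refine (hEc.tendsto _).eventually (eventually_le_norm_near ?_ 1)
    simp only [hE, one_mul]
    exact (hcon x₀ hx₀m).2
  obtain ⟨r, hr, hr'⟩ := Metric.eventually_nhds_iff_ball.1 h1
  set r' := min r ((β - α) / 2) with hr'd
  have hr'0 : 0 < r' := lt_min hr (by linarith)
  have hbig : ∀ s ∈ Metric.ball (x₀ : ℂ) r' ∩ {s | 0 < s.im}, 1 ≤ ‖f (E s)‖ := fun s hs =>
    hr' s (Metric.ball_subset_ball (min_le_left _ _) hs.1) (hE1 s hs.2)
  obtain ⟨H, hHd, hHu, hHl⟩ := exists_holomorphic_glue (x₀ := x₀) (r := r') (M := 1)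
    (Gp := fun s => (f (E s))⁻¹) (Gm := fun _ => 0)
    (by
      refine DifferentiableOn.inv ?_ fun s hs h0 => ?_
      · exact hf.comp hEd.differentiableOn fun s hs => hE1 s hs.2
      · have := hbig s hs; rw [h0, norm_zero] at this; linarith)
    (differentiableOn_const _)
    (fun s hs => by rw [norm_inv]; exact inv_le_one_of_one_le₀ (hbig s hs))
    (fun s _ => by simp)
    (fun x hx => by
      simp only [sub_zero]
      have hxm : x ∈ Set.Ioo α β := by
        rw [Metric.mem_ball, Complex.dist_eq, ← Complex.ofReal_sub, Complex.norm_real,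
          Real.norm_eq_abs, abs_lt] at hx
        have := min_le_right r ((β - α) / 2)
        constructor <;> linarith
      have h2 := (hcon x hxm).2
      rw [← one_mul (Complex.exp (Complex.I * x)), ← map_strip_real norm_one, tendsto_map'_iff] at h2
      exact tendsto_inv₀_cobounded.comp h2)
  have hx0b : (x₀ : ℂ) ∈ Metric.ball (x₀ : ℂ) r' := Metric.mem_ball_self hr'0
  set p : ℂ := x₀ - (r' / 2 : ℝ) * Complex.I with hp
  have hpb : p ∈ Metric.ball (x₀ : ℂ) r' := by
    rw [Metric.mem_ball, dist_eq_norm, hp, sub_sub_cancel_left, norm_neg, norm_mul, Complex.norm_I,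
      mul_one, Complex.norm_real, Real.norm_eq_abs, abs_of_pos (by linarith)]
    linarith
  have hq : (x₀ + (r' / 2 : ℝ) * Complex.I : ℂ) ∈ Metric.ball (x₀ : ℂ) r' := by
    rw [Metric.mem_ball, dist_eq_norm, add_sub_cancel_left, norm_mul, Complex.norm_I,
      mul_one, Complex.norm_real, Real.norm_eq_abs, abs_of_pos (by linarith)]
    linarith
  have hpi : p.im < 0 := by
    have : p.im = -(r' / 2) := by simp [hp]
    linarith
  have hqi : 0 < (x₀ + (r' / 2 : ℝ) * Complex.I : ℂ).im := by
    simp only [Complex.add_im, Complex.ofReal_im, Complex.mul_im, Complex.I_im, Complex.ofReal_re,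
      Complex.I_re]
    linarith
  have hev : H =ᶠ[𝓝 p] 0 := by
    filter_upwards [Metric.isOpen_ball.mem_nhds hpb,
      (isOpen_lt Complex.continuous_im continuous_const).mem_nhds hpi] with s h1 h2
    exact hHl s h1 h2
  have hz := (hHd.analyticOnNhd Metric.isOpen_ball).eqOn_zero_of_preconnected_of_eventuallyEq_zero
    (convex_ball _ _).isPreconnected hpb hev hq
  rw [hHu _ hq hqi] at hz
  have h3 := hbig _ ⟨hq, hqi⟩
  have h4 : f (E (x₀ + (r' / 2 : ℝ) * Complex.I)) = 0 := by simpa using hz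
  rw [h4, norm_zero] at h3
  linarith

/-- The boundary values along an arc of prevertices of flat corners between two points at which `f`
tends to `∞` run through a full line. -/
theorem exists_line_of_arc {f : ℂ → ℂ} {α β : ℝ} (hαβ : α < β)
    (hα : Complex.exp (Complex.I * α) ∈ poleSet f) (hβ : Complex.exp (Complex.I * β) ∈ poleSet f)
    {S : Set ℂ} (h : ∀ t ∈ Set.Ioo α β, ∃ c : ℂ × ℝ × ℝ, c.2.2 = Real.pi ∧ c.1 ∈ S ∧
      IsPrevertex f c (Complex.exp (Complex.I * t))) :
    ∃ q u : ℂ, u ≠ 0 ∧ ∀ x : ℝ, q + x * u ∈ S := by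
  choose! c hcπ hcS hcp using h
  set b : ℝ → ℂ := fun t => (c t).1 with hb
  set u : ℝ → ℂ := fun t => Complex.exp ((c t).2.1 * Complex.I) with hu
  have hun : ∀ t, ‖u t‖ = 1 := fun t => norm_exp_real_mul_I _
  have hlim : ∀ t ∈ Set.Ioo α β, Tendsto f (𝓝[Metric.ball 0 1] (Complex.exp (Complex.I * t))) (𝓝 (b t)) :=
    fun t ht => (hcp t ht).tendsto_apex (by rw [hcπ t ht]; exact Real.pi_pos)
  have hder : ∀ t ∈ Set.Ioo α β, ∃ d : ℝ → ℝ, ∀ᶠ t' in 𝓝 t, 0 < d t' ∧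
      HasDerivAt b (u t * d t') t' := by
    intro t ht
    obtain ⟨ρ, d, hρ⟩ := (hcp t ht).exists_boundary_param (hcπ t ht)
    have hsub : Tendsto (fun t' : ℝ => t' - t) (𝓝 t) (𝓝 0) := by
      have : Continuous fun t' : ℝ => t' - t := by fun_prop
      simpa using this.tendsto t
    have hρ' := hsub.eventually hρ
    have hbe : ∀ᶠ t' in 𝓝 t, b t' = b t + u t * ρ (t' - t) := by
      filter_upwards [hρ', isOpen_Ioo.mem_nhds ht] with t' h1 ht'
      have h2 := h1.2.2
      have e : Complex.exp (Complex.I * t) * Complex.exp (Complex.I * ((t' - t : ℝ) : ℂ)) =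
          Complex.exp (Complex.I * t') := by
        rw [← Complex.exp_add]; push_cast; ring_nf
      rw [e] at h2
      have := neBot_nhdsWithin_ball (norm_exp_I_mul_real t')
      exact tendsto_nhds_unique (hlim t' ht') h2
    refine ⟨fun t' => d (t' - t), ?_⟩
    filter_upwards [hρ', hbe.eventually_nhds] with t' h1 h2
    refine ⟨h1.1, ?_⟩
    have h3 : HasDerivAt (fun t' => b t + u t * ρ (t' - t)) (u t * d (t' - t)) t' := by
      have h4 : HasDerivAt (fun t' => ρ (t' - t)) (d (t' - t)) t' := h1.2.1.comp_sub_const _ _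
      exact (h4.ofReal_comp.const_mul (u t)).const_add (b t)
    exact h3.congr_of_eventuallyEq h2
  -- Near t the derivative of the boundary curve is a positive multiple of u(t), and at t' also of
  -- u(t'). Unit vectors that agree up to a positive factor are equal.
  have huc : ∀ t ∈ Set.Ioo α β, ∀ᶠ t' in 𝓝 t, u t' = u t := by
    intro t ht
    obtain ⟨d, hd⟩ := hder t ht
    filter_upwards [hd, isOpen_Ioo.mem_nhds ht] with t' h1 ht'
    obtain ⟨d', hd'⟩ := hder t' ht'
    obtain ⟨h2, h3⟩ := hd'.self_of_nhds
    have e := h3.unique h1.2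
    have hn : d' t' = d t' := by
      have := congrArg norm e
      rwa [norm_mul, norm_mul, hun, hun, one_mul, one_mul, Complex.norm_real, Complex.norm_real,
        Real.norm_of_nonneg h2.le, Real.norm_of_nonneg h1.1.le] at this
    rw [hn] at e
    exact mul_right_cancel₀ (by exact_mod_cast h1.1.ne') e
  set t₀ := (α + β) / 2 with ht₀
  have ht₀m : t₀ ∈ Set.Ioo α β := ⟨by linarith, by linarith⟩
  have hue : ∀ t ∈ Set.Ioo α β, u t = u t₀ := by
    intro t ht
    have h1 : ∀ t ∈ Set.Ioo α β, HasDerivAt u 0 t := fun t ht =>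
      (hasDerivAt_const t (u t)).congr_of_eventuallyEq (huc t ht)
    exact isOpen_Ioo.is_const_of_deriv_eq_zero isPreconnected_Ioo
      (fun t ht => (h1 t ht).differentiableAt.differentiableWithinAt) (fun t ht => (h1 t ht).deriv) ht ht₀m
  set U := u t₀ with hU
  have hUU : U * (starRingEnd ℂ) U = 1 := by
    rw [Complex.mul_conj, Complex.normSq_eq_norm_sq, hun]; simp
  set G : ℝ → ℂ := fun t => (b t - b t₀) * (starRingEnd ℂ) U with hG
  have hGd : ∀ t ∈ Set.Ioo α β, ∃ d : ℝ, 0 < d ∧ HasDerivAt G (d : ℂ) t := by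
    intro t ht
    obtain ⟨d, hd⟩ := hder t ht
    obtain ⟨h1, h2⟩ := hd.self_of_nhds
    refine ⟨d t, h1, ?_⟩
    have h3 := (h2.sub_const (b t₀)).mul_const ((starRingEnd ℂ) U)
    refine h3.congr_deriv ?_
    rw [hue t ht]
    linear_combination (d t : ℂ) * hUU
  set X : ℝ → ℝ := fun t => (G t).re with hX
  have hXd : ∀ t ∈ Set.Ioo α β, ∃ d : ℝ, 0 < d ∧ HasDerivAt X d t := by
    intro t ht
    obtain ⟨d, h1, h2⟩ := hGd t ht
    refine ⟨d, h1, ?_⟩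
    exact Complex.reCLM.hasFDerivAt.comp_hasDerivAt t h2
  have hYd : ∀ t ∈ Set.Ioo α β, HasDerivAt (fun t => (G t).im) 0 t := by
    intro t ht
    obtain ⟨d, h1, h2⟩ := hGd t ht
    exact Complex.imCLM.hasFDerivAt.comp_hasDerivAt t h2
  have hG0 : G t₀ = 0 := by simp [hG]
  have hY : ∀ t ∈ Set.Ioo α β, (G t).im = 0 := by
    intro t ht
    have := isOpen_Ioo.is_const_of_deriv_eq_zero isPreconnected_Ioo
      (fun t ht => (hYd t ht).differentiableAt.differentiableWithinAt) (fun t ht => (hYd t ht).deriv) ht ht₀m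
    rw [this, hG0, Complex.zero_im]
  have hbX : ∀ t ∈ Set.Ioo α β, b t = b t₀ + X t * U := by
    intro t ht
    have h1 : G t = (X t : ℂ) := Complex.ext (by simp [hX]) (by simpa using hY t ht)
    rw [← h1]
    simp only [hG]
    linear_combination (-(b t - b t₀)) * hUU
  have hXc : ContinuousOn X (Set.Ioo α β) := fun t ht => by
    obtain ⟨d, -, hd⟩ := hXd t ht
    exact hd.continuousAt.continuousWithinAt
  have hXm : StrictMonoOn X (Set.Ioo α β) := by
    refine strictMonoOn_of_deriv_pos (convex_Ioo _ _) hXc ?_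
    rw [interior_Ioo]
    intro t ht
    obtain ⟨d, h1, hd⟩ := hXd t ht
    rwa [hd.deriv]
  have hX0 : X t₀ = 0 := by simp [hX, hG0]
  -- Boundary values near a pole are large because f is. So the increasing coordinate X is unbounded
  -- at both ends of the arc and takes every real value.
  have hlarge : ∀ γ : ℝ, Complex.exp (Complex.I * γ) ∈ poleSet f → ∀ M : ℝ,
      ∀ᶠ t : ℝ in 𝓝 γ, t ∈ Set.Ioo α β → M ≤ |X t| := by
    intro γ hγ M
    have h1 := (eventually_le_norm_near hγ.2 (M + ‖b t₀‖)).eventually_nhds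
    have h2 : Tendsto (fun t : ℝ => Complex.exp (Complex.I * t)) (𝓝 γ) (𝓝 (Complex.exp (Complex.I * γ))) := by
      have : Continuous fun t : ℝ => Complex.exp (Complex.I * t) := by fun_prop
      exact this.tendsto γ
    filter_upwards [h2.eventually h1] with t h3 ht
    have := neBot_nhdsWithin_ball (norm_exp_I_mul_real t)
    have h4 : M + ‖b t₀‖ ≤ ‖b t‖ :=
      ge_of_tendsto (hlim t ht).norm (eventually_nhdsWithin_iff.2 h3)
    rw [hbX t ht] at h4
    have h5 := norm_add_le (b t₀) (X t * U)
    rw [norm_mul, hun, mul_one, Complex.norm_real, Real.norm_eq_abs] at h5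
    linarith
  refine ⟨b t₀, U, fun h => by have := hun t₀; rw [← hU, h, norm_zero] at this; norm_num at this, fun x => ?_⟩
  have hlo : ∃ t ∈ Set.Ioo α t₀, |x| + 1 ≤ |X t| := by
    obtain ⟨t, h1, h2⟩ := (((hlarge α hα (|x| + 1)).filter_mono
      (nhdsWithin_le_nhds (s := Set.Ioi α))).and (Ioo_mem_nhdsGT ht₀m.1)).exists
    exact ⟨t, h2, h1 ⟨h2.1, h2.2.trans ht₀m.2⟩⟩
  have hhi : ∃ t ∈ Set.Ioo t₀ β, |x| + 1 ≤ |X t| := by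
    obtain ⟨t, h1, h2⟩ := (((hlarge β hβ (|x| + 1)).filter_mono
      (nhdsWithin_le_nhds (s := Set.Iio β))).and (Ioo_mem_nhdsLT ht₀m.2)).exists
    exact ⟨t, h2, h1 ⟨ht₀m.1.trans h2.1, h2.2⟩⟩
  obtain ⟨t₁, ht₁, hx₁⟩ := hlo
  obtain ⟨t₂, ht₂, hx₂⟩ := hhi
  have ht₁m : t₁ ∈ Set.Ioo α β := ⟨ht₁.1, ht₁.2.trans ht₀m.2⟩
  have ht₂m : t₂ ∈ Set.Ioo α β := ⟨ht₀m.1.trans ht₂.1, ht₂.2⟩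
  have n1 : X t₁ < 0 := hX0 ▸ hXm ht₁m ht₀m ht₁.2
  have n2 : 0 < X t₂ := hX0 ▸ hXm ht₀m ht₂m ht₂.1
  rw [abs_of_neg n1] at hx₁
  rw [abs_of_pos n2] at hx₂
  have hsub : Set.Icc t₁ t₂ ⊆ Set.Ioo α β := fun t ht => ⟨ht₁.1.trans_le ht.1, ht.2.trans_lt ht₂.2⟩
  obtain ⟨t, ht, hxt⟩ := intermediate_value_Icc (ht₁.2.trans ht₂.1).le (hXc.mono hsub)
    (show x ∈ Set.Icc (X t₁) (X t₂) from
      ⟨by linarith [neg_abs_le x], by linarith [le_abs_self x]⟩)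
  rw [← hxt, ← hbX t (hsub ht)]
  exact hcS t (hsub ht)

/-- The finitely many prevertices of corners over a finite set. -/
theorem finite_prevertices {f : ℂ → ℂ} {Ω : Set ℂ} (hΩ : IsPolygon Ω) {E : Set ℂ} (hE : E.Finite) :
    {ζ | ∃ c ∈ corners Ω, c.1 ∈ E ∧ IsPrevertex f c ζ}.Finite := by
  have h1 : (⋃ p ∈ E, {c ∈ corners Ω | c.1 = p}).Finite := hE.biUnion fun p _ => hΩ.finite_corners_at p
  have h2 : (⋃ c ∈ (⋃ p ∈ E, {c ∈ corners Ω | c.1 = p}), {ζ | IsPrevertex f c ζ}).Finite := by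
    refine h1.biUnion fun c hc => Set.Subsingleton.finite ?_
    simp only [Set.mem_iUnion] at hc
    obtain ⟨p, -, hc, -⟩ := hc
    exact fun a ha a' ha' => ha.unique hc ha'
  refine h2.subset ?_
  rintro ζ ⟨c, hc, hcE, h⟩
  simp only [Set.mem_iUnion]
  exact ⟨c, ⟨c.1, hcE, hc, rfl⟩, h⟩

theorem exists_real_log {ζ : ℂ} (h : ‖ζ‖ = 1) : ∃ t : ℝ, Complex.exp (Complex.I * t) = ζ :=
  ⟨ζ.arg, by
    have := Complex.norm_mul_exp_arg_mul_I ζ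
    rwa [h, Complex.ofReal_one, one_mul, mul_comm] at this⟩

/-- Near an accumulation point there is an arc between two poles that carries only flat corners with
apex off the exceptional set E. Its boundary values fill a line in the frontier that avoids E, which
the choice of E excludes. -/
theorem finite_poleSet {f : ℂ → ℂ} {Ω : Set ℂ} (hΩ : IsPolygon Ω) (hf : IsConformalFromDisk f Ω) :
    (poleSet f).Finite := by
  by_contra hinf
  obtain ⟨E, hEf, hE1, hE2⟩ := hΩ.exists_exceptional_set
  obtain ⟨x, hx, hacc⟩ := (show (poleSet f).Infinite from hinf).exists_accPt_of_subset_isCompact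
    (isCompact_sphere (0 : ℂ) 1) (fun ζ hζ => by rw [mem_sphere_zero_iff_norm]; exact hζ.1)
  have hxK : x ∈ poleSet f := (isClosed_poleSet hΩ hf).closure_eq ▸ mem_closure_iff_clusterPt.2 hacc.clusterPt
  set N := {ζ | ∃ c ∈ corners Ω, c.1 ∈ E ∧ IsPrevertex f c ζ} with hN
  have hNf : N.Finite := finite_prevertices hΩ hEf
  have hxN : x ∉ N := by
    rintro ⟨c, hc, -, h⟩
    exact h.not_tendsto_cobounded hc.2.1.1 hxK.2
  obtain ⟨t₀, ht₀⟩ := exists_real_log hxK.1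
  have hcont : Continuous fun t : ℝ => Complex.exp (Complex.I * t) := by fun_prop
  have hNt : ∀ᶠ t : ℝ in 𝓝 t₀, Complex.exp (Complex.I * t) ∉ N :=
    (hcont.tendsto t₀).eventually (by rw [ht₀]; exact hNf.isClosed.isOpen_compl.mem_nhds hxN)
  obtain ⟨δ, hδ, hδN⟩ := Metric.eventually_nhds_iff_ball.1 hNt
  have hx0 : x ≠ 0 := by
    intro h; have := hxK.1; rw [h, norm_zero] at this; norm_num at this
  obtain ⟨t₁, ht₁, hne, ht₁K⟩ : ∃ t₁ ∈ Metric.ball t₀ δ, t₁ ≠ t₀ ∧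
      Complex.exp (Complex.I * t₁) ∈ poleSet f := by
    have hL : Tendsto (fun ζ : ℂ => Complex.arg (ζ / x)) (𝓝 x) (𝓝 0) := by
      have h1 : ContinuousAt (fun ζ : ℂ => Complex.arg (ζ / x)) x := by
        refine ContinuousAt.comp (g := Complex.arg) ?_ (continuousAt_id.div_const x)
        simp only [div_self hx0]
        exact Complex.continuousAt_arg Complex.one_mem_slitPlane
      have := h1.tendsto
      rwa [div_self hx0, Complex.arg_one] at this
    obtain ⟨ζ, ⟨h1, h2⟩, h3⟩ := ((accPt_iff_frequently.1 hacc).and_eventually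
      (hL.eventually (Metric.ball_mem_nhds 0 hδ))).exists
    have e : Complex.exp (Complex.I * ((t₀ + (ζ / x).arg : ℝ) : ℂ)) = ζ := by
      have h4 : ‖ζ / x‖ = 1 := by rw [norm_div, h2.1, hxK.1, div_one]
      have h5 := Complex.norm_mul_exp_arg_mul_I (ζ / x)
      rw [h4, Complex.ofReal_one, one_mul] at h5
      rw [Complex.ofReal_add, mul_add, Complex.exp_add, ht₀, mul_comm Complex.I, h5,
        mul_div_cancel₀ _ hx0]
    refine ⟨t₀ + (ζ / x).arg, ?_, ?_, by rw [e]; exact h2⟩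
    · rw [dist_eq_norm, sub_zero] at h3
      rw [Metric.mem_ball, dist_eq_norm, add_sub_cancel_left]
      exact h3
    · intro h4
      rw [h4, ht₀] at e
      exact h1 e.symm
  obtain ⟨α₀, β₀, hlt, hsub, hα₀, hβ₀⟩ : ∃ α₀ β₀ : ℝ, α₀ < β₀ ∧ Set.Icc α₀ β₀ ⊆ Metric.ball t₀ δ ∧
      Complex.exp (Complex.I * α₀) ∈ poleSet f ∧ Complex.exp (Complex.I * β₀) ∈ poleSet f := by
    have hc : (Metric.ball t₀ δ).OrdConnected := by rw [Real.ball_eq_Ioo]; infer_instance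
    have h0 := Metric.mem_ball_self (x := t₀) hδ
    have h0K : Complex.exp (Complex.I * t₀) ∈ poleSet f := by rw [ht₀]; exact hxK
    rcases hne.lt_or_gt with h | h
    · exact ⟨t₁, t₀, h, hc.out ht₁ h0, ht₁K, h0K⟩
    · exact ⟨t₀, t₁, h, hc.out h0 ht₁, h0K, ht₁K⟩
  obtain ⟨t₃, ht₃, ht₃K⟩ := exists_notMem_poleSet hf.differentiableOn hlt
  set A : Set ℝ := {t | Complex.exp (Complex.I * t) ∈ poleSet f} with hA
  have hAc : IsClosed A := (isClosed_poleSet hΩ hf).preimage hcont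
  -- The pole-free arc around t₃ ends at the last pole before it and the first pole after it.
  obtain ⟨α, ⟨hαA, hα1, hα2⟩, hαm⟩ := (isCompact_Icc (a := α₀) (b := t₃)).inter_left hAc
    |>.exists_isGreatest ⟨α₀, hα₀, le_rfl, ht₃.1.le⟩
  obtain ⟨β, ⟨hβA, hβ1, hβ2⟩, hβm⟩ := (isCompact_Icc (a := t₃) (b := β₀)).inter_left hAc
    |>.exists_isLeast ⟨β₀, hβ₀, ht₃.2.le, le_rfl⟩
  have hα3 : α < t₃ := lt_of_le_of_ne hα2 fun h => ht₃K (h ▸ hαA)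
  have hβ3 : t₃ < β := lt_of_le_of_ne hβ1 fun h => ht₃K (h ▸ hβA)
  have hgap : ∀ t ∈ Set.Ioo α β, t ∉ A := by
    intro t ht htA
    rcases le_total t t₃ with h | h
    · exact absurd (hαm ⟨htA, hα1.trans ht.1.le, h⟩) (not_le.2 ht.1)
    · exact absurd (hβm ⟨htA, h, ht.2.le.trans hβ2⟩) (not_le.2 ht.2)
  obtain ⟨q, u, hu, hline⟩ := exists_line_of_arc (S := frontier Ω \ E) (hα3.trans hβ3) hαA hβA (by
    intro t ht
    have htb : t ∈ Metric.ball t₀ δ := hsub ⟨hα1.trans ht.1.le, ht.2.le.trans hβ2⟩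
    rcases isPrevertex_or_tendsto_cobounded hΩ hf (norm_exp_I_mul_real t) with ⟨c, hc, h⟩ | h
    · have hcE : c.1 ∉ E := fun h' => hδN t htb ⟨c, hc, h', h⟩
      refine ⟨c, ?_, ⟨hΩ.apex_mem_frontier hc, hcE⟩, h⟩
      by_contra hπ
      exact hcE (hE1 c hc hπ)
    · exact absurd ⟨norm_exp_I_mul_real t, h⟩ (hgap t ht))
  obtain ⟨y, hy⟩ := hE2 q u hu fun y => (hline y).1
  exact (hline y).2 hy


/-! ### Local behaviour at the points of the circle -/

/-- In the coordinate `s`, `z = a * exp (I * s)`, the function `I * (1 + z f'' / f')` has principal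
part `γ / s` at `a`, and a real constant term. -/
def HasAngleIndex (f : ℂ → ℂ) (a : ℂ) (γ : ℝ) : Prop :=
  ∃ α : ℝ, Tendsto (fun s => Complex.I * curvatureFn f (a * Complex.exp (Complex.I * s)) - (γ : ℂ) / s)
    (𝓝[{s | 0 < s.im}] 0) (𝓝 (α : ℂ))

theorem isOpen_upper : IsOpen {s : ℂ | 0 < s.im} := isOpen_lt continuous_const Complex.continuous_im

/-- A holomorphic function on a half disk with real boundary values off the center extends by
reflection. -/
theorem exists_reflection_of_real_limits {G : ℂ → ℂ} {r : ℝ}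
    (hG : DifferentiableOn ℂ G (Metric.ball 0 r ∩ {s | 0 < s.im}))
    (hl : ∀ t : ℝ, t ≠ 0 → |t| < r → ∃ α : ℝ, Tendsto G (𝓝[{s | 0 < s.im}] (t : ℂ)) (𝓝 (α : ℂ))) :
    ∃ F : ℂ → ℂ, DifferentiableOn ℂ F (Metric.ball 0 r \ {0}) ∧
      (∀ s, 0 < s.im → F s = G s) ∧ (∀ s, s.im < 0 → F s = (starRingEnd ℂ) (G ((starRingEnd ℂ) s))) ∧
      ∀ t : ℝ, t ≠ 0 → |t| < r → (F t).im = 0 := by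
  classical
  set F : ℂ → ℂ := fun s => if 0 < s.im then G s else if s.im < 0 then
    (starRingEnd ℂ) (G ((starRingEnd ℂ) s)) else limUnder (𝓝[{w | 0 < w.im}] s) G with hF
  have hFu : ∀ s, 0 < s.im → F s = G s := fun s hs => by simp only [hF, if_pos hs]
  have hFl : ∀ s, s.im < 0 → F s = (starRingEnd ℂ) (G ((starRingEnd ℂ) s)) := fun s hs => by
    simp only [hF, if_neg hs.le.not_gt, if_pos hs]
  have hFr : ∀ t : ℝ, F t = limUnder (𝓝[{w | 0 < w.im}] (t : ℂ)) G := fun t => by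
    simp [hF]
  refine ⟨F, ?_, hFu, hFl, fun t ht htr => ?_⟩
  · rintro s ⟨hs, hs0⟩
    apply DifferentiableAt.differentiableWithinAt
    rcases lt_trichotomy s.im 0 with h | h | h
    · have hsc : (starRingEnd ℂ) s ∈ Metric.ball 0 r ∩ {s | 0 < s.im} := by
        refine ⟨?_, ?_⟩
        · rw [mem_ball_zero_iff, RCLike.norm_conj]; exact mem_ball_zero_iff.1 hs
        · change 0 < ((starRingEnd ℂ) s).im
          rw [Complex.conj_im]; linarith
      have h1 : DifferentiableAt ℂ G ((starRingEnd ℂ) s) :=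
        hG.differentiableAt ((isOpen_upper_ball 0 r).mem_nhds hsc)
      have h2 := h1.conj_conj
      rw [Complex.conj_conj] at h2
      refine h2.congr_of_eventuallyEq ?_
      filter_upwards [(isOpen_lt Complex.continuous_im continuous_const).mem_nhds h] with w hw
      exact hFl w hw
    · obtain ⟨t, rfl⟩ : ∃ t : ℝ, s = t := ⟨s.re, Complex.ext (by simp) (by simpa using h)⟩
      have ht0 : t ≠ 0 := fun h => hs0 (by simp [h])
      have htr : |t| < r := by simpa using hs
      obtain ⟨α, hα⟩ := hl t ht0 htr
      have hb : ∀ᶠ s in 𝓝 (t : ℂ), 0 < s.im → ‖G s‖ < ‖(α : ℂ)‖ + 1 :=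
        eventually_nhdsWithin_iff.1 (hα.norm.eventually (gt_mem_nhds (by linarith)))
      obtain ⟨δ, hδ, hb'⟩ := Metric.eventually_nhds_iff_ball.1 hb
      set ρ := min δ (min (r - |t|) |t|) with hρ
      have hρ0 : 0 < ρ := lt_min hδ (lt_min (by linarith) (abs_pos.2 ht0))
      have hρδ : ρ ≤ δ := min_le_left _ _
      have hρr : ρ ≤ r - |t| := (min_le_right _ _).trans (min_le_left _ _)
      have hρt : ρ ≤ |t| := (min_le_right _ _).trans (min_le_right _ _)
      have hsubr : Metric.ball (t : ℂ) ρ ⊆ Metric.ball 0 r := by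
        intro w hw
        rw [Metric.mem_ball, dist_eq_norm] at hw
        rw [mem_ball_zero_iff]
        have h1 := norm_add_le (w - t) (t : ℂ)
        rw [sub_add_cancel, Complex.norm_real, Real.norm_eq_abs] at h1
        linarith
      have hconj : ∀ w ∈ Metric.ball (t : ℂ) ρ, (starRingEnd ℂ) w ∈ Metric.ball (t : ℂ) ρ := by
        intro w hw
        rw [Metric.mem_ball, dist_eq_norm] at hw ⊢
        rwa [← Complex.conj_ofReal t, ← map_sub, RCLike.norm_conj]
      have hlow : ∀ w, w ∈ Metric.ball (t : ℂ) ρ ∩ {s | s.im < 0} →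
          (starRingEnd ℂ) w ∈ Metric.ball (t : ℂ) ρ ∩ {s | 0 < s.im} := by
        rintro w ⟨hw, hw'⟩
        refine ⟨hconj w hw, ?_⟩
        have hw2 : w.im < 0 := hw'
        change 0 < ((starRingEnd ℂ) w).im
        rw [Complex.conj_im]; linarith
      -- The two sides differ at conjugate points by G - conj G, which tends to 0 because the limits
      -- are real. The radius ρ stays below the distance to 0, which is excluded.
      obtain ⟨H, hHd, hHu, hHl⟩ := exists_holomorphic_glue (x₀ := t) (r := ρ) (M := ‖(α : ℂ)‖ + 1)
        (Gp := G) (Gm := fun s => (starRingEnd ℂ) (G ((starRingEnd ℂ) s)))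
        (hG.mono fun w hw => ⟨hsubr hw.1, hw.2⟩)
        (fun w hw => by
          have h1 := hlow w hw
          have h2 : DifferentiableAt ℂ G ((starRingEnd ℂ) w) :=
            hG.differentiableAt ((isOpen_upper_ball 0 r).mem_nhds ⟨hsubr h1.1, h1.2⟩)
          have h3 := h2.conj_conj
          rw [Complex.conj_conj] at h3
          exact h3.differentiableWithinAt)
        (fun w hw => (hb' w (Metric.ball_subset_ball hρδ hw.1) hw.2).le)
        (fun w hw => by
          have h1 := hlow w hw
          rw [RCLike.norm_conj]
          exact (hb' _ (Metric.ball_subset_ball hρδ h1.1) h1.2).le)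
        (fun x hx => by
          have hxr : |x| < r := by simpa using hsubr hx
          have hx0 : x ≠ 0 := by
            rintro rfl
            rw [Metric.mem_ball, dist_eq_norm, Complex.ofReal_zero, zero_sub, norm_neg,
              Complex.norm_real, Real.norm_eq_abs] at hx
            linarith
          obtain ⟨α', hα'⟩ := hl x hx0 hxr
          have h1 := hα'.sub ((Complex.continuous_conj.tendsto _).comp hα')
          rw [Complex.conj_ofReal, sub_self] at h1
          refine h1.congr fun s => ?_
          simp only [Function.comp_apply, Complex.conj_conj])
      have hdiff : DifferentiableAt ℂ H t :=
        hHd.differentiableAt (Metric.isOpen_ball.mem_nhds (Metric.mem_ball_self hρ0))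
      refine hdiff.congr_of_eventuallyEq ?_
      filter_upwards [Metric.ball_mem_nhds (t : ℂ) hρ0] with w hw
      rcases lt_trichotomy w.im 0 with h1 | h1 | h1
      · rw [hFl w h1, hHl w hw h1]
      · obtain ⟨x, rfl⟩ : ∃ x : ℝ, w = x := ⟨w.re, Complex.ext (by simp) (by simpa using h1)⟩
        rw [hFr]
        apply Tendsto.limUnder_eq
        have h2 : Tendsto H (𝓝[{w | 0 < w.im}] (x : ℂ)) (𝓝 (H x)) :=
          ((hHd.continuousOn.continuousAt (Metric.isOpen_ball.mem_nhds hw)).tendsto).mono_left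
            nhdsWithin_le_nhds
        refine h2.congr' ?_
        filter_upwards [nhdsWithin_le_nhds (Metric.isOpen_ball.mem_nhds hw), self_mem_nhdsWithin]
          with v hv hv' using hHu v hv hv'
      · rw [hFu w h1, hHu w hw h1]
    · refine (hG.differentiableAt ((isOpen_upper_ball 0 r).mem_nhds ⟨hs, h⟩)).congr_of_eventuallyEq ?_
      filter_upwards [isOpen_upper.mem_nhds h] with w hw using hFu w hw
  · obtain ⟨α, hα⟩ := hl t ht htr
    rw [hFr, hα.limUnder_eq, Complex.ofReal_im]

theorem differentiableOn_curvatureFn {f : ℂ → ℂ} (hf : DifferentiableOn ℂ f (Metric.ball 0 1))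
    (hi : Set.InjOn f (Metric.ball 0 1)) : DifferentiableOn ℂ (curvatureFn f) (Metric.ball 0 1) := by
  have h1 := hf.deriv Metric.isOpen_ball
  have h2 := h1.deriv Metric.isOpen_ball
  exact (differentiableOn_const _).add (differentiableOn_id.mul (h2.div h1 fun z hz =>
    deriv_ne_zero_of_injOn Metric.isOpen_ball hf hi hz))

/-- The distortion bound is applied to f(a e^{is}) on the disk about s of radius Im s. That disk has
diameter at most 2 < 2π, so the exponential is injective on it. -/
theorem norm_curvatureFn_le {f : ℂ → ℂ} (hf : DifferentiableOn ℂ f (Metric.ball 0 1))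
    (hi : Set.InjOn f (Metric.ball 0 1)) {a : ℂ} (ha : ‖a‖ = 1) {s : ℂ} (hs : 0 < s.im) (hs1 : s.im ≤ 1) :
    ‖Complex.I * curvatureFn f (a * Complex.exp (Complex.I * s))‖ ≤ 8 * (128 * Real.pi) ^ 2 / s.im := by
  have ha0 : a ≠ 0 := by
    intro h; rw [h, norm_zero] at ha; norm_num at ha
  have hpos : ∀ w ∈ Metric.ball s s.im, 0 < w.im := by
    intro w hw
    rw [Metric.mem_ball, dist_eq_norm] at hw
    have h1 := Complex.abs_im_le_norm (w - s)
    rw [Complex.sub_im] at h1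
    have := neg_abs_le (w.im - s.im)
    linarith
  have hd : DifferentiableOn ℂ (fun s => f (a * Complex.exp (Complex.I * s))) (Metric.ball s s.im) := by
    refine hf.comp (g := f) (f := fun s => a * Complex.exp (Complex.I * s)) ?_ fun w hw =>
      (mul_exp_I_mul_mem_ball ha).2 (hpos w hw)
    have : Differentiable ℂ fun s => a * Complex.exp (Complex.I * s) := by fun_prop
    exact this.differentiableOn
  have hinj : Set.InjOn (fun s => f (a * Complex.exp (Complex.I * s))) (Metric.ball s s.im) := by
    intro w hw v hv hwv
    have h1 := hi ((mul_exp_I_mul_mem_ball ha).2 (hpos w hw)) ((mul_exp_I_mul_mem_ball ha).2 (hpos v hv)) hwv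
    obtain ⟨n, hn⟩ := Complex.exp_eq_exp_iff_exists_int.1 (mul_left_cancel₀ ha0 h1)
    have h2 : w = v + n * (2 * Real.pi) := by
      apply mul_left_cancel₀ Complex.I_ne_zero
      rw [hn]; ring
    have h3 : dist w v < 2 := by
      have := dist_triangle_right w v s
      rw [Metric.mem_ball] at hw hv
      linarith
    rw [dist_eq_norm, h2, add_sub_cancel_left, norm_mul, Complex.norm_intCast] at h3
    have h4 : ‖(2 * Real.pi : ℂ)‖ = 2 * Real.pi := by
      rw [norm_mul, Complex.norm_real, Real.norm_of_nonneg Real.pi_pos.le]; simp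
    rw [h4] at h3
    have hn0 : n = 0 := by
      by_contra hne
      have h5 : (1 : ℝ) ≤ |(n : ℝ)| := by exact_mod_cast Int.one_le_abs hne
      have := Real.pi_gt_three
      nlinarith
    rw [h2, hn0]; simp
  have key := norm_deriv_deriv_div_deriv_le hs hd hinj
  obtain ⟨h1, h2⟩ := deriv_strip hf hi ha hs
  rwa [h2, mul_div_cancel_right₀ _ h1] at key

theorem im_eq_zero_of_eventually {φ : ℂ → ℂ} (hφ : ContinuousAt φ 0)
    (hr : ∀ᶠ s in 𝓝[≠] (0 : ℂ), s.im = 0 → (φ s).im = 0) : (φ 0).im = 0 := by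
  have t1 : Tendsto (fun y : ℝ => (y : ℂ)) (𝓝[>] 0) (𝓝[≠] 0) := by
    rw [tendsto_nhdsWithin_iff]
    constructor
    · have := (Complex.continuous_ofReal.tendsto 0).mono_left (nhdsWithin_le_nhds (s := Set.Ioi (0 : ℝ)))
      simpa using this
    · filter_upwards [self_mem_nhdsWithin] with y hy
      have : (y : ℝ) ≠ 0 := ne_of_gt hy
      simpa using this
  have h1 := (Complex.continuous_im.tendsto _).comp (hφ.tendsto.comp (t1.mono_right nhdsWithin_le_nhds))
  refine tendsto_nhds_unique (h1.congr' ?_) tendsto_const_nhds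
  filter_upwards [t1.eventually hr] with y hy
  exact hy (by simp)

/-- An isolated point of the circle around which the index vanishes has an index. -/
theorem exists_hasAngleIndex {f : ℂ → ℂ} (hf : DifferentiableOn ℂ f (Metric.ball 0 1))
    (hi : Set.InjOn f (Metric.ball 0 1)) {a : ℂ} (ha : ‖a‖ = 1) {r : ℝ} (hr : 0 < r)
    (h : ∀ t : ℝ, t ≠ 0 → |t| < r → HasAngleIndex f (a * Complex.exp (Complex.I * t)) 0) :
    ∃ γ : ℝ, HasAngleIndex f a γ := by
  set r' := min r 1 with hr'
  have hr'0 : 0 < r' := lt_min hr one_pos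
  set G : ℂ → ℂ := fun s => Complex.I * curvatureFn f (a * Complex.exp (Complex.I * s)) with hG
  have hGd : DifferentiableOn ℂ G {s | 0 < s.im} := by
    refine (differentiableOn_const _).mul ?_
    refine (differentiableOn_curvatureFn hf hi).comp (f := fun s => a * Complex.exp (Complex.I * s)) ?_
      fun s hs => (mul_exp_I_mul_mem_ball ha).2 hs
    have : Differentiable ℂ fun s => a * Complex.exp (Complex.I * s) := by fun_prop
    exact this.differentiableOn
  obtain ⟨F, hFd, hFu, hFl, hFr⟩ := exists_reflection_of_real_limits (G := G) (r := r')
    (hGd.mono Set.inter_subset_right) (by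
      intro t ht htr
      obtain ⟨α, hα⟩ := h t ht (htr.trans_le (min_le_left _ _))
      refine ⟨α, ?_⟩
      have hat : ‖a * Complex.exp (Complex.I * t)‖ = 1 := by rw [norm_mul_exp_I_mul ha]; simp
      have h1 : Tendsto (fun z => Complex.I * curvatureFn f z)
          (𝓝[Metric.ball 0 1] (a * Complex.exp (Complex.I * t))) (𝓝 (α : ℂ)) := by
        rw [← map_strip hat, tendsto_map'_iff]
        refine hα.congr fun s => ?_
        simp
      rw [← map_strip_real ha, tendsto_map'_iff] at h1
      exact h1)
  obtain ⟨φ, hφa, hφ⟩ := exists_analyticAt_eq_mul_of_le_div_im (C := 8 * (128 * Real.pi) ^ 2) hr'0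
    (by positivity) hFd (by
      intro s hs him
      have hs1 : |s.im| ≤ 1 := (Complex.abs_im_le_norm s).trans
        ((mem_ball_zero_iff.1 hs).le.trans (min_le_right _ _))
      rcases him.lt_or_gt with hneg | hpos
      · have e : ((starRingEnd ℂ) s).im = |s.im| := by rw [Complex.conj_im, abs_of_neg hneg]
        have h1 := norm_curvatureFn_le hf hi ha (s := (starRingEnd ℂ) s) (by rw [e]; positivity)
          (by rw [e]; exact hs1)
        rw [hFl s hneg, RCLike.norm_conj]
        rwa [e] at h1
      · rw [hFu s hpos, abs_of_pos hpos]
        rw [abs_of_pos hpos] at hs1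
        exact norm_curvatureFn_le hf hi ha hpos hs1)
  have hreal : ∀ᶠ s in 𝓝[≠] (0 : ℂ), s.im = 0 → (φ s).im = 0 := by
    filter_upwards [hφ, nhdsWithin_le_nhds (Metric.ball_mem_nhds (0 : ℂ) hr'0), self_mem_nhdsWithin]
      with s h1 h2 h3 h4
    obtain ⟨t, rfl⟩ : ∃ t : ℝ, s = t := ⟨s.re, Complex.ext (by simp) (by simpa using h4)⟩
    have h5 := hFr t (by simpa using h3) (by simpa using h2)
    rw [h1, Complex.im_ofReal_mul, h5, mul_zero]
  have h0 : (φ 0).im = 0 := im_eq_zero_of_eventually hφa.continuousAt hreal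
  have hreal' : ∀ᶠ s in 𝓝 (0 : ℂ), s.im = 0 → (φ s).im = 0 := by
    rw [eventually_nhdsWithin_iff] at hreal
    filter_upwards [hreal] with s hs him
    by_cases hs0 : s = 0
    · rw [hs0, h0]
    · exact hs hs0 him
  have h1 := deriv_im_eq_zero hφa.differentiableAt hreal'
  -- Since the function is φ(s)/s, the index and the constant term are the first two Taylor
  -- coefficients of φ, both real because φ is real on the axis.
  refine ⟨(φ 0).re, (deriv φ 0).re, ?_⟩
  have e0 : (((φ 0).re : ℝ) : ℂ) = φ 0 := Complex.ext (by simp) (by simpa using h0.symm)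
  have e1 : (((deriv φ 0).re : ℝ) : ℂ) = deriv φ 0 := Complex.ext (by simp) (by simpa using h1.symm)
  rw [e0, e1]
  have hle : 𝓝[{s : ℂ | 0 < s.im}] 0 ≤ 𝓝[≠] 0 := nhdsWithin_mono _ fun s hs h => by
    have hs' : 0 < s.im := hs
    rw [h] at hs'
    simp at hs'
  refine ((hasDerivAt_iff_tendsto_slope.1 hφa.differentiableAt.hasDerivAt).mono_left hle).congr' ?_
  filter_upwards [hle hφ, self_mem_nhdsWithin, hle self_mem_nhdsWithin] with s hs hs' hs0
  have hs0' : s ≠ 0 := hs0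
  have e2 : φ s = s * G s := by rw [← hFu s hs']; exact hs
  rw [slope_def_field, e2, sub_zero, sub_div, mul_div_cancel_left₀ _ hs0']

/-- If `f` tends to `∞` at `a`, then the index at `a` is negative. -/
theorem HasAngleIndex.neg_of_tendsto {f : ℂ → ℂ} (hf : DifferentiableOn ℂ f (Metric.ball 0 1))
    (hi : Set.InjOn f (Metric.ball 0 1)) {a : ℂ} {γ : ℝ} (h : HasAngleIndex f a γ) (ha : a ∈ poleSet f) :
    γ < 0 := by
  -- On s = iy, u(y) = h'(iy) satisfies u' = wu with Re w = γ/y + O(1) ≥ -C if γ ≥ 0. Then ‖u‖²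
  -- e^{2Cy} is nondecreasing in y, so u stays bounded as y tends to 0, and so does f along the
  -- radius.
  by_contra! hγ
  obtain ⟨ha1, ha2⟩ := ha
  obtain ⟨α, hα⟩ := h
  set h : ℂ → ℂ := fun s => f (a * Complex.exp (Complex.I * s)) with hh
  have hb := hα.norm.eventually (gt_mem_nhds (show ‖(α : ℂ)‖ < ‖(α : ℂ)‖ + 1 by linarith))
  set C := ‖(α : ℂ)‖ + 1 with hC
  have hI : Tendsto (fun y : ℝ => (y : ℂ) * Complex.I) (𝓝[>] 0) (𝓝[{s | 0 < s.im}] 0) := by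
    rw [tendsto_nhdsWithin_iff]
    constructor
    · have h1 : Continuous fun y : ℝ => (y : ℂ) * Complex.I := by fun_prop
      have := (h1.tendsto 0).mono_left (nhdsWithin_le_nhds (s := Set.Ioi (0 : ℝ)))
      simpa using this
    · filter_upwards [self_mem_nhdsWithin] with y hy
      have hy' : 0 < y := hy
      change 0 < ((y : ℂ) * Complex.I).im
      simpa using hy'
  obtain ⟨y₀, hy₀, hby⟩ := mem_nhdsGT_iff_exists_Ioc_subset.1 (hI.eventually hb)
  have hy₀' : 0 < y₀ := hy₀
  set w : ℝ → ℂ := fun y => Complex.I * (Complex.I * curvatureFn f (a * Complex.exp (Complex.I *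
    (y * Complex.I)))) with hw
  have hwre : ∀ y ∈ Set.Ioc 0 y₀, -C ≤ (w y).re := by
    intro y hy
    have h1 := hby hy
    simp only [Set.mem_ofPred_eq] at h1
    set e := Complex.I * curvatureFn f (a * Complex.exp (Complex.I * (y * Complex.I))) -
      (γ : ℂ) / (y * Complex.I) with he
    have h2 : w y = ((γ / y : ℝ) : ℂ) + Complex.I * e := by
      have hy0 : (y : ℂ) ≠ 0 := by exact_mod_cast hy.1.ne'
      simp only [hw, he]
      push_cast
      have := Complex.I_ne_zero
      field_simp
      ring
    rw [h2, Complex.add_re, Complex.ofReal_re]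
    have h3 : 0 ≤ γ / y := div_nonneg hγ hy.1.le
    have h4 := Complex.abs_re_le_norm (Complex.I * e)
    rw [norm_mul, Complex.norm_I, one_mul] at h4
    have := neg_abs_le (Complex.I * e).re
    have h1' : ‖e‖ < C := h1
    linarith
  have hhd : DifferentiableOn ℂ h {s | 0 < s.im} := by
    refine hf.comp (g := f) (f := fun s => a * Complex.exp (Complex.I * s)) ?_ fun w hw =>
      (mul_exp_I_mul_mem_ball ha1).2 hw
    have : Differentiable ℂ fun s => a * Complex.exp (Complex.I * s) := by fun_prop
    exact this.differentiableOn
  have hup : ∀ y : ℝ, 0 < y → 0 < ((y : ℂ) * Complex.I).im := fun y hy => by simpa using hy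
  have hid : ∀ y : ℝ, HasDerivAt (fun y : ℝ => (y : ℂ) * Complex.I) Complex.I y := fun y => by
    have := (Complex.ofRealCLM.hasDerivAt (x := y)).mul_const Complex.I
    simpa using this
  set u : ℝ → ℂ := fun y => deriv h (y * Complex.I) with hu
  have hud : ∀ y : ℝ, 0 < y → HasDerivAt u (w y * u y) y := by
    intro y hy
    have h1 : HasDerivAt (deriv h) (deriv (deriv h) (y * Complex.I)) (y * Complex.I) :=
      ((hhd.deriv isOpen_upper).differentiableAt (isOpen_upper.mem_nhds (hup y hy))).hasDerivAt
    have h2 := HasDerivAt.scomp y h1 (hid y)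
    refine h2.congr_deriv ?_
    rw [(deriv_strip hf hi ha1 (hup y hy)).2, smul_eq_mul]
    simp only [hw, hu, hh]
    ring
  have hvd : ∀ y : ℝ, 0 < y → HasDerivAt (fun y : ℝ => h (y * Complex.I)) (Complex.I * u y) y := by
    intro y hy
    have h1 : HasDerivAt h (deriv h (y * Complex.I)) (y * Complex.I) :=
      (hhd.differentiableAt (isOpen_upper.mem_nhds (hup y hy))).hasDerivAt
    exact HasDerivAt.scomp (g₁ := h) y h1 (hid y)
  set W : ℝ → ℝ := fun y => ‖u y‖ ^ 2 * Real.exp (2 * C * y) with hW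
  have hWd : ∀ y : ℝ, 0 < y → HasDerivAt W (2 * (‖u y‖ ^ 2 * ((w y).re + C)) * Real.exp (2 * C * y)) y := by
    intro y hy
    have h1 := (hud y hy).norm_sq
    have h2 : HasDerivAt (fun y => Real.exp (2 * C * y)) (Real.exp (2 * C * y) * (2 * C * 1)) y :=
      ((hasDerivAt_id y).const_mul (2 * C)).exp
    refine (h1.mul h2).congr_deriv ?_
    have h3 : inner ℝ (u y) (w y * u y) = ‖u y‖ ^ 2 * (w y).re := by
      rw [Complex.inner, mul_assoc, Complex.mul_conj', mul_comm, ← Complex.ofReal_pow,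
        Complex.re_ofReal_mul]
    rw [h3]
    ring
  have hWm : MonotoneOn W (Set.Ioc 0 y₀) := by
    refine monotoneOn_of_deriv_nonneg (convex_Ioc _ _) ?_ ?_ ?_
    · exact fun y hy => (hWd y hy.1).continuousAt.continuousWithinAt
    · rw [interior_Ioc]
      exact fun y hy => (hWd y hy.1).differentiableAt.differentiableWithinAt
    · rw [interior_Ioc]
      intro y hy
      rw [(hWd y hy.1).deriv]
      have := hwre y ⟨hy.1, hy.2.le⟩
      have h2 : 0 ≤ (w y).re + C := by linarith
      positivity
  have hC0 : 0 ≤ C := by positivity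
  have hub : ∀ y ∈ Set.Ioc 0 y₀, ‖Complex.I * u y‖ ≤ Real.sqrt (W y₀) := by
    intro y hy
    rw [norm_mul, Complex.norm_I, one_mul]
    apply Real.le_sqrt_of_sq_le
    refine le_trans ?_ (hWm hy ⟨hy₀', le_rfl⟩ hy.2)
    have : 1 ≤ Real.exp (2 * C * y) := Real.one_le_exp (by have := hy.1; positivity)
    simp only [hW]
    nlinarith [sq_nonneg ‖u y‖]
  have hvb : ∀ y ∈ Set.Ioc 0 y₀, ‖h (y * Complex.I)‖ ≤ ‖h (y₀ * Complex.I)‖ + Real.sqrt (W y₀) * y₀ := by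
    intro y hy
    have h1 := (convex_Ioc (0 : ℝ) y₀).norm_image_sub_le_of_norm_hasDerivWithin_le
      (f := fun y : ℝ => h (y * Complex.I)) (fun y hy => (hvd y hy.1).hasDerivWithinAt) hub
      (⟨hy₀', le_rfl⟩ : y₀ ∈ Set.Ioc 0 y₀) hy
    have h2 := norm_sub_norm_le (h (y * Complex.I)) (h (y₀ * Complex.I))
    have h3 : ‖y - y₀‖ ≤ y₀ := by
      rw [Real.norm_eq_abs, abs_le]; constructor <;> linarith [hy.1, hy.2]
    have h4 := mul_le_mul_of_nonneg_left h3 (Real.sqrt_nonneg (W y₀))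
    linarith
  have hcob : Tendsto (fun y : ℝ => ‖h (y * Complex.I)‖) (𝓝[>] 0) atTop := by
    have h1 := tendsto_norm_atTop_iff_cobounded.2 ha2
    rw [← map_strip ha1, tendsto_map'_iff] at h1
    exact h1.comp hI
  obtain ⟨y, h1, h2⟩ := ((hcob.eventually_gt_atTop (‖h (y₀ * Complex.I)‖ + Real.sqrt (W y₀) * y₀)).and
    (Ioc_mem_nhdsGT hy₀')).exists
  exact absurd (hvb y h2) (not_le.2 h1)

/-- Every point of the circle has an index. It is negative at the points at which `f` tends to `∞`, it
is `β / π - 1` at the prevertex of a corner with angle `β`, and it vanishes at almost all points. -/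
theorem exists_angleIndex {f : ℂ → ℂ} {Ω : Set ℂ} (hΩ : IsPolygon Ω) (hf : IsConformalFromDisk f Ω) :
    ∃ γ : ℂ → ℝ, (∀ ζ, ‖ζ‖ = 1 → HasAngleIndex f ζ (γ ζ)) ∧ {ζ | ‖ζ‖ = 1 ∧ γ ζ ≠ 0}.Finite ∧
      (∀ ζ ∈ poleSet f, γ ζ < 0) ∧
      ∀ c ∈ corners Ω, ∀ ζ, IsPrevertex f c ζ → γ ζ = c.2.2 / Real.pi - 1 := by
  classical
  obtain ⟨E, hEf, hE1, -⟩ := hΩ.exists_exceptional_set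
  set N := {ζ | ∃ c ∈ corners Ω, c.1 ∈ E ∧ IsPrevertex f c ζ} with hN
  have hNf : N.Finite := finite_prevertices hΩ hEf
  have hKf := finite_poleSet hΩ hf
  have hflat : ∀ ζ, ‖ζ‖ = 1 → ζ ∉ N ∪ poleSet f → HasAngleIndex f ζ 0 := by
    intro ζ hζ hn
    rcases isPrevertex_or_tendsto_cobounded hΩ hf hζ with ⟨c, hc, h⟩ | h
    · have hπ : c.2.2 = Real.pi := by
        by_contra h'
        exact hn (Or.inl ⟨c, hc, hE1 c hc h', h⟩)
      have := h.tendsto_curvatureFn hf.differentiableOn hf.injOn hc.2.1.1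
      rwa [hπ, div_self Real.pi_ne_zero, sub_self] at this
    · exact absurd (Or.inr ⟨hζ, h⟩) hn
  have hcorner : ∀ c ∈ corners Ω, ∀ ζ, IsPrevertex f c ζ → HasAngleIndex f ζ (c.2.2 / Real.pi - 1) :=
    fun c hc ζ h => h.tendsto_curvatureFn hf.differentiableOn hf.injOn hc.2.1.1
  have hpole : ∀ a ∈ poleSet f, ∃ γ, HasAngleIndex f a γ := by
    intro a ha
    have ha0 : a ≠ 0 := by
      intro h; have := ha.1; rw [h, norm_zero] at this; norm_num at this
    have hfin : ((N ∪ poleSet f) \ {a}).Finite := (hNf.union hKf).subset Set.sdiff_subset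
    have hcont : Continuous fun t : ℝ => a * Complex.exp (Complex.I * t) := by fun_prop
    have h1 : ∀ᶠ t : ℝ in 𝓝 0, a * Complex.exp (Complex.I * t) ∉ (N ∪ poleSet f) \ {a} := by
      refine (hcont.tendsto 0).eventually (hfin.isClosed.isOpen_compl.mem_nhds ?_)
      simp
    obtain ⟨δ, hδ, h2⟩ := Metric.eventually_nhds_iff_ball.1 h1
    -- The cap 1 on the radius rules out e^{it} = 1 with t ≠ 0, so the arc returns to a only at its
    -- centre.
    refine exists_hasAngleIndex hf.differentiableOn hf.injOn ha.1 (lt_min hδ one_pos) fun t ht htr => ?_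
    refine hflat _ (by rw [norm_mul_exp_I_mul ha.1]; simp) fun h3 => ?_
    refine h2 t (by rw [mem_ball_zero_iff]; exact htr.trans_le (min_le_left _ _)) ⟨h3, fun h4 => ?_⟩
    have h5 : Complex.exp (Complex.I * t) = Complex.exp 0 := by
      rw [Complex.exp_zero]
      exact mul_left_cancel₀ ha0 (by rw [mul_one]; exact h4)
    rw [mul_comm, ← zero_mul Complex.I, ← Complex.ofReal_zero] at h5
    obtain ⟨n, hn⟩ := exp_eq_exp_iff_real h5
    have h6 : |t| < 1 := htr.trans_le (min_le_right _ _)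
    rw [zero_add] at hn
    have hn0 : n ≠ 0 := by rintro rfl; simp at hn; exact ht hn
    have h7 : (1 : ℝ) ≤ |(n : ℝ)| := by exact_mod_cast Int.one_le_abs hn0
    have := Real.pi_gt_three
    rw [hn, abs_mul, abs_of_pos (by positivity : 0 < 2 * Real.pi)] at h6
    nlinarith
  choose! g hg using hpole
  have hprev : ∀ ζ, ‖ζ‖ = 1 → ζ ∉ poleSet f → ∃ c ∈ corners Ω, IsPrevertex f c ζ := fun ζ h1 h2 =>
    (isPrevertex_or_tendsto_cobounded hΩ hf h1).resolve_right fun h => h2 ⟨h1, h⟩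
  choose! c hc hcp using hprev
  refine ⟨fun ζ => if ζ ∈ poleSet f then g ζ else (c ζ).2.2 / Real.pi - 1, ?_, ?_, ?_, ?_⟩
  · intro ζ hζ
    by_cases h : ζ ∈ poleSet f
    · simp only [if_pos h]; exact hg ζ h
    · simp only [if_neg h]; exact hcorner _ (hc ζ hζ h) ζ (hcp ζ hζ h)
  · refine (hNf.union hKf).subset ?_
    rintro ζ ⟨hζ, hne⟩
    by_cases h : ζ ∈ poleSet f
    · exact Or.inr h
    · left
      simp only [if_neg h] at hne
      refine ⟨c ζ, hc ζ hζ h, hE1 _ (hc ζ hζ h) fun hπ => hne ?_, hcp ζ hζ h⟩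
      rw [hπ, div_self Real.pi_ne_zero, sub_self]
  · intro ζ h
    simp only [if_pos h]
    exact (hg ζ h).neg_of_tendsto hf.differentiableOn hf.injOn h
  · intro c' hc' ζ h
    have hζ : ζ ∉ poleSet f := fun h' => h.not_tendsto_cobounded hc'.2.1.1 h'.2
    simp only [if_neg hζ]
    rw [h.corner_unique hc' (hc ζ h.1 hζ) (hcp ζ h.1 hζ)]


/-! ### The Schwarz-Christoffel formula -/

/-- A holomorphic function on the disk with purely imaginary boundary values is constant. -/
theorem eq_of_imaginary_boundary_values {Q : ℂ → ℂ} (hQ : DifferentiableOn ℂ Q (Metric.ball 0 1))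
    (hb : ∀ ζ : ℂ, ‖ζ‖ = 1 → ∃ α : ℝ, Tendsto (fun z => Complex.I * Q z) (𝓝[Metric.ball 0 1] ζ) (𝓝 (α : ℂ))) :
    ∀ z ∈ Metric.ball (0 : ℂ) 1, (Q z).re = 0 ∧ Q z = Q 0 := by
  have hcl : closure (Metric.ball (0 : ℂ) 1) = Metric.closedBall 0 1 := closure_ball _ one_ne_zero
  have hb' : ∀ ζ : ℂ, ‖ζ‖ = 1 → ∃ y : ℂ, y.re = 0 ∧ Tendsto Q (𝓝[Metric.ball 0 1] ζ) (𝓝 y) := by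
    intro ζ hζ
    obtain ⟨α, hα⟩ := hb ζ hζ
    refine ⟨-Complex.I * α, by simp, (hα.const_mul (-Complex.I)).congr fun z => ?_⟩
    rw [← mul_assoc, neg_mul, Complex.I_mul_I, neg_neg, one_mul]
  set R := extendFrom (Metric.ball (0 : ℂ) 1) Q with hR
  have hRQ : ∀ z ∈ Metric.ball (0 : ℂ) 1, R z = Q z := extendFrom_extends hQ.continuousOn
  have hRc : ContinuousOn R (closure (Metric.ball (0 : ℂ) 1)) := by
    refine continuousOn_extendFrom le_rfl fun z hz => ?_
    rw [hcl, mem_closedBall_zero_iff] at hz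
    rcases hz.lt_or_eq with h | h
    · exact ⟨Q z, hQ.continuousOn z (mem_ball_zero_iff.2 h)⟩
    · obtain ⟨y, -, hy⟩ := hb' z h
      exact ⟨y, hy⟩
  have hRd : DiffContOnCl ℂ R (Metric.ball 0 1) := ⟨hQ.congr hRQ, hRc⟩
  have hRb : ∀ z ∈ frontier (Metric.ball (0 : ℂ) 1), (R z).re = 0 := by
    intro z hz
    rw [frontier_ball _ one_ne_zero, mem_sphere_zero_iff_norm] at hz
    obtain ⟨y, hy0, hy⟩ := hb' z hz
    rw [hR, extendFrom_eq (by rw [hcl, mem_closedBall_zero_iff, hz]) hy, hy0]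
  -- Both exp R and exp(-R) have modulus 1 on the circle; the maximum principle bounds Re Q from
  -- both sides.
  have hre : ∀ z ∈ Metric.ball (0 : ℂ) 1, (Q z).re = 0 := by
    intro z hz
    have h1 := Complex.norm_le_of_forall_mem_frontier_norm_le (f := fun z => Complex.exp (R z))
      Metric.isBounded_ball (Complex.differentiable_exp.comp_diffContOnCl hRd) (C := 1)
      (fun z hz => by rw [Complex.norm_exp, hRb z hz, Real.exp_zero]) (subset_closure hz)
    have h2 := Complex.norm_le_of_forall_mem_frontier_norm_le (f := fun z => Complex.exp (-R z))
      Metric.isBounded_ball (Complex.differentiable_exp.comp_diffContOnCl hRd.neg) (C := 1)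
      (fun z hz => by rw [Complex.norm_exp, Complex.neg_re, hRb z hz, neg_zero, Real.exp_zero])
      (subset_closure hz)
    rw [Complex.norm_exp, Real.exp_le_one_iff, hRQ z hz] at h1
    rw [Complex.norm_exp, Real.exp_le_one_iff, Complex.neg_re, hRQ z hz] at h2
    linarith
  have hball : IsPreconnected (Metric.ball (0 : ℂ) 1) := (convex_ball _ _).isPreconnected
  have h0 : (0 : ℂ) ∈ Metric.ball (0 : ℂ) 1 := Metric.mem_ball_self one_pos
  have hconst : Set.EqOn (fun z => Complex.exp (Q z)) (Function.const ℂ (Complex.exp (Q 0)))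
      (Metric.ball 0 1) := by
    refine Complex.eqOn_of_isPreconnected_of_isMaxOn_norm hball Metric.isOpen_ball hQ.cexp h0
      fun z hz => ?_
    simp only [Set.mem_ofPred_eq, Function.comp_apply, Complex.norm_exp, hre z hz, hre 0 h0, le_refl]
  refine fun z hz => ⟨hre z hz, ?_⟩
  refine Metric.isOpen_ball.is_const_of_deriv_eq_zero hball hQ (fun w hw => ?_) hz h0
  have h1 : HasDerivAt Q (deriv Q w) w :=
    (hQ.differentiableAt (Metric.isOpen_ball.mem_nhds hw)).hasDerivAt
  have h2 : (fun z => Complex.exp (Q z)) =ᶠ[𝓝 w] fun _ => Complex.exp (Q 0) := by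
    filter_upwards [Metric.isOpen_ball.mem_nhds hw] with v hv using hconst hv
  have h3 := h1.cexp.unique ((hasDerivAt_const w (Complex.exp (Q 0))).congr_of_eventuallyEq h2)
  simpa [Complex.exp_ne_zero] using h3

/-- The principal part of `(e^{is} + 1) / (e^{is} - 1)`. -/
theorem tendsto_cayley_exp :
    Tendsto (fun s : ℂ => Complex.I * ((Complex.exp (Complex.I * s) + 1) /
      (Complex.exp (Complex.I * s) - 1)) / 2 - 1 / s) (𝓝[≠] 0) (𝓝 0) := by
  set e : ℂ → ℂ := fun s => Complex.exp (Complex.I * s) with he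
  have hed : Differentiable ℂ e := by fun_prop
  have he' : HasDerivAt e Complex.I 0 := by
    have h1 : HasDerivAt (fun s : ℂ => Complex.I * s) (Complex.I * 1) 0 := (hasDerivAt_id 0).const_mul _
    have h2 := h1.cexp
    simpa using h2
  set g := dslope e 0 with hg
  have hgd : DifferentiableAt ℂ g 0 :=
    ((Complex.differentiableOn_dslope (Filter.univ_mem)).2 hed.differentiableOn).differentiableAt
      Filter.univ_mem
  have hg0 : g 0 = Complex.I := by rw [hg, dslope_same, he'.deriv]
  have hge : ∀ s, e s = 1 + s * g s := by
    intro s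
    have := sub_smul_dslope e 0 s
    rw [sub_zero, smul_eq_mul] at this
    rw [hg, this]
    simp [he]
  have hgne : ∀ᶠ s in 𝓝[≠] (0 : ℂ), g s ≠ 0 :=
    nhdsWithin_le_nhds (hgd.continuousAt.eventually_ne (by rw [hg0]; exact Complex.I_ne_zero))
  have hlim : ∃ L, Tendsto (fun s : ℂ => Complex.I * ((e s + 1) / (e s - 1)) / 2 - 1 / s) (𝓝[≠] 0) (𝓝 L) := by
    have h1 := (hasDerivAt_iff_tendsto_slope.1 hgd.hasDerivAt).div
      (hgd.continuousAt.tendsto.mono_left (nhdsWithin_le_nhds (s := {0}ᶜ)))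
      (by rw [hg0]; exact Complex.I_ne_zero)
    refine ⟨_, (h1.const_sub (Complex.I / 2)).congr' ?_⟩
    filter_upwards [hgne, self_mem_nhdsWithin] with s hs hs0
    have hs0' : s ≠ 0 := hs0
    simp only [Pi.div_apply, slope_def_field, sub_zero, hg0]
    rw [hge, add_sub_cancel_left]
    field_simp
    ring
  obtain ⟨L, hL⟩ := hlim
  have hneg : Tendsto (fun s : ℂ => -s) (𝓝[≠] 0) (𝓝[≠] 0) := by
    rw [tendsto_nhdsWithin_iff]
    constructor
    · have := (continuous_neg.tendsto (0 : ℂ)).mono_left (nhdsWithin_le_nhds (s := {0}ᶜ))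
      rwa [neg_zero] at this
    · filter_upwards [self_mem_nhdsWithin] with s hs
      simpa using hs
  -- The function is odd, so its limit L equals -L and need not be computed.
  have h2 : Tendsto (fun s : ℂ => Complex.I * ((e s + 1) / (e s - 1)) / 2 - 1 / s) (𝓝[≠] 0) (𝓝 (-L)) := by
    refine (hL.comp hneg).neg.congr' ?_
    filter_upwards [hgne, self_mem_nhdsWithin] with s hs hs0
    have hs0' : s ≠ 0 := hs0
    have e1 : e (-s) = (e s)⁻¹ := by simp only [he]; rw [mul_neg, Complex.exp_neg]
    have e2 : e s ≠ 0 := Complex.exp_ne_zero _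
    have e3 : e s - 1 ≠ 0 := by rw [hge, add_sub_cancel_left]; exact mul_ne_zero hs0' hs
    have e4 : 1 - e s ≠ 0 := by rw [← neg_sub]; exact neg_ne_zero.2 e3
    have e5 : ((e s)⁻¹ + 1) / ((e s)⁻¹ - 1) = -((e s + 1) / (e s - 1)) := by
      rw [← div_neg, neg_sub]
      field_simp
      ring
    simp only [Function.comp_apply]
    rw [e1, e5]
    field_simp
    ring
  have h3 := tendsto_nhds_unique hL h2
  have h4 : L = 0 := by
    have : (2 : ℂ) * L = 0 := by linear_combination h3
    simpa using this
  rwa [h4] at hL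

theorem cayley_re_eq_zero {ζ a : ℂ} (hζ : ‖ζ‖ = 1) (ha : ‖a‖ = 1) : ((ζ + a) / (ζ - a)).re = 0 := by
  rw [Complex.div_re, ← add_div]
  have h1 : ζ.re * ζ.re + ζ.im * ζ.im = 1 := by
    rw [← Complex.normSq_apply, Complex.normSq_eq_norm_sq, hζ]; norm_num
  have h2 : a.re * a.re + a.im * a.im = 1 := by
    rw [← Complex.normSq_apply, Complex.normSq_eq_norm_sq, ha]; norm_num
  have h3 : (ζ + a).re * (ζ - a).re + (ζ + a).im * (ζ - a).im = 0 := by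
    simp only [Complex.add_re, Complex.sub_re, Complex.add_im, Complex.sub_im]
    linear_combination h1 - h2
  rw [h3, zero_div]

theorem sub_ne_zero_of_mem_ball {z a : ℂ} (hz : z ∈ Metric.ball (0 : ℂ) 1) (ha : ‖a‖ = 1) : z - a ≠ 0 := by
  intro h
  rw [sub_eq_zero] at h
  rw [h, mem_ball_zero_iff, ha] at hz
  exact lt_irrefl _ hz

/-- The kernel γ(a)(z + a)/(2(z - a)) has the singularity of 1 + z f''/f' at a and is imaginary
elsewhere on the circle. So the difference Q is an imaginary constant. But Q(0) = 1 + ½ ∑ γ(a) is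
real, hence Q = 0 and ∑ γ(a) = -2. -/
theorem schwarzChristoffel {f : ℂ → ℂ} (hf : DifferentiableOn ℂ f (Metric.ball 0 1))
    (hi : Set.InjOn f (Metric.ball 0 1)) {γ : ℂ → ℝ} (hγ : ∀ ζ, ‖ζ‖ = 1 → HasAngleIndex f ζ (γ ζ))
    {T : Finset ℂ} (hT : ∀ ζ ∈ T, ‖ζ‖ = 1) (hT' : ∀ ζ, ‖ζ‖ = 1 → ζ ∉ T → γ ζ = 0) :
    ∑ a ∈ T, γ a = -2 ∧ ∀ z ∈ Metric.ball (0 : ℂ) 1,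
      deriv (deriv f) z / deriv f z = ∑ a ∈ T, (γ a : ℂ) / (z - a) := by
  classical
  set C : ℂ → ℂ := fun z => ∑ a ∈ T, (γ a : ℂ) * ((z + a) / (z - a)) / 2 with hC
  set Q : ℂ → ℂ := fun z => curvatureFn f z - C z with hQ
  have hCd : DifferentiableOn ℂ C (Metric.ball 0 1) := by
    refine DifferentiableOn.fun_sum fun a ha => ?_
    refine (DifferentiableOn.const_mul ?_ _).div_const _
    exact (differentiableOn_id.add_const a).div (differentiableOn_id.sub_const a) fun z hz =>
      sub_ne_zero_of_mem_ball hz (hT a ha)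
  have hQd : DifferentiableOn ℂ Q (Metric.ball 0 1) := (differentiableOn_curvatureFn hf hi).sub hCd
  have hle : 𝓝[{s : ℂ | 0 < s.im}] 0 ≤ 𝓝[≠] 0 := nhdsWithin_mono _ fun s hs h => by
    have hs' : 0 < s.im := hs
    rw [h] at hs'
    simp at hs'
  have hQb : ∀ ζ : ℂ, ‖ζ‖ = 1 →
      ∃ α : ℝ, Tendsto (fun z => Complex.I * Q z) (𝓝[Metric.ball 0 1] ζ) (𝓝 (α : ℂ)) := by
    intro ζ hζ
    have hζ0 : ζ ≠ 0 := by
      intro h; rw [h, norm_zero] at hζ; norm_num at hζ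
    obtain ⟨α, hα⟩ := hγ ζ hζ
    set E : ℂ → ℂ := fun s => ζ * Complex.exp (Complex.I * s) with hE
    have hEc : Tendsto E (𝓝[{s | 0 < s.im}] 0) (𝓝 ζ) := by
      have h1 : Continuous E := by fun_prop
      have := (h1.tendsto 0).mono_left (nhdsWithin_le_nhds (s := {s : ℂ | 0 < s.im}))
      simpa [hE] using this
    have hterm : ∀ a ∈ T.erase ζ, ∃ β : ℝ, Tendsto (fun s => Complex.I *
        ((γ a : ℂ) * ((E s + a) / (E s - a)) / 2)) (𝓝[{s | 0 < s.im}] 0) (𝓝 (β : ℂ)) := by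
      intro a ha
      obtain ⟨hne, haT⟩ := Finset.mem_erase.1 ha
      have h1 := (((hEc.add_const a).div (hEc.sub_const a) (sub_ne_zero.2 hne.symm)).const_mul
        (γ a : ℂ)).div_const 2 |>.const_mul Complex.I
      have h2 := cayley_re_eq_zero hζ (hT a haT)
      set w := (ζ + a) / (ζ - a) with hw
      have h3 : w = Complex.I * w.im := by
        apply Complex.ext <;> simp [h2]
      refine ⟨-(γ a * w.im / 2), ?_⟩
      have e : Complex.I * ((γ a : ℂ) * w / 2) = ((-(γ a * w.im / 2) : ℝ) : ℂ) := by
        rw [h3]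
        push_cast
        simp only [Complex.mul_im, Complex.I_re, Complex.I_im, Complex.ofReal_re, Complex.ofReal_im]
        ring_nf
        rw [Complex.I_sq]
        ring_nf
      rw [e] at h1
      exact h1
    choose! β hβ using hterm
    have hsum := tendsto_finsetSum (T.erase ζ) hβ
    have hsing : Tendsto (fun s => Complex.I * ((γ ζ : ℂ) * ((E s + ζ) / (E s - ζ)) / 2) - (γ ζ : ℂ) / s)
        (𝓝[{s | 0 < s.im}] 0) (𝓝 0) := by
      have h1 := (tendsto_cayley_exp.mono_left hle).const_mul (γ ζ : ℂ)
      rw [mul_zero] at h1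
      refine h1.congr fun s => ?_
      have e : (E s + ζ) / (E s - ζ) =
          (Complex.exp (Complex.I * s) + 1) / (Complex.exp (Complex.I * s) - 1) := by
        simp only [hE]
        rw [← mul_div_mul_left (Complex.exp (Complex.I * s) + 1) _ hζ0]
        ring_nf
      rw [e]
      ring
    refine ⟨α - 0 - ∑ a ∈ T.erase ζ, β a, ?_⟩
    rw [← map_strip hζ, tendsto_map'_iff]
    have hfin := (hα.sub hsing).sub hsum
    push_cast
    refine hfin.congr fun s => ?_
    simp only [Function.comp_apply, hQ, hC]
    have hsplit : ∑ a ∈ T, (γ a : ℂ) * ((E s + a) / (E s - a)) / 2 =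
        (γ ζ : ℂ) * ((E s + ζ) / (E s - ζ)) / 2 +
          ∑ a ∈ T.erase ζ, (γ a : ℂ) * ((E s + a) / (E s - a)) / 2 := by
      by_cases h : ζ ∈ T
      · exact (Finset.add_sum_erase T (fun a => (γ a : ℂ) * ((E s + a) / (E s - a)) / 2) h).symm
      · rw [Finset.erase_eq_of_notMem h, hT' ζ hζ h]
        simp
    change _ = Complex.I * (curvatureFn f (E s) - ∑ a ∈ T, (γ a : ℂ) * ((E s + a) / (E s - a)) / 2)
    rw [hsplit, mul_sub, mul_add, Finset.mul_sum]
    simp only [hE]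
    ring
  have hQc := eq_of_imaginary_boundary_values hQd hQb
  have h0 : (0 : ℂ) ∈ Metric.ball (0 : ℂ) 1 := Metric.mem_ball_self one_pos
  have hQ0 : Q 0 = ((1 + (∑ a ∈ T, γ a) / 2 : ℝ) : ℂ) := by
    simp only [hQ, hC, curvatureFn, zero_mul, add_zero]
    push_cast
    rw [Finset.sum_div, sub_eq_add_neg, ← Finset.sum_neg_distrib]
    congr 1
    refine Finset.sum_congr rfl fun a ha => ?_
    have ha0 : a ≠ 0 := by
      intro h; have := hT a ha; rw [h, norm_zero] at this; norm_num at this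
    rw [zero_add, zero_sub, div_neg, div_self ha0]
    ring
  have hsum0 : 1 + (∑ a ∈ T, γ a) / 2 = 0 := by
    have := (hQc 0 h0).1
    rwa [hQ0, Complex.ofReal_re] at this
  have hsum : ∑ a ∈ T, γ a = -2 := by linarith
  refine ⟨hsum, ?_⟩
  have hmul : ∀ z ∈ Metric.ball (0 : ℂ) 1,
      z * (deriv (deriv f) z / deriv f z) = z * ∑ a ∈ T, (γ a : ℂ) / (z - a) := by
    intro z hz
    have h1 : Q z = 0 := by rw [(hQc z hz).2, hQ0, hsum0, Complex.ofReal_zero]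
    have h2 : z * (deriv (deriv f) z / deriv f z) = C z - 1 := by
      have : curvatureFn f z - C z = 0 := h1
      rw [curvatureFn] at this
      linear_combination this
    have h3 : (1 : ℂ) = -∑ a ∈ T, (γ a : ℂ) / 2 := by
      rw [← Finset.sum_div]
      have : ((∑ a ∈ T, γ a : ℝ) : ℂ) = -2 := by rw [hsum]; push_cast; ring
      rw [Complex.ofReal_sum] at this
      rw [this]; ring
    rw [h2, h3, sub_neg_eq_add, hC, ← Finset.sum_add_distrib, Finset.mul_sum]
    refine Finset.sum_congr rfl fun a ha => ?_
    have := sub_ne_zero_of_mem_ball hz (hT a ha)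
    field_simp
    ring
  intro z hz
  -- The identity is obtained multiplied by z; continuity recovers it at the origin.
  by_cases hz0 : z = 0
  · have hL : ContinuousAt (fun z => deriv (deriv f) z / deriv f z) 0 := by
      have h1 := hf.deriv Metric.isOpen_ball
      have h2 := h1.deriv Metric.isOpen_ball
      exact ((h2.div h1 fun z hz => deriv_ne_zero_of_injOn Metric.isOpen_ball hf hi hz).continuousOn).continuousAt
        (Metric.isOpen_ball.mem_nhds h0)
    have hR : ContinuousAt (fun z => ∑ a ∈ T, (γ a : ℂ) / (z - a)) 0 := by
      refine tendsto_finsetSum _ fun a ha => ?_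
      exact (continuousAt_const.div (continuousAt_id.sub continuousAt_const)
        (sub_ne_zero_of_mem_ball h0 (hT a ha)))
    rw [hz0]
    refine tendsto_nhds_unique (hL.tendsto.mono_left (nhdsWithin_le_nhds (s := {0}ᶜ)))
      ((hR.tendsto.mono_left (nhdsWithin_le_nhds (s := {0}ᶜ))).congr' ?_)
    filter_upwards [nhdsWithin_le_nhds (Metric.isOpen_ball.mem_nhds h0), self_mem_nhdsWithin] with w h1 h2
    exact (mul_left_cancel₀ h2 (hmul w h1)).symm
  · exact mul_left_cancel₀ hz0 (hmul z hz)


/-! ### Counting the roots of polynomials in the unit disk -/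

/-- The number of roots of `p` in the unit disk, counted with multiplicity. -/
noncomputable def diskRootCount (p : Polynomial ℂ) : ℕ := p.roots.countP fun z => ‖z‖ < 1

theorem circleIntegral_sum_inv (s : Multiset ℂ) (hs : ∀ w ∈ s, ‖w‖ ≠ 1) :
    CircleIntegrable (fun z => (s.map fun w => 1 / (z - w)).sum) 0 1 ∧
    (∮ z in C(0, 1), (s.map fun w => 1 / (z - w)).sum) =
      2 * Real.pi * Complex.I * (s.countP fun z => ‖z‖ < 1 : ℕ) := by
  induction s using Multiset.induction_on with
  | empty => simp [circleIntegral]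
  | cons w s ih =>
    obtain ⟨h1, h2⟩ := ih fun v hv => hs v (Multiset.mem_cons_of_mem hv)
    have hw := hs w (Multiset.mem_cons_self w s)
    have hci : CircleIntegrable (fun z => 1 / (z - w)) 0 1 := by
      refine ContinuousOn.circleIntegrable zero_le_one ?_
      refine continuousOn_const.div (continuousOn_id.sub continuousOn_const) fun z hz h => ?_
      rw [mem_sphere_zero_iff_norm] at hz
      rw [sub_eq_zero] at h
      exact hw (h ▸ hz)
    have hval : (∮ z in C(0, 1), 1 / (z - w)) = if ‖w‖ < 1 then 2 * Real.pi * Complex.I else 0 := by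
      split_ifs with h
      · simp only [one_div]
        exact circleIntegral.integral_sub_inv_of_mem_ball (mem_ball_zero_iff.2 h)
      · have h' : 1 < ‖w‖ := lt_of_le_of_ne (not_lt.1 h) hw.symm
        have hne : ∀ z ∈ Metric.closedBall (0 : ℂ) 1, z - w ≠ 0 := by
          intro z hz h0
          rw [sub_eq_zero] at h0
          rw [h0, mem_closedBall_zero_iff] at hz
          linarith
        have hd : DiffContOnCl ℂ (fun z => 1 / (z - w)) (Metric.ball 0 1) := by
          apply DifferentiableOn.diffContOnCl
          rw [closure_ball _ one_ne_zero]
          exact (differentiableOn_const _).div (differentiableOn_id.sub_const w) hne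
        exact hd.circleIntegral_eq_zero zero_le_one
    simp only [Multiset.map_cons, Multiset.sum_cons, Multiset.countP_cons]
    refine ⟨hci.add h1, ?_⟩
    rw [circleIntegral.integral_add hci h1, hval, h2]
    split_ifs <;> push_cast <;> ring

theorem circleIntegral_derivative_div {p : Polynomial ℂ} (hp : ∀ z : ℂ, ‖z‖ = 1 → p.eval z ≠ 0) :
    (∮ z in C(0, 1), p.derivative.eval z / p.eval z) = 2 * Real.pi * Complex.I * (diskRootCount p : ℕ) := by
  rw [diskRootCount, ← (circleIntegral_sum_inv p.roots _).2]
  · refine circleIntegral.integral_congr zero_le_one fun z hz => ?_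
    exact (IsAlgClosed.splits p).eval_derivative_div_eval_of_ne_zero
      (hp z (mem_sphere_zero_iff_norm.1 hz))
  · intro w hw h1
    exact hp w h1 (Polynomial.isRoot_of_mem_roots hw)

/-- Rouché's theorem for polynomials and the unit circle. -/
theorem diskRootCount_add {p r : Polynomial ℂ} (h : ∀ z : ℂ, ‖z‖ = 1 → ‖r.eval z‖ < ‖p.eval z‖) :
    diskRootCount (p + r) = diskRootCount p := by
  -- Clamping the parameter to [0, 1] gives a family on all of ℝ without roots on the circle. By the
  -- argument principle its root count is continuous and integer valued, hence constant.
  set P : ℝ → Polynomial ℂ := fun t => p + Polynomial.C ((max 0 (min t 1) : ℝ) : ℂ) * r with hP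
  have hne : ∀ t : ℝ, ∀ z : ℂ, ‖z‖ = 1 → (P t).eval z ≠ 0 := by
    intro t z hz h0
    have h1 := h z hz
    simp only [hP, Polynomial.eval_add, Polynomial.eval_mul, Polynomial.eval_C] at h0
    have h2 : ‖p.eval z‖ ≤ ‖r.eval z‖ := by
      rw [eq_neg_of_add_eq_zero_left h0, norm_neg, norm_mul, Complex.norm_real, Real.norm_eq_abs,
        abs_of_nonneg (le_max_left _ _)]
      exact mul_le_of_le_one_left (norm_nonneg _) (max_le zero_le_one (min_le_right _ _))
    linarith
  have hcont : Continuous fun t : ℝ => (diskRootCount (P t) : ℝ) := by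
    have h1 : Continuous fun t : ℝ => ∮ z in C(0, 1), (P t).derivative.eval z / (P t).eval z := by
      unfold circleIntegral
      refine intervalIntegral.continuous_parametric_intervalIntegral_of_continuous' ?_ 0 (2 * Real.pi)
      have hc : Continuous fun x : ℝ × ℝ => circleMap 0 1 x.2 := (continuous_circleMap 0 1).comp continuous_snd
      have hd : Continuous fun x : ℝ × ℝ => deriv (circleMap 0 1) x.2 := by
        simp only [deriv_circleMap]
        fun_prop
      have hp : ∀ q : Polynomial ℂ, Continuous fun x : ℝ × ℝ => q.eval (circleMap 0 1 x.2) := fun q =>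
        q.continuous.comp hc
      have hm : Continuous fun x : ℝ × ℝ => ((max 0 (min x.1 1) : ℝ) : ℂ) := by fun_prop
      refine hd.smul (Continuous.div ?_ ?_ fun x => hne _ _ (by simp [circleMap]))
      · simp only [hP, Polynomial.derivative_add, Polynomial.derivative_C_mul, Polynomial.eval_add,
          Polynomial.eval_mul, Polynomial.eval_C]
        exact (hp _).add (hm.mul (hp _))
      · simp only [hP, Polynomial.eval_add, Polynomial.eval_mul, Polynomial.eval_C]
        exact (hp _).add (hm.mul (hp _))
    have h2 : Continuous fun t : ℝ => ((∮ z in C(0, 1), (P t).derivative.eval z / (P t).eval z) /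
        (2 * Real.pi * Complex.I)).re := Complex.continuous_re.comp (h1.div_const _)
    refine h2.congr fun t => ?_
    rw [circleIntegral_derivative_div (hne t), mul_div_cancel_left₀ _ (by simp [Real.pi_ne_zero])]
    simp
  have hcont' : Continuous fun t : ℝ => diskRootCount (P t) :=
    Nat.isClosedEmbedding_coe_real.isInducing.continuous_iff.2 hcont
  have key := PreconnectedSpace.constant inferInstance hcont' (x := 1) (y := 0)
  simpa [hP] using key

/-- The number of roots in the disk does not change in a family without roots on the circle. -/
theorem diskRootCount_eq_of_homotopy {P : ℝ → Polynomial ℂ}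
    (hc : Continuous fun x : ℝ × ℂ => (P x.1).eval x.2)
    (hne : ∀ t ∈ Set.Icc (0 : ℝ) 1, ∀ z : ℂ, ‖z‖ = 1 → (P t).eval z ≠ 0) :
    diskRootCount (P 0) = diskRootCount (P 1) := by
  have hloc : ∀ t ∈ Set.Icc (0 : ℝ) 1, ∀ᶠ t' in 𝓝 t, diskRootCount (P t') = diskRootCount (P t) := by
    intro t ht
    have h1 : ∀ᶠ t' in 𝓝 t, ∀ z ∈ Metric.sphere (0 : ℂ) 1,
        ‖(P t').eval z - (P t).eval z‖ < ‖(P t).eval z‖ := by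
      refine (isCompact_sphere (0 : ℂ) 1).eventually_forall_of_forall_eventually fun z hz => ?_
      have h2 : Continuous fun x : ℝ × ℂ => ‖(P x.1).eval x.2 - (P t).eval x.2‖ :=
        (hc.sub ((P t).continuous.comp continuous_snd)).norm
      have h3 : Continuous fun x : ℝ × ℂ => ‖(P t).eval x.2‖ :=
        ((P t).continuous.comp continuous_snd).norm
      refine (isOpen_lt h2 h3).mem_nhds ?_
      simpa using hne t ht z (mem_sphere_zero_iff_norm.1 hz)
    filter_upwards [h1] with t' h2
    rw [← diskRootCount_add (p := P t) (r := P t' - P t) fun z hz => by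
      rw [Polynomial.eval_sub]
      exact h2 z (mem_sphere_zero_iff_norm.2 hz), add_sub_cancel]
  refine isPreconnected_Icc.constant (f := fun t => diskRootCount (P t)) (fun t ht => ?_)
    (Set.left_mem_Icc.2 zero_le_one) (Set.right_mem_Icc.2 zero_le_one)
  exact (continuousAt_const.congr (by filter_upwards [hloc t ht] with t' h using h.symm)).continuousWithinAt

theorem diskRootCount_mul {p q : Polynomial ℂ} (h : p * q ≠ 0) :
    diskRootCount (p * q) = diskRootCount p + diskRootCount q := by
  rw [diskRootCount, Polynomial.roots_mul h, Multiset.countP_add]; rfl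

theorem diskRootCount_eq_natDegree {p : Polynomial ℂ} (h : ∀ z : ℂ, 1 ≤ ‖z‖ → p.eval z ≠ 0) :
    diskRootCount p = p.natDegree := by
  rw [(IsAlgClosed.splits p).natDegree_eq_card_roots, diskRootCount, Multiset.countP_eq_card]
  intro z hz
  by_contra hn
  exact h z (not_lt.1 hn) (Polynomial.isRoot_of_mem_roots hz)

theorem diskRootCount_eq_zero {p : Polynomial ℂ} (h : ∀ z : ℂ, ‖z‖ < 1 → p.eval z ≠ 0) :
    diskRootCount p = 0 := by
  rw [diskRootCount, Multiset.countP_eq_zero]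
  exact fun z hz hn => h z hn (Polynomial.isRoot_of_mem_roots hz)

theorem diskRootCount_C_mul {p : Polynomial ℂ} {c : ℂ} (hc : c ≠ 0) :
    diskRootCount (Polynomial.C c * p) = diskRootCount p := by
  rw [diskRootCount, Polynomial.roots_C_mul _ hc]; rfl

theorem diskRootCount_X : diskRootCount Polynomial.X = 1 := by
  rw [diskRootCount, Polynomial.roots_X, ← Multiset.cons_zero, Multiset.countP_cons_of_pos] <;> simp

/-! ### The polynomials attached to a sum of simple fractions -/

/-- The polynomial with simple roots `ρ a`, `a ∈ S`. -/
noncomputable def nodePoly (S : Finset ℂ) (ρ : ℝ) : Polynomial ℂ :=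
  ∏ a ∈ S, (Polynomial.X - Polynomial.C (ρ * a))

/-- The numerator of `(1/2) ∑ γ a (z + ρ a) / (z - ρ a)`. -/
noncomputable def herglotzPoly (S : Finset ℂ) (γ : ℂ → ℝ) (ρ : ℝ) : Polynomial ℂ :=
  ∑ a ∈ S, Polynomial.C (γ a / 2 : ℂ) * ((Polynomial.X + Polynomial.C (ρ * a)) * nodePoly (S.erase a) ρ)

theorem eval_nodePoly (S : Finset ℂ) (ρ : ℝ) (z : ℂ) : (nodePoly S ρ).eval z = ∏ a ∈ S, (z - ρ * a) := by
  simp [nodePoly, Polynomial.eval_prod]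

theorem eval_herglotzPoly (S : Finset ℂ) (γ : ℂ → ℝ) (ρ : ℝ) (z : ℂ) : (herglotzPoly S γ ρ).eval z =
    ∑ a ∈ S, (γ a / 2 : ℂ) * ((z + ρ * a) * ∏ b ∈ S.erase a, (z - ρ * b)) := by
  simp [herglotzPoly, Polynomial.eval_finsetSum, eval_nodePoly]

theorem eval_nodePoly_ne_zero {S : Finset ℂ} {ρ : ℝ} {z : ℂ} (h : ∀ a ∈ S, z ≠ ρ * a) :
    (nodePoly S ρ).eval z ≠ 0 := by
  rw [eval_nodePoly, Finset.prod_ne_zero_iff]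
  exact fun a ha => sub_ne_zero.2 (h a ha)

theorem eval_herglotzPoly_eq_mul {S : Finset ℂ} (γ : ℂ → ℝ) {ρ : ℝ} {z : ℂ} (h : ∀ a ∈ S, z ≠ ρ * a) :
    (herglotzPoly S γ ρ).eval z =
      (nodePoly S ρ).eval z * ∑ a ∈ S, (γ a / 2 : ℂ) * ((z + ρ * a) / (z - ρ * a)) := by
  rw [eval_herglotzPoly, eval_nodePoly, Finset.mul_sum]
  refine Finset.sum_congr rfl fun a ha => ?_
  have h1 := sub_ne_zero.2 (h a ha)
  rw [← Finset.mul_prod_erase S _ ha]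
  field_simp

/-- At a node only the summand of that node survives. -/
theorem eval_herglotzPoly_node_ne_zero {S : Finset ℂ} {γ : ℂ → ℝ} {ρ : ℝ} (hρ : ρ ≠ 0) {a : ℂ}
    (ha : a ∈ S) (ha0 : a ≠ 0) (hγ : γ a ≠ 0) : (herglotzPoly S γ ρ).eval (ρ * a) ≠ 0 := by
  have hρ' : (ρ : ℂ) ≠ 0 := by exact_mod_cast hρ
  have hγ' : (γ a : ℂ) ≠ 0 := by exact_mod_cast hγ
  rw [eval_herglotzPoly, Finset.sum_eq_single_of_mem a ha]
  · refine mul_ne_zero (div_ne_zero hγ' two_ne_zero) (mul_ne_zero ?_ ?_)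
    · rw [← two_mul]
      exact mul_ne_zero two_ne_zero (mul_ne_zero hρ' ha0)
    · rw [Finset.prod_ne_zero_iff]
      intro b hb
      rw [← mul_sub]
      exact mul_ne_zero hρ' (sub_ne_zero.2 (Finset.ne_of_mem_erase hb).symm)
  · intro b hb hba
    have h0 : ∏ b' ∈ S.erase b, ((ρ : ℂ) * a - ρ * b') = 0 :=
      Finset.prod_eq_zero (Finset.mem_erase.2 ⟨hba.symm, ha⟩) (sub_self _)
    rw [h0, mul_zero, mul_zero]

theorem cayley_re (z a : ℂ) : ((z + a) / (z - a)).re = (‖z‖ ^ 2 - ‖a‖ ^ 2) / Complex.normSq (z - a) := by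
  rw [Complex.div_re, ← add_div, ← Complex.normSq_eq_norm_sq, ← Complex.normSq_eq_norm_sq]
  congr 1
  simp only [Complex.normSq_apply, Complex.add_re, Complex.sub_re, Complex.add_im, Complex.sub_im]
  ring

theorem re_sum_cayley (S : Finset ℂ) (γ : ℂ → ℝ) (ρ : ℝ) (z : ℂ) :
    (∑ a ∈ S, (γ a / 2 : ℂ) * ((z + ρ * a) / (z - ρ * a))).re =
      ∑ a ∈ S, γ a / 2 * ((‖z‖ ^ 2 - ‖(ρ : ℂ) * a‖ ^ 2) / Complex.normSq (z - ρ * a)) := by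
  rw [Complex.re_sum]
  refine Finset.sum_congr rfl fun a _ => ?_
  have : (γ a / 2 : ℂ) = ((γ a / 2 : ℝ) : ℂ) := by push_cast; rfl
  rw [this, Complex.re_ofReal_mul, cayley_re]

theorem nodePoly_union {S S' : Finset ℂ} (h : Disjoint S S') (ρ : ℝ) :
    nodePoly (S ∪ S') ρ = nodePoly S ρ * nodePoly S' ρ := Finset.prod_union h

theorem herglotzPoly_union {S S' : Finset ℂ} (h : Disjoint S S') (γ : ℂ → ℝ) (ρ : ℝ) :
    herglotzPoly (S ∪ S') γ ρ =
      herglotzPoly S γ ρ * nodePoly S' ρ + nodePoly S ρ * herglotzPoly S' γ ρ := by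
  rw [herglotzPoly, Finset.sum_union h, herglotzPoly, herglotzPoly, Finset.sum_mul, Finset.mul_sum]
  congr 1
  · refine Finset.sum_congr rfl fun a ha => ?_
    have : (S ∪ S').erase a = S.erase a ∪ S' := by
      rw [Finset.erase_union_distrib, Finset.erase_eq_of_notMem (Finset.disjoint_left.1 h ha)]
    rw [this, nodePoly_union (h.mono_left (Finset.erase_subset _ _))]
    ring
  · refine Finset.sum_congr rfl fun a ha => ?_
    have : (S ∪ S').erase a = S ∪ S'.erase a := by
      rw [Finset.erase_union_distrib, Finset.erase_eq_of_notMem (Finset.disjoint_right.1 h ha)]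
    rw [this, nodePoly_union (h.mono_right (Finset.erase_subset _ _))]
    ring

theorem monic_nodePoly (S : Finset ℂ) (ρ : ℝ) : (nodePoly S ρ).Monic :=
  Polynomial.monic_prod_of_monic _ _ fun _ _ => Polynomial.monic_X_sub_C _

theorem natDegree_nodePoly (S : Finset ℂ) (ρ : ℝ) : (nodePoly S ρ).natDegree = S.card := by
  rw [nodePoly, Polynomial.natDegree_prod_of_monic _ _ fun _ _ => Polynomial.monic_X_sub_C _]
  simp only [Polynomial.natDegree_X_sub_C, Finset.sum_const, smul_eq_mul, mul_one]

theorem natDegree_sum_C_mul_le {S : Finset ℂ} {g : ℂ → ℂ} {m : ℂ → Polynomial ℂ} {n : ℕ}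
    (hm : ∀ a ∈ S, (m a).Monic ∧ (m a).natDegree = n) :
    (∑ a ∈ S, Polynomial.C (g a) * m a).natDegree ≤ n ∧
      (∑ a ∈ S, Polynomial.C (g a) * m a).coeff n = ∑ a ∈ S, g a := by
  constructor
  · refine Polynomial.natDegree_sum_le_of_forall_le _ _ fun a ha => ?_
    exact (Polynomial.natDegree_C_mul_le _ _).trans (hm a ha).2.le
  · rw [Polynomial.finsetSum_coeff]
    refine Finset.sum_congr rfl fun a ha => ?_
    rw [Polynomial.coeff_C_mul, ← (hm a ha).2, (hm a ha).1.coeff_natDegree, mul_one]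

theorem herglotzPoly_degree (S : Finset ℂ) (γ : ℂ → ℝ) (ρ : ℝ) :
    (herglotzPoly S γ ρ).natDegree ≤ S.card ∧
      (herglotzPoly S γ ρ).coeff S.card = ∑ a ∈ S, (γ a / 2 : ℂ) := by
  refine natDegree_sum_C_mul_le fun a ha => ?_
  have h1 : (Polynomial.X + Polynomial.C (ρ * a : ℂ)).Monic := Polynomial.monic_X_add_C _
  refine ⟨h1.mul (monic_nodePoly _ _), ?_⟩
  rw [h1.natDegree_mul (monic_nodePoly _ _), natDegree_nodePoly, Polynomial.natDegree_X_add_C,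
    Finset.card_erase_of_mem ha]
  have := Finset.card_pos.2 ⟨a, ha⟩
  omega

/-- The numerator of `∑ γ a / (z - a)`. -/
noncomputable def fracNumerator (S : Finset ℂ) (γ : ℂ → ℝ) : Polynomial ℂ :=
  ∑ a ∈ S, Polynomial.C (γ a : ℂ) * nodePoly (S.erase a) 1

theorem eval_fracNumerator {S : Finset ℂ} (γ : ℂ → ℝ) {z : ℂ} (h : ∀ a ∈ S, z ≠ a) :
    (fracNumerator S γ).eval z = (nodePoly S 1).eval z * ∑ a ∈ S, (γ a : ℂ) / (z - a) := by
  rw [fracNumerator, Polynomial.eval_finsetSum, Finset.mul_sum]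
  refine Finset.sum_congr rfl fun a ha => ?_
  have h1 := sub_ne_zero.2 (h a ha)
  rw [Polynomial.eval_mul, Polynomial.eval_C, eval_nodePoly, eval_nodePoly, ← Finset.mul_prod_erase S _ ha]
  simp only [Complex.ofReal_one, one_mul]
  field_simp

theorem fracNumerator_degree {S : Finset ℂ} {γ : ℂ → ℝ} (h : ∑ a ∈ S, γ a = -2) :
    (fracNumerator S γ).natDegree = S.card - 1 ∧ (fracNumerator S γ).leadingCoeff = -2 := by
  obtain ⟨h1, h2⟩ := natDegree_sum_C_mul_le (S := S) (g := fun a => (γ a : ℂ))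
    (m := fun a => nodePoly (S.erase a) 1) (n := S.card - 1) fun a ha =>
      ⟨monic_nodePoly _ _, by rw [natDegree_nodePoly, Finset.card_erase_of_mem ha]⟩
  have h3 : (fracNumerator S γ).coeff (S.card - 1) = -2 := by
    rw [fracNumerator, h2, ← Complex.ofReal_sum, h]
    push_cast; ring
  have h4 : (fracNumerator S γ).natDegree = S.card - 1 :=
    le_antisymm h1 (Polynomial.le_natDegree_of_ne_zero (by rw [h3]; norm_num))
  exact ⟨h4, by rw [Polynomial.leadingCoeff, h4, h3]⟩

/-- This is z/(z - a) = ½((z + a)/(z - a) + 1) summed with weights γ(a), after clearing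
denominators; the constant is ½ ∑ γ(a) = -1. -/
theorem X_mul_fracNumerator {S : Finset ℂ} {γ : ℂ → ℝ} (h : ∑ a ∈ S, γ a = -2) :
    Polynomial.X * fracNumerator S γ = herglotzPoly S γ 1 - nodePoly S 1 := by
  have h1 : nodePoly S 1 = -∑ a ∈ S, Polynomial.C (γ a / 2 : ℂ) *
      ((Polynomial.X - Polynomial.C a) * nodePoly (S.erase a) 1) := by
    have h2 : ∀ a ∈ S, Polynomial.C (γ a / 2 : ℂ) * ((Polynomial.X - Polynomial.C a) *
        nodePoly (S.erase a) 1) = Polynomial.C (γ a / 2 : ℂ) * nodePoly S 1 := by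
      intro a ha
      rw [nodePoly, nodePoly, ← Finset.mul_prod_erase S _ ha]
      simp
    rw [Finset.sum_congr rfl h2, ← Finset.sum_mul, ← map_sum, ← Finset.sum_div, ← Complex.ofReal_sum, h]
    simp
  rw [h1, sub_neg_eq_add, fracNumerator, herglotzPoly, ← Finset.sum_add_distrib, Finset.mul_sum]
  refine Finset.sum_congr rfl fun a _ => ?_
  have h3 : Polynomial.C (γ a : ℂ) = Polynomial.C (γ a / 2 : ℂ) + Polynomial.C (γ a / 2 : ℂ) := by
    rw [← map_add]; congr 1; ring
  rw [h3, Complex.ofReal_one, one_mul]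
  ring

/-- Off the nodes, dividing by the node polynomials leaves Φ - 1 + (1 - t)Ψ. On the circle Re Φ = 0,
since the nodes of Φ lie there, and Re Ψ ≤ 0, since Ψ has positive weights and nodes of modulus 1 +
t ≥ 1. So the real part is at most -1. Nodes on the circle are treated separately; those of S occur
only at t = 0. -/
theorem herglotz_sub_node_ne_zero_on_circle {S S' : Finset ℂ} {γ : ℂ → ℝ} (hd : Disjoint S S')
    (hS : ∀ a ∈ S, ‖a‖ = 1 ∧ 0 < γ a) (hS' : ∀ a ∈ S', ‖a‖ = 1 ∧ γ a < 0) {t : ℝ}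
    (ht : t ∈ Set.Icc (0 : ℝ) 1) {z : ℂ} (hz : ‖z‖ = 1) :
    (nodePoly S (1 + t) * (herglotzPoly S' γ 1 - nodePoly S' 1) +
      Polynomial.C ((1 - t : ℝ) : ℂ) * (nodePoly S' 1 * herglotzPoly S γ (1 + t))).eval z ≠ 0 := by
  have hne0 : ∀ a : ℂ, ‖a‖ = 1 → a ≠ 0 := by
    rintro a ha rfl; rw [norm_zero] at ha; norm_num at ha
  have hnorm : ∀ a : ℂ, ‖a‖ = 1 → ‖((1 + t : ℝ) : ℂ) * a‖ = 1 + t := by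
    intro a ha
    rw [norm_mul, ha, mul_one, Complex.norm_real, Real.norm_of_nonneg (by linarith [ht.1])]
  simp only [Polynomial.eval_add, Polynomial.eval_mul, Polynomial.eval_sub, Polynomial.eval_C]
  by_cases h1 : z ∈ S'
  · have h2 : (nodePoly S' 1).eval z = 0 := by
      rw [eval_nodePoly]
      exact Finset.prod_eq_zero h1 (by simp)
    rw [h2, sub_zero, zero_mul, mul_zero, add_zero]
    refine mul_ne_zero (eval_nodePoly_ne_zero fun a ha h3 => ?_) ?_
    · have h4 := hnorm a (hS a ha).1
      rw [← h3, hz] at h4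
      have ht0 : t = 0 := by linarith
      rw [ht0] at h3
      simp only [add_zero, Complex.ofReal_one, one_mul] at h3
      exact Finset.disjoint_left.1 hd ha (h3 ▸ h1)
    · have := eval_herglotzPoly_node_ne_zero one_ne_zero h1 (hne0 z hz) (hS' z h1).2.ne
      simpa using this
  · by_cases h2 : ∃ a ∈ S, z = ((1 + t : ℝ) : ℂ) * a
    · obtain ⟨a, ha, h3⟩ := h2
      have h4 := hnorm a (hS a ha).1
      rw [← h3, hz] at h4
      have ht0 : t = 0 := by linarith
      subst ht0
      have h5 : (nodePoly S (1 + 0)).eval z = 0 := by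
        rw [eval_nodePoly]
        exact Finset.prod_eq_zero ha (by rw [h3, sub_self])
      rw [h5, zero_mul, zero_add]
      refine mul_ne_zero (by norm_num) (mul_ne_zero (eval_nodePoly_ne_zero fun b hb h6 => ?_) ?_)
      · rw [Complex.ofReal_one, one_mul] at h6
        exact h1 (h6 ▸ hb)
      · rw [h3]
        exact eval_herglotzPoly_node_ne_zero (by norm_num) ha (hne0 a (hS a ha).1) (hS a ha).2.ne'
    · push Not at h2
      have h1' : ∀ a ∈ S', z ≠ ((1 : ℝ) : ℂ) * a := by
        intro a ha h
        rw [Complex.ofReal_one, one_mul] at h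
        exact h1 (h ▸ ha)
      rw [eval_herglotzPoly_eq_mul γ h1', eval_herglotzPoly_eq_mul γ h2]
      set Φ := ∑ a ∈ S', (γ a / 2 : ℂ) * ((z + ((1 : ℝ) : ℂ) * a) / (z - ((1 : ℝ) : ℂ) * a)) with hΦ
      set Ψ := ∑ a ∈ S, (γ a / 2 : ℂ) * ((z + ((1 + t : ℝ) : ℂ) * a) / (z - ((1 + t : ℝ) : ℂ) * a)) with hΨ
      have e1 : Φ.re = 0 := by
        rw [hΦ, re_sum_cayley]
        refine Finset.sum_eq_zero fun a ha => ?_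
        rw [hz, Complex.ofReal_one, one_mul, (hS' a ha).1, sub_self, zero_div, mul_zero]
      have e2 : Ψ.re ≤ 0 := by
        rw [hΨ, re_sum_cayley]
        refine Finset.sum_nonpos fun a ha => ?_
        refine mul_nonpos_of_nonneg_of_nonpos (by linarith [(hS a ha).2]) ?_
        refine div_nonpos_of_nonpos_of_nonneg ?_ (Complex.normSq_nonneg _)
        rw [hz, hnorm a (hS a ha).1]
        nlinarith [ht.1]
      have e3 : Φ - 1 + ((1 - t : ℝ) : ℂ) * Ψ ≠ 0 := by
        intro h
        have := congrArg Complex.re h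
        rw [Complex.add_re, Complex.sub_re, Complex.re_ofReal_mul, e1, Complex.one_re,
          Complex.zero_re] at this
        have : (1 - t) * Ψ.re ≤ 0 := mul_nonpos_of_nonneg_of_nonpos (by linarith [ht.2]) e2
        linarith
      have e4 := mul_ne_zero (mul_ne_zero (eval_nodePoly_ne_zero h2) (eval_nodePoly_ne_zero h1')) e3
      intro h
      apply e4
      rw [← h]
      ring

/-- The number of critical points in the disk. -/
theorem diskRootCount_herglotz {S S' : Finset ℂ} {γ : ℂ → ℝ} (hd : Disjoint S S')
    (hS : ∀ a ∈ S, ‖a‖ = 1 ∧ 0 < γ a) (hS' : ∀ a ∈ S', ‖a‖ = 1 ∧ γ a < 0) :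
    diskRootCount (herglotzPoly (S ∪ S') γ 1 - nodePoly (S ∪ S') 1) = S'.card := by
  set P : ℝ → Polynomial ℂ := fun t => nodePoly S (1 + t) * (herglotzPoly S' γ 1 - nodePoly S' 1) +
      Polynomial.C ((1 - t : ℝ) : ℂ) * (nodePoly S' 1 * herglotzPoly S γ (1 + t)) with hP
  have hc : Continuous fun x : ℝ × ℂ => (P x.1).eval x.2 := by
    simp only [hP, Polynomial.eval_add, Polynomial.eval_mul, Polynomial.eval_sub, Polynomial.eval_C,
      eval_nodePoly, eval_herglotzPoly]
    fun_prop
  have h1 := diskRootCount_eq_of_homotopy hc fun t ht z hz =>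
    herglotz_sub_node_ne_zero_on_circle hd hS hS' ht hz
  have hP0 : P 0 = herglotzPoly (S ∪ S') γ 1 - nodePoly (S ∪ S') 1 := by
    simp only [hP, add_zero, sub_zero, Complex.ofReal_one, map_one, one_mul]
    rw [herglotzPoly_union hd, nodePoly_union hd]
    ring
  -- At the end of the homotopy the positive nodes have modulus 2 and split off as a factor without
  -- roots in the disk.
  have hP1 : P 1 = nodePoly S (1 + 1) * (herglotzPoly S' γ 1 - nodePoly S' 1) := by
    simp [hP]
  rw [← hP0, h1, hP1]
  -- With only negative weights, Re Φ ≤ 0 for |z| ≥ 1, so Φ - 1 does not vanish there. All roots lie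
  -- in the disk and their number is the degree, whose top coefficient ½ ∑ γ(a) - 1 is nonzero.
  have hout : ∀ z : ℂ, 1 ≤ ‖z‖ → (herglotzPoly S' γ 1 - nodePoly S' 1).eval z ≠ 0 := by
    intro z hz
    rw [Polynomial.eval_sub]
    by_cases h2 : z ∈ S'
    · have h3 : (nodePoly S' 1).eval z = 0 := by
        rw [eval_nodePoly]
        exact Finset.prod_eq_zero h2 (by simp)
      have hz0 : z ≠ 0 := by rintro rfl; rw [norm_zero] at hz; norm_num at hz
      have := eval_herglotzPoly_node_ne_zero one_ne_zero h2 hz0 (hS' z h2).2.ne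
      rw [h3, sub_zero]
      simpa using this
    · have h2' : ∀ a ∈ S', z ≠ ((1 : ℝ) : ℂ) * a := by
        intro a ha h
        rw [Complex.ofReal_one, one_mul] at h
        exact h2 (h ▸ ha)
      rw [eval_herglotzPoly_eq_mul γ h2']
      set Φ := ∑ a ∈ S', (γ a / 2 : ℂ) * ((z + ((1 : ℝ) : ℂ) * a) / (z - ((1 : ℝ) : ℂ) * a)) with hΦ
      have e1 : Φ.re ≤ 0 := by
        rw [hΦ, re_sum_cayley]
        refine Finset.sum_nonpos fun a ha => ?_
        refine mul_nonpos_of_nonpos_of_nonneg (by linarith [(hS' a ha).2]) ?_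
        refine div_nonneg ?_ (Complex.normSq_nonneg _)
        rw [Complex.ofReal_one, one_mul, (hS' a ha).1]
        nlinarith
      have e2 : Φ - 1 ≠ 0 := by
        intro h
        have := congrArg Complex.re h
        rw [Complex.sub_re, Complex.one_re, Complex.zero_re] at this
        linarith
      have e3 := mul_ne_zero (eval_nodePoly_ne_zero h2') e2
      rwa [mul_sub, mul_one] at e3
  have hne : herglotzPoly S' γ 1 - nodePoly S' 1 ≠ 0 := by
    intro h
    exact hout 1 (by simp) (by rw [h, Polynomial.eval_zero])
  rw [diskRootCount_mul (mul_ne_zero (monic_nodePoly _ _).ne_zero hne), diskRootCount_eq_zero, zero_add,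
    diskRootCount_eq_natDegree hout]
  · obtain ⟨d1, d2⟩ := herglotzPoly_degree S' γ 1
    have hn := natDegree_nodePoly S' 1
    refine le_antisymm ?_ (Polynomial.le_natDegree_of_ne_zero ?_)
    · exact (Polynomial.natDegree_sub_le _ _).trans (max_le d1 hn.le)
    · have hm : (nodePoly S' 1).coeff S'.card = 1 := by
        rw [← hn, (monic_nodePoly _ _).coeff_natDegree]
      rw [Polynomial.coeff_sub, d2, hm]
      intro h
      have h3 := congrArg Complex.re h
      rw [Complex.sub_re, Complex.re_sum, Complex.one_re, Complex.zero_re] at h3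
      have h4 : ∑ a ∈ S', (γ a / 2 : ℂ).re ≤ 0 := by
        refine Finset.sum_nonpos fun a ha => ?_
        have : (γ a / 2 : ℂ) = ((γ a / 2 : ℝ) : ℂ) := by push_cast; rfl
        rw [this, Complex.ofReal_re]
        linarith [(hS' a ha).2]
      linarith
  · intro z hz
    refine eval_nodePoly_ne_zero fun a ha h => ?_
    rw [h, norm_mul, (hS a ha).1, Complex.norm_real] at hz
    norm_num at hz


/-! ### Reflection of the polynomials in the unit circle -/

theorem conj_sub_of_norm_one {z a : ℂ} (hz : ‖z‖ = 1) (ha : ‖a‖ = 1) :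
    (starRingEnd ℂ) (z - a) = -(z * a)⁻¹ * (z - a) ∧ (starRingEnd ℂ) (z + a) = (z * a)⁻¹ * (z + a) := by
  have hz0 : z ≠ 0 := by rintro rfl; rw [norm_zero] at hz; norm_num at hz
  have ha0 : a ≠ 0 := by rintro rfl; rw [norm_zero] at ha; norm_num at ha
  rw [map_sub, map_add, ← Complex.inv_eq_conj hz, ← Complex.inv_eq_conj ha]
  constructor
  · field_simp; ring
  · field_simp; ring

/-- The numerator of `∑ γ a z / (z - a) + 2`, the reflection of `fracNumerator` in the circle. -/
noncomputable def reflectedNumerator (S : Finset ℂ) (γ : ℂ → ℝ) : Polynomial ℂ :=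
  herglotzPoly S γ 1 + nodePoly S 1

theorem reflectedNumerator_eq {S : Finset ℂ} {γ : ℂ → ℝ} (h : ∑ a ∈ S, γ a = -2) (z : ℂ) :
    (reflectedNumerator S γ).eval z = z * (fracNumerator S γ).eval z + 2 * (nodePoly S 1).eval z := by
  have := congrArg (Polynomial.eval z) (X_mul_fracNumerator h)
  rw [Polynomial.eval_mul, Polynomial.eval_X, Polynomial.eval_sub] at this
  rw [reflectedNumerator, Polynomial.eval_add, this]
  ring

/-- On the circle conj D = wD with w = ∏ -(za)⁻¹, while conj H = -wH because each Cayley quotient is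
imaginary. So conjugation takes H - D = zN to -w(H + D). -/
theorem exists_reflectedNumerator_eq {S : Finset ℂ} {γ : ℂ → ℝ} (hS : ∀ a ∈ S, ‖a‖ = 1)
    (h : ∑ a ∈ S, γ a = -2) : ∃ c : ℂ, ‖c‖ = 1 ∧ ∀ z : ℂ, ‖z‖ = 1 →
      (reflectedNumerator S γ).eval z = c * z ^ (S.card - 1) * (starRingEnd ℂ) ((fracNumerator S γ).eval z) := by
  have hcard : 0 < S.card := by
    rw [Finset.card_pos]
    by_contra hne
    rw [Finset.not_nonempty_iff_eq_empty] at hne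
    rw [hne, Finset.sum_empty] at h
    norm_num at h
  refine ⟨-∏ a ∈ S, -a, ?_, fun z hz => ?_⟩
  · rw [norm_neg, norm_prod]
    exact Finset.prod_eq_one fun a ha => by rw [norm_neg, hS a ha]
  have hz0 : z ≠ 0 := by rintro rfl; rw [norm_zero] at hz; norm_num at hz
  have ha0 : ∀ a ∈ S, a ≠ 0 := by
    rintro a ha rfl; have := hS _ ha; rw [norm_zero] at this; norm_num at this
  set w := ∏ a ∈ S, -(z * a)⁻¹ with hw
  have hD : (starRingEnd ℂ) ((nodePoly S 1).eval z) = w * (nodePoly S 1).eval z := by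
    rw [eval_nodePoly, map_prod, hw, ← Finset.prod_mul_distrib]
    refine Finset.prod_congr rfl fun a ha => ?_
    rw [Complex.ofReal_one, one_mul, (conj_sub_of_norm_one hz (hS a ha)).1]
  have hH : (starRingEnd ℂ) ((herglotzPoly S γ 1).eval z) = -w * (herglotzPoly S γ 1).eval z := by
    rw [eval_herglotzPoly, map_sum, Finset.mul_sum]
    refine Finset.sum_congr rfl fun a ha => ?_
    have h1 : (starRingEnd ℂ) (γ a / 2 : ℂ) = (γ a / 2 : ℂ) := by
      rw [map_div₀, Complex.conj_ofReal, map_ofNat]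
    have h2 : (starRingEnd ℂ) (∏ b ∈ S.erase a, (z - ((1 : ℝ) : ℂ) * b)) =
        (∏ b ∈ S.erase a, -(z * b)⁻¹) * ∏ b ∈ S.erase a, (z - ((1 : ℝ) : ℂ) * b) := by
      rw [map_prod, ← Finset.prod_mul_distrib]
      refine Finset.prod_congr rfl fun b hb => ?_
      rw [Complex.ofReal_one, one_mul, (conj_sub_of_norm_one hz (hS b (Finset.mem_of_mem_erase hb))).1]
    rw [map_mul, map_mul, h1, h2, Complex.ofReal_one, one_mul, (conj_sub_of_norm_one hz (hS a ha)).2, hw,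
      ← Finset.mul_prod_erase S _ ha]
    ring
  have hN := congrArg (Polynomial.eval z) (X_mul_fracNumerator h)
  rw [Polynomial.eval_mul, Polynomial.eval_X, Polynomial.eval_sub] at hN
  have hN' := congrArg (starRingEnd ℂ) hN
  rw [map_mul, map_sub, hD, hH, ← Complex.inv_eq_conj hz] at hN'
  have hwz : (∏ a ∈ S, -a) * z ^ S.card * w = 1 := by
    rw [hw, ← Finset.prod_const, ← Finset.prod_mul_distrib, ← Finset.prod_mul_distrib]
    refine Finset.prod_eq_one fun a ha => ?_
    have := ha0 a ha
    field_simp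
  have hpow : z ^ S.card * z⁻¹ = z ^ (S.card - 1) := by
    obtain ⟨n, hn⟩ := Nat.exists_eq_add_of_lt hcard
    rw [hn, zero_add, Nat.add_sub_cancel, pow_succ, mul_assoc, mul_inv_cancel₀ hz0, mul_one]
  rw [reflectedNumerator, Polynomial.eval_add, ← hpow]
  linear_combination (∏ a ∈ S, -a) * z ^ S.card * hN' - hwz * ((herglotzPoly S γ 1).eval z + (nodePoly S 1).eval z)

theorem infinite_unit_circle : {z : ℂ | ‖z‖ = 1}.Infinite := by
  refine Set.infinite_of_injective_forall_mem (f := fun n : ℕ => Complex.exp (((1 / (n + 1) : ℝ) : ℂ) * Complex.I))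
    ?_ fun n => norm_exp_real_mul_I _
  intro n m hnm
  obtain ⟨j, hj⟩ := exp_eq_exp_iff_real hnm
  have h1 : ∀ n : ℕ, 0 < (1 / (n + 1) : ℝ) ∧ (1 / (n + 1) : ℝ) ≤ 1 := fun n =>
    ⟨by positivity, by rw [div_le_one (by positivity)]; linarith [n.cast_nonneg (α := ℝ)]⟩
  have hj0 : j = 0 := by
    by_contra hne
    have h2 : (1 : ℝ) ≤ |(j : ℝ)| := by exact_mod_cast Int.one_le_abs hne
    have h3 : |(j : ℝ) * (2 * Real.pi)| < 2 := by
      rw [abs_lt]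
      constructor <;> linarith [h1 n, h1 m]
    rw [abs_mul, abs_of_pos (by positivity : 0 < 2 * Real.pi)] at h3
    have := Real.pi_gt_three
    nlinarith
  rw [hj0, Int.cast_zero, zero_mul, add_zero] at hj
  rw [one_div, one_div] at hj
  have h4 := inv_injective hj
  exact_mod_cast (add_right_cancel h4)

theorem norm_eq_of_circle {S : Finset ℂ} {γ : ℂ → ℝ} (hS : ∀ a ∈ S, ‖a‖ = 1) (h : ∑ a ∈ S, γ a = -2)
    {z : ℂ} (hz : ‖z‖ = 1) : ‖(reflectedNumerator S γ).eval z‖ = ‖(fracNumerator S γ).eval z‖ := by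
  obtain ⟨c, hc, h1⟩ := exists_reflectedNumerator_eq hS h
  rw [h1 z hz, norm_mul, norm_mul, norm_pow, hz, hc, one_pow, one_mul, one_mul, RCLike.norm_conj]

theorem eval_fracNumerator_eq_prod {S : Finset ℂ} {γ : ℂ → ℝ} (h : ∑ a ∈ S, γ a = -2) (z : ℂ) :
    (fracNumerator S γ).eval z = -2 * ((fracNumerator S γ).roots.map fun r => z - r).prod := by
  have h1 := (IsAlgClosed.splits (fracNumerator S γ)).eq_prod_roots
  conv_lhs => rw [h1]
  rw [Polynomial.eval_mul, Polynomial.eval_C, (fracNumerator_degree h).2, Polynomial.eval_multiset_prod,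
    Multiset.map_map]
  simp

/-- Since z conj(z - r) = 1 - conj(r) z on the circle, the reflection formula turns each root factor
of N into one of these. Polynomials that agree on the circle are equal. -/
theorem exists_reflectedNumerator_eq_prod {S : Finset ℂ} {γ : ℂ → ℝ} (hS : ∀ a ∈ S, ‖a‖ = 1)
    (h : ∑ a ∈ S, γ a = -2) : ∃ c : ℂ, ‖c‖ = 1 ∧ reflectedNumerator S γ = Polynomial.C (-2 * c) *
      ((fracNumerator S γ).roots.map fun r =>
        1 - Polynomial.C ((starRingEnd ℂ) r) * Polynomial.X).prod := by
  obtain ⟨c, hc, h1⟩ := exists_reflectedNumerator_eq hS h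
  refine ⟨c, hc, Polynomial.eq_of_infinite_eval_eq _ _ (infinite_unit_circle.mono fun z hz => ?_)⟩
  have hz1 : ‖z‖ = 1 := hz
  have hz0 : z ≠ 0 := by rintro rfl; rw [norm_zero] at hz1; norm_num at hz1
  have hcard : (fracNumerator S γ).roots.card = S.card - 1 := by
    rw [← (IsAlgClosed.splits _).natDegree_eq_card_roots, (fracNumerator_degree h).1]
  change (reflectedNumerator S γ).eval z = Polynomial.eval z _
  rw [h1 z hz1, eval_fracNumerator_eq_prod h, map_mul, map_multiset_prod, Multiset.map_map,
    Polynomial.eval_mul, Polynomial.eval_C, Polynomial.eval_multiset_prod, Multiset.map_map, ← hcard]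
  have h2 : z ^ (fracNumerator S γ).roots.card =
      ((fracNumerator S γ).roots.map fun _ => z).prod := by
    rw [Multiset.map_const', Multiset.prod_replicate]
  have h3 : ((fracNumerator S γ).roots.map fun _ => z).prod *
      ((fracNumerator S γ).roots.map ((starRingEnd ℂ) ∘ fun r => z - r)).prod =
      ((fracNumerator S γ).roots.map (Polynomial.eval z ∘ fun r =>
        1 - Polynomial.C ((starRingEnd ℂ) r) * Polynomial.X)).prod := by
    rw [← Multiset.prod_map_mul]
    congr 1
    refine Multiset.map_congr rfl fun r _ => ?_
    simp only [Function.comp_apply, map_sub, Polynomial.eval_sub, Polynomial.eval_one, Polynomial.eval_mul,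
      Polynomial.eval_C, Polynomial.eval_X]
    rw [← Complex.inv_eq_conj hz1, mul_sub, mul_inv_cancel₀ hz0]
    ring
  rw [← h3, h2]
  have h4 : (starRingEnd ℂ) (-2 : ℂ) = -2 := by rw [map_neg, map_ofNat]
  rw [h4]
  ring

theorem diskRootCount_one_sub {r : ℂ} (hr : ‖r‖ ≠ 1) :
    diskRootCount (1 - Polynomial.C ((starRingEnd ℂ) r) * Polynomial.X) = if 1 < ‖r‖ then 1 else 0 := by
  have hev : ∀ z : ℂ, (1 - Polynomial.C ((starRingEnd ℂ) r) * Polynomial.X).eval z =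
      1 - (starRingEnd ℂ) r * z := fun z => by simp
  have hz1 : ∀ z : ℂ, (1 - Polynomial.C ((starRingEnd ℂ) r) * Polynomial.X).eval z = 0 → ‖r‖ * ‖z‖ = 1 := by
    intro z hz
    rw [hev, sub_eq_zero] at hz
    rw [← RCLike.norm_conj r, ← norm_mul, ← hz, norm_one]
  split_ifs with h
  · rw [diskRootCount_eq_natDegree fun z hz h0 => ?_]
    · rw [Polynomial.natDegree_sub_eq_right_of_natDegree_lt] <;>
      rw [Polynomial.natDegree_C_mul_X _ (by
        rw [Ne, map_eq_zero]; rintro rfl; rw [norm_zero] at h; linarith)]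
      rw [Polynomial.natDegree_one]
      exact one_pos
    · have := hz1 z h0
      nlinarith
  · refine diskRootCount_eq_zero fun z hz h0 => ?_
    have := hz1 z h0
    have h2 : ‖r‖ < 1 := lt_of_le_of_ne (not_lt.1 h) hr
    nlinarith [norm_nonneg z, norm_nonneg r]

theorem one_sub_ne_zero (r : ℂ) : (1 - Polynomial.C r * Polynomial.X : Polynomial ℂ) ≠ 0 := by
  intro h
  have := congrArg (Polynomial.eval 0) h
  simp at this

theorem diskRootCount_prod_one_sub (s : Multiset ℂ) (hs : ∀ r ∈ s, ‖r‖ ≠ 1) :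
    diskRootCount (s.map fun r => 1 - Polynomial.C ((starRingEnd ℂ) r) * Polynomial.X).prod =
      s.countP fun r => 1 < ‖r‖ := by
  induction s using Multiset.induction_on with
  | empty => simp [diskRootCount]
  | cons w s ih =>
    rw [Multiset.map_cons, Multiset.prod_cons, diskRootCount_mul, diskRootCount_one_sub
      (hs w (Multiset.mem_cons_self w s)), ih fun v hv => hs v (Multiset.mem_cons_of_mem hv),
      Multiset.countP_cons, add_comm]
    refine mul_ne_zero (one_sub_ne_zero _) ?_
    rw [Ne, Multiset.prod_eq_zero_iff, Multiset.mem_map]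
    rintro ⟨r, -, hr⟩
    exact one_sub_ne_zero _ hr

/-- The roots of the reflected polynomial in the disk are the reflections of the roots of N outside
it. None lie on the circle, and N has `S.card - 1` roots in all. -/
theorem diskRootCount_reflectedNumerator {S : Finset ℂ} {γ : ℂ → ℝ} (hS : ∀ a ∈ S, ‖a‖ = 1)
    (h : ∑ a ∈ S, γ a = -2) (hN : ∀ z : ℂ, ‖z‖ = 1 → (fracNumerator S γ).eval z ≠ 0) :
    diskRootCount (fracNumerator S γ) + diskRootCount (reflectedNumerator S γ) + 1 = S.card := by
  obtain ⟨c, hc, hq⟩ := exists_reflectedNumerator_eq_prod hS h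
  have hc0 : c ≠ 0 := by rintro rfl; rw [norm_zero] at hc; norm_num at hc
  have hr : ∀ r ∈ (fracNumerator S γ).roots, ‖r‖ ≠ 1 := fun r hr h1 =>
    hN r h1 (Polynomial.isRoot_of_mem_roots hr)
  have hcard : (fracNumerator S γ).roots.card = S.card - 1 := by
    rw [← (IsAlgClosed.splits _).natDegree_eq_card_roots, (fracNumerator_degree h).1]
  have hpos : 0 < S.card := by
    rw [Finset.card_pos]
    by_contra hne
    rw [Finset.not_nonempty_iff_eq_empty] at hne
    rw [hne, Finset.sum_empty] at h
    norm_num at h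
  rw [hq, diskRootCount_C_mul (mul_ne_zero (by norm_num) hc0), diskRootCount_prod_one_sub _ hr, diskRootCount]
  have h1 := Multiset.card_eq_countP_add_countP (fun z : ℂ => ‖z‖ < 1) (fracNumerator S γ).roots
  have h2 : (fracNumerator S γ).roots.countP (fun z => ¬ ‖z‖ < 1) =
      (fracNumerator S γ).roots.countP (fun r => 1 < ‖r‖) := by
    refine Multiset.countP_congr rfl fun r hr' => ?_
    rw [not_lt]
    exact propext ⟨fun h => lt_of_le_of_ne h (hr r hr').symm, le_of_lt⟩
  rw [h2] at h1
  omega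

/-! ### Blaschke products -/

theorem exists_fin_enum (s : Multiset ℂ) : ∃ a : Fin s.card → ℂ, (∀ j, a j ∈ s) ∧
    ∀ g : ℂ → ℂ, (s.map g).prod = ∏ j, g (a j) := by
  induction s using Multiset.induction_on with
  | empty =>
    have : IsEmpty (Fin (Multiset.card (0 : Multiset ℂ))) := by rw [Multiset.card_zero]; infer_instance
    exact ⟨fun _ => 0, fun j => isEmptyElim j, fun g => (Fintype.prod_empty _).symm⟩
  | cons w s ih =>
    obtain ⟨a, ha, hg⟩ := ih
    have h1 : s.card + 1 = (w ::ₘ s).card := (Multiset.card_cons w s).symm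
    refine ⟨fun j => (Fin.cons w a : Fin (s.card + 1) → ℂ) (Fin.cast h1.symm j), fun j => ?_, fun g => ?_⟩
    · refine Fin.cases (motive := fun i => (Fin.cons w a : Fin (s.card + 1) → ℂ) i ∈ w ::ₘ s) ?_ ?_ _
      · exact Multiset.mem_cons_self w s
      · intro i
        rw [Fin.cons_succ]
        exact Multiset.mem_cons_of_mem (ha i)
    · rw [Multiset.map_cons, Multiset.prod_cons, hg,
        ← Equiv.prod_comp (finCongr h1) fun j => g ((Fin.cons w a : Fin (s.card + 1) → ℂ) (Fin.cast h1.symm j)),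
        Fin.prod_univ_succ]
      simp

/-- Roots r of N inside the disk are the zeros of `Bk`; roots w outside reflect to the zeros
1/conj(w) of `Bm`. The common factor G collects the factors 1 - conj(r) z and z - w, which do not
vanish in the disk; the unimodular factors conj(w)/w go to `Bm`. -/
theorem exists_blaschke_factorization {S : Finset ℂ} {γ : ℂ → ℝ} (hS : ∀ a ∈ S, ‖a‖ = 1)
    (h : ∑ a ∈ S, γ a = -2) (hN : ∀ z : ℂ, ‖z‖ = 1 → (fracNumerator S γ).eval z ≠ 0) :
    ∃ Bk Bm G : ℂ → ℂ, IsFiniteBlaschkeProduct (diskRootCount (fracNumerator S γ)) Bk ∧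
      IsFiniteBlaschkeProduct (diskRootCount (reflectedNumerator S γ)) Bm ∧
      ∀ z ∈ Metric.ball (0 : ℂ) 1, G z ≠ 0 ∧ (fracNumerator S γ).eval z = G z * Bk z ∧
        (reflectedNumerator S γ).eval z = G z * Bm z := by
  obtain ⟨c, hc, hq⟩ := exists_reflectedNumerator_eq_prod hS h
  set s := (fracNumerator S γ).roots with hs
  have hr : ∀ r ∈ s, ‖r‖ ≠ 1 := fun r hr h1 => hN r h1 (Polynomial.isRoot_of_mem_roots hr)
  set i := s.filter fun r => ‖r‖ < 1 with hi
  set o := s.filter fun r => ¬ ‖r‖ < 1 with ho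
  have hsplit : i + o = s := Multiset.filter_add_not _ _
  have hin : ∀ r ∈ i, ‖r‖ < 1 := fun r hr => (Multiset.mem_filter.1 hr).2
  have hout : ∀ r ∈ o, 1 < ‖r‖ := fun r hr' => by
    obtain ⟨h1, h2⟩ := Multiset.mem_filter.1 hr'
    exact lt_of_le_of_ne (not_lt.1 h2) (hr r h1).symm
  have hicard : i.card = diskRootCount (fracNumerator S γ) := by
    rw [hi, diskRootCount, Multiset.countP_eq_card_filter]
  have hocard : o.card = diskRootCount (reflectedNumerator S γ) := by
    have h1 := diskRootCount_reflectedNumerator hS h hN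
    have h2 : s.card = S.card - 1 := by
      rw [hs, ← (IsAlgClosed.splits _).natDegree_eq_card_roots, (fracNumerator_degree h).1]
    have h3 : i.card + o.card = s.card := by rw [← Multiset.card_add, hsplit]
    omega
  obtain ⟨a, ha, hga⟩ := exists_fin_enum i
  obtain ⟨b, hb, hgb⟩ := exists_fin_enum o
  set σ := starRingEnd ℂ with hσ
  refine ⟨fun z => (i.map fun r => (z - r) / (1 - σ r * z)).prod,
    fun z => c * (o.map fun w => σ w / w).prod * (o.map fun w => (z - (σ w)⁻¹) / (1 - σ (σ w)⁻¹ * z)).prod,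
    fun z => -2 * (i.map fun r => 1 - σ r * z).prod * (o.map fun w => z - w).prod, ?_, ?_, ?_⟩
  · rw [← hicard]
    refine ⟨1, a, norm_one, fun j => hin _ (ha j), fun z _ => ?_⟩
    rw [one_mul]
    exact hga _
  · rw [← hocard]
    refine ⟨c * (o.map fun w => σ w / w).prod, fun j => (σ (b j))⁻¹, ?_, fun j => ?_, fun z _ => ?_⟩
    · rw [norm_mul, hc, one_mul, hgb, norm_prod]
      refine Finset.prod_eq_one fun j _ => ?_
      have := hout _ (hb j)
      rw [norm_div, hσ, RCLike.norm_conj, div_self (by linarith)]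
    · have := hout _ (hb j)
      rw [norm_inv, hσ, RCLike.norm_conj]
      exact inv_lt_one_of_one_lt₀ this
    · exact congrArg (fun t => c * (o.map fun w => σ w / w).prod * t)
        (hgb fun w => (z - (σ w)⁻¹) / (1 - σ (σ w)⁻¹ * z))
  · intro z hz
    rw [mem_ball_zero_iff] at hz
    have h1 : ∀ r ∈ i, 1 - σ r * z ≠ 0 := by
      intro r hr' h0
      have h2 : ‖r‖ * ‖z‖ = 1 := by
        rw [← RCLike.norm_conj r, ← norm_mul, ← hσ, ← sub_eq_zero.1 h0, norm_one]
      nlinarith [hin r hr', norm_nonneg r, norm_nonneg z]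
    have h2 : ∀ w ∈ o, z - w ≠ 0 := by
      intro w hw h0
      have := hout w hw
      rw [← sub_eq_zero.1 h0] at this
      linarith
    refine ⟨mul_ne_zero (mul_ne_zero (by norm_num) ?_) ?_, ?_, ?_⟩
    · rw [Ne, Multiset.prod_eq_zero_iff, Multiset.mem_map]
      rintro ⟨r, hr', h0⟩
      exact h1 r hr' h0
    · rw [Ne, Multiset.prod_eq_zero_iff, Multiset.mem_map]
      rintro ⟨w, hw, h0⟩
      exact h2 w hw h0
    · rw [eval_fracNumerator_eq_prod h, ← hs, ← hsplit, Multiset.map_add, Multiset.prod_add]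
      have h3 : (i.map fun r => 1 - σ r * z).prod * (i.map fun r => (z - r) / (1 - σ r * z)).prod =
          (i.map fun r => z - r).prod := by
        rw [← Multiset.prod_map_mul]
        congr 1
        refine Multiset.map_congr rfl fun r hr' => ?_
        rw [mul_div_cancel₀ _ (h1 r hr')]
      rw [← h3]
      ring
    · rw [hq, ← hsplit, Multiset.map_add, Multiset.prod_add, Polynomial.eval_mul, Polynomial.eval_C,
        Polynomial.eval_mul, Polynomial.eval_multiset_prod, Polynomial.eval_multiset_prod, Multiset.map_map,
        Multiset.map_map]
      have h3 : (i.map (Polynomial.eval z ∘ fun r => 1 - Polynomial.C (σ r) * Polynomial.X)) =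
          i.map fun r => 1 - σ r * z := Multiset.map_congr rfl fun r _ => by simp
      have h4 : (o.map (Polynomial.eval z ∘ fun r => 1 - Polynomial.C (σ r) * Polynomial.X)).prod =
          (o.map fun w => z - w).prod * ((o.map fun w => σ w / w).prod *
            (o.map fun w => (z - (σ w)⁻¹) / (1 - σ (σ w)⁻¹ * z)).prod) := by
        rw [← Multiset.prod_map_mul, ← Multiset.prod_map_mul]
        congr 1
        refine Multiset.map_congr rfl fun w hw => ?_
        have hw0 : w ≠ 0 := by
          rintro rfl; have := hout _ hw; rw [norm_zero] at this; linarith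
        have hw1 : σ w ≠ 0 := by rw [hσ, Ne, map_eq_zero]; exact hw0
        have h5 : σ (σ w)⁻¹ = w⁻¹ := by rw [map_inv₀, hσ, Complex.conj_conj]
        have h6 : 1 - w⁻¹ * z ≠ 0 := by
          intro h0
          have : z - w = -w * (1 - w⁻¹ * z) := by field_simp; ring
          exact h2 w hw (by rw [this, h0, mul_zero])
        have h7 : w - z ≠ 0 := by rw [← neg_sub]; exact neg_ne_zero.2 (h2 w hw)
        simp only [Function.comp_apply, Polynomial.eval_sub, Polynomial.eval_one, Polynomial.eval_mul,
          Polynomial.eval_C, Polynomial.eval_X]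
        rw [h5]
        have h8 : 1 - w⁻¹ * z = (w - z) / w := by field_simp
        rw [h8]
        field_simp
        ring
      rw [h3, h4]
      ring


/-! ### Counting the values of the pole -/

theorem analyticOrderAt_eq_rootMultiplicity {p : Polynomial ℂ} (hp : p ≠ 0) {φ h : ℂ → ℂ} {z : ℂ}
    (hh : AnalyticAt ℂ h z) (hz : h z ≠ 0) (he : ∀ᶠ w in 𝓝 z, φ w = p.eval w * h w) :
    analyticOrderAt φ z = p.rootMultiplicity z := by
  obtain ⟨q, hq, hdvd⟩ := Polynomial.exists_eq_pow_rootMultiplicity_mul_and_not_dvd p hp z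
  have hqz : q.eval z ≠ 0 := fun h0 => hdvd (Polynomial.dvd_iff_isRoot.2 h0)
  have hqa : AnalyticAt ℂ (fun w => q.eval w) z := q.differentiable.analyticAt z
  have hψ : AnalyticAt ℂ (fun w => p.eval w * h w) z := (p.differentiable.analyticAt z).mul hh
  have hφ : AnalyticAt ℂ φ z := hψ.congr (by filter_upwards [he] with w hw using hw.symm)
  rw [hφ.analyticOrderAt_eq_natCast]
  refine ⟨fun w => q.eval w * h w, hqa.mul hh, mul_ne_zero hqz hz, ?_⟩
  filter_upwards [he] with w hw
  rw [hw]
  conv_lhs => rw [hq]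
  simp only [Polynomial.eval_mul, Polynomial.eval_pow, Polynomial.eval_sub, Polynomial.eval_X,
    Polynomial.eval_C, smul_eq_mul]
  ring

theorem takesValueExactly_of_polynomial {g : ℂ → OnePoint ℂ} {b : OnePoint ℂ} {p : Polynomial ℂ} (hp : p ≠ 0)
    (hz : ∀ z ∈ Metric.ball (0 : ℂ) 1, g z = b ↔ p.eval z = 0)
    (hm : ∀ z ∈ Metric.ball (0 : ℂ) 1, p.eval z = 0 → valueMultiplicity g b z = p.rootMultiplicity z) :
    TakesValueExactly g (Metric.ball 0 1) b (diskRootCount p) := by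
  constructor
  · refine p.roots.toFinset.finite_toSet.subset ?_
    rintro z ⟨hzb, hzg⟩
    rw [Finset.mem_coe, Multiset.mem_toFinset, Polynomial.mem_roots hp]
    exact (hz z hzb).1 hzg
  · set s := p.roots.filter fun z => ‖z‖ < 1 with hs
    have h1 : ∀ z ∈ Metric.ball (0 : ℂ) 1, valueMultiplicity g b z = ((s.count z : ℕ) : ℕ∞) := by
      intro z hzb
      have e : Multiset.count z (p.roots.filter fun z => ‖z‖ < 1) = Multiset.count z p.roots :=
        Multiset.count_filter_of_pos (p := fun z : ℂ => ‖z‖ < 1) (mem_ball_zero_iff.1 hzb)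
      rw [hs, e, Polynomial.count_roots]
      by_cases h : p.eval z = 0
      · exact hm z hzb h
      · rw [Polynomial.rootMultiplicity_eq_zero h, valueMultiplicity, if_neg (fun h' => h ((hz z hzb).1 h'))]
        rfl
    rw [finsum_mem_congr rfl h1, finsum_mem_eq_sum_of_inter_support_eq (t := s.toFinset),
      ← Nat.cast_sum, Multiset.toFinset_sum_count_eq, diskRootCount, Multiset.countP_eq_card_filter]
    ext z
    simp only [Set.mem_inter_iff, Function.mem_support, Finset.mem_coe, Multiset.mem_toFinset]
    constructor
    · rintro ⟨-, h2⟩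
      exact ⟨Multiset.count_ne_zero.1 (by exact_mod_cast h2), h2⟩
    · rintro ⟨h2, h3⟩
      exact ⟨mem_ball_zero_iff.2 (Multiset.mem_filter.1 h2).2, h3⟩

/-- Data of the pole of the best Möbius approximation in terms of the polynomials `N` and `q`. -/
theorem bmaPole_eq {f : ℂ → ℂ} {N D q : Polynomial ℂ} {z : ℂ} (hf : deriv f z ≠ 0) (hD : D.eval z ≠ 0)
    (hF : deriv (deriv f) z / deriv f z = N.eval z / D.eval z)
    (hq : q.eval z = z * N.eval z + 2 * D.eval z) :
    (N.eval z = 0 → bmaPole f z = OnePoint.infty) ∧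
      (N.eval z ≠ 0 → bmaPole f z = ((q.eval z / N.eval z : ℂ) : OnePoint ℂ)) := by
  have h2 : deriv (deriv f) z = N.eval z / D.eval z * deriv f z := by
    rw [← hF, div_mul_cancel₀ _ hf]
  constructor
  · intro h
    rw [bmaPole, if_pos (by rw [h2, h, zero_div, zero_mul])]
  · intro h
    rw [bmaPole, if_neg (by rw [h2]; exact mul_ne_zero (div_ne_zero h hD) hf), h2, hq]
    congr 1
    field_simp

/-- Since N and q have no common zero in the disk, N is nonzero wherever q - bN vanishes. Dividing
by N is then harmless for multiplicities. -/
theorem takesValueExactly_bmaPole {f : ℂ → ℂ} {N q : Polynomial ℂ}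
    (h0 : ∀ z ∈ Metric.ball (0 : ℂ) 1, N.eval z = 0 → bmaPole f z = OnePoint.infty)
    (h1 : ∀ z ∈ Metric.ball (0 : ℂ) 1, N.eval z ≠ 0 →
      bmaPole f z = ((q.eval z / N.eval z : ℂ) : OnePoint ℂ))
    (hc : ∀ z ∈ Metric.ball (0 : ℂ) 1, N.eval z = 0 → q.eval z ≠ 0)
    {b : ℂ} (hp : q - Polynomial.C b * N ≠ 0) :
    TakesValueExactly (bmaPole f) (Metric.ball 0 1) b (diskRootCount (q - Polynomial.C b * N)) := by
  have hev : ∀ z, (q - Polynomial.C b * N).eval z = q.eval z - b * N.eval z := fun z => by simp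
  have hz : ∀ z ∈ Metric.ball (0 : ℂ) 1,
      bmaPole f z = (b : OnePoint ℂ) ↔ (q - Polynomial.C b * N).eval z = 0 := by
    intro z hz
    rw [hev]
    by_cases hN : N.eval z = 0
    · rw [h0 z hz hN, hN, mul_zero, sub_zero]
      exact ⟨fun h => absurd h (OnePoint.infty_ne_coe b), fun h => absurd h (hc z hz hN)⟩
    · rw [h1 z hz hN, OnePoint.coe_eq_coe, div_eq_iff hN, sub_eq_zero]
  refine takesValueExactly_of_polynomial hp hz fun z hzb h => ?_
  have hN : N.eval z ≠ 0 := by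
    intro hN
    rw [hev, hN, mul_zero, sub_zero] at h
    exact hc z hzb hN h
  rw [valueMultiplicity, if_pos ((hz z hzb).2 h), if_neg (OnePoint.coe_ne_infty b)]
  have hNa : AnalyticAt ℂ (fun w => N.eval w) z := N.differentiable.analyticAt z
  refine analyticOrderAt_eq_rootMultiplicity hp (hNa.inv hN) (inv_ne_zero hN) ?_
  filter_upwards [Metric.isOpen_ball.mem_nhds hzb, hNa.continuousAt.eventually_ne hN] with w hw hw'
  rw [h1 w hw hw', hev]
  change q.eval w / N.eval w - b = _ * (N.eval w)⁻¹
  field_simp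

theorem takesValueExactly_bmaPole_infty {f : ℂ → ℂ} {N q : Polynomial ℂ}
    (h0 : ∀ z ∈ Metric.ball (0 : ℂ) 1, N.eval z = 0 → bmaPole f z = OnePoint.infty)
    (h1 : ∀ z ∈ Metric.ball (0 : ℂ) 1, N.eval z ≠ 0 →
      bmaPole f z = ((q.eval z / N.eval z : ℂ) : OnePoint ℂ))
    (hc : ∀ z ∈ Metric.ball (0 : ℂ) 1, N.eval z = 0 → q.eval z ≠ 0) (hp : N ≠ 0) :
    TakesValueExactly (bmaPole f) (Metric.ball 0 1) OnePoint.infty (diskRootCount N) := by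
  have hz : ∀ z ∈ Metric.ball (0 : ℂ) 1, bmaPole f z = OnePoint.infty ↔ N.eval z = 0 := by
    intro z hz
    refine ⟨fun h => ?_, h0 z hz⟩
    by_contra hN
    rw [h1 z hz hN] at h
    exact OnePoint.coe_ne_infty _ h
  refine takesValueExactly_of_polynomial hp hz fun z hzb h => ?_
  rw [valueMultiplicity, if_pos ((hz z hzb).2 h), if_pos rfl]
  have hq := hc z hzb h
  have hqa : AnalyticAt ℂ (fun w => q.eval w) z := q.differentiable.analyticAt z
  refine analyticOrderAt_eq_rootMultiplicity hp (hqa.inv hq) (inv_ne_zero hq) ?_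
  filter_upwards [Metric.isOpen_ball.mem_nhds hzb] with w hw
  by_cases hN : N.eval w = 0
  · rw [h0 w hw hN, hN, zero_mul]
    rfl
  · rw [h1 w hw hN]
    change (q.eval w / N.eval w)⁻¹ = N.eval w * (q.eval w)⁻¹
    rw [inv_div, div_eq_mul_inv]

/-- The conclusions about the pole, from the partial fraction decomposition of `f'' / f'`. -/
theorem exists_blaschke_of_partialFractions {f : ℂ → ℂ} {S S' : Finset ℂ} {γ : ℂ → ℝ} (hd : Disjoint S S')
    (hS : ∀ a ∈ S, ‖a‖ = 1 ∧ 0 < γ a) (hS' : ∀ a ∈ S', ‖a‖ = 1 ∧ γ a < 0)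
    (hsum : ∑ a ∈ S ∪ S', γ a = -2) (hne : ∀ z ∈ Metric.ball (0 : ℂ) 1, deriv f z ≠ 0)
    (hF : ∀ z ∈ Metric.ball (0 : ℂ) 1,
      deriv (deriv f) z / deriv f z = ∑ a ∈ S ∪ S', (γ a : ℂ) / (z - a)) :
    ∃ k : ℕ, S'.card = k + 1 ∧
      (∃ Bk Bm : ℂ → ℂ, IsFiniteBlaschkeProduct k Bk ∧ IsFiniteBlaschkeProduct S.card Bm ∧
        (∀ z ∈ Metric.ball (0 : ℂ) 1, ¬ (Bk z = 0 ∧ Bm z = 0)) ∧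
        (∀ z ∈ Metric.ball (0 : ℂ) 1, Bm z - z * Bk z ≠ 0 ∧
          deriv (deriv f) z / deriv f z = 2 * Bk z / (Bm z - z * Bk z)) ∧
        (∀ z ∈ Metric.ball (0 : ℂ) 1,
          (Bk z = 0 → bmaPole f z = OnePoint.infty) ∧
          (Bk z ≠ 0 → bmaPole f z = ((Bm z / Bk z : ℂ) : OnePoint ℂ)))) ∧
      (∀ b : ℂ, 1 < ‖b‖ → TakesValueExactly (bmaPole f) (Metric.ball 0 1) (b : OnePoint ℂ) k) ∧
      TakesValueExactly (bmaPole f) (Metric.ball 0 1) OnePoint.infty k ∧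
      (∀ a : ℂ, ‖a‖ < 1 → TakesValueExactly (bmaPole f) (Metric.ball 0 1) (a : OnePoint ℂ) S.card) := by
  have hT : ∀ a ∈ S ∪ S', ‖a‖ = 1 := fun a ha => by
    rcases Finset.mem_union.1 ha with h | h
    exacts [(hS a h).1, (hS' a h).1]
  set N := fracNumerator (S ∪ S') γ with hN
  set D := nodePoly (S ∪ S') 1 with hD
  set q := reflectedNumerator (S ∪ S') γ with hq
  have hN0 : N ≠ 0 := by
    intro h
    have := (fracNumerator_degree hsum).2
    rw [← hN, h, Polynomial.leadingCoeff_zero] at this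
    norm_num at this
  have hXN := X_mul_fracNumerator hsum
  -- The homotopy at t = 0 is exactly zN, which is already known to be zero-free on the circle.
  have hNc : ∀ z : ℂ, ‖z‖ = 1 → N.eval z ≠ 0 := by
    intro z hz h
    have h1 := herglotz_sub_node_ne_zero_on_circle hd hS hS' (t := 0) ⟨le_rfl, zero_le_one⟩ hz
    apply h1
    have h2 := congrArg (Polynomial.eval z) hXN
    rw [Polynomial.eval_mul, ← hN, h, mul_zero, herglotzPoly_union hd, nodePoly_union hd] at h2
    rw [h2]
    simp only [add_zero, sub_zero, Complex.ofReal_one, map_one, one_mul]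
    congr 1
    ring
  -- The extra root of zN at the origin accounts for the shift between k and the number k + 1 of
  -- convex vertices.
  have hcount : diskRootCount N + 1 = S'.card := by
    have h1 := diskRootCount_herglotz hd hS hS'
    rw [← hXN, diskRootCount_mul (mul_ne_zero Polynomial.X_ne_zero hN0), diskRootCount_X] at h1
    omega
  have hcountq : diskRootCount q = S.card := by
    have h1 := diskRootCount_reflectedNumerator hT hsum hNc
    rw [← hN, ← hq, Finset.card_union_of_disjoint hd] at h1
    omega
  have hDne : ∀ z ∈ Metric.ball (0 : ℂ) 1, D.eval z ≠ 0 := fun z hz =>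
    eval_nodePoly_ne_zero fun a ha h => by
      rw [Complex.ofReal_one, one_mul] at h
      exact sub_ne_zero_of_mem_ball hz (hT a ha) (sub_eq_zero.2 h)
  have hFN : ∀ z ∈ Metric.ball (0 : ℂ) 1, deriv (deriv f) z / deriv f z = N.eval z / D.eval z := by
    intro z hz
    rw [hF z hz, hN, eval_fracNumerator γ fun a ha h => sub_ne_zero_of_mem_ball hz (hT a ha)
      (sub_eq_zero.2 h), mul_div_cancel_left₀ _ (hDne z hz)]
  have hqe : ∀ z, q.eval z = z * N.eval z + 2 * D.eval z := reflectedNumerator_eq hsum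
  have h0 : ∀ z ∈ Metric.ball (0 : ℂ) 1, N.eval z = 0 → bmaPole f z = OnePoint.infty := fun z hz =>
    (bmaPole_eq (hne z hz) (hDne z hz) (hFN z hz) (hqe z)).1
  have h1 : ∀ z ∈ Metric.ball (0 : ℂ) 1, N.eval z ≠ 0 →
      bmaPole f z = ((q.eval z / N.eval z : ℂ) : OnePoint ℂ) := fun z hz =>
    (bmaPole_eq (hne z hz) (hDne z hz) (hFN z hz) (hqe z)).2
  have hc : ∀ z ∈ Metric.ball (0 : ℂ) 1, N.eval z = 0 → q.eval z ≠ 0 := by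
    intro z hz h
    rw [hqe, h, mul_zero, zero_add]
    exact mul_ne_zero two_ne_zero (hDne z hz)
  have hnc : ∀ z : ℂ, ‖z‖ = 1 → ‖q.eval z‖ = ‖N.eval z‖ := fun z hz => norm_eq_of_circle hT hsum hz
  refine ⟨diskRootCount N, hcount.symm, ?_, fun b hb => ?_, ?_, fun a ha => ?_⟩
  · obtain ⟨Bk, Bm, G, hk, hm, hG⟩ := exists_blaschke_factorization hT hsum hNc
    -- This is q - zN = 2D. As D has no zeros in the disk, it excludes both a vanishing denominator
    -- and common zeros of the Blaschke products.
    have hsub : ∀ z ∈ Metric.ball (0 : ℂ) 1, G z * (Bm z - z * Bk z) = 2 * D.eval z := by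
      intro z hz
      obtain ⟨-, g1, g2⟩ := hG z hz
      linear_combination hqe z + z * g1 - g2
    have hsubne : ∀ z ∈ Metric.ball (0 : ℂ) 1, Bm z - z * Bk z ≠ 0 := fun z hz h => by
      have := hsub z hz
      rw [h, mul_zero] at this
      exact mul_ne_zero two_ne_zero (hDne z hz) this.symm
    refine ⟨Bk, Bm, hk, hcountq ▸ hm, ?_, ?_, ?_⟩
    · rintro z hz ⟨g1, g2⟩
      exact hsubne z hz (by rw [g1, g2, mul_zero, sub_zero])
    · intro z hz
      obtain ⟨g0, g1, g2⟩ := hG z hz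
      refine ⟨hsubne z hz, ?_⟩
      rw [hFN z hz, div_eq_div_iff (hDne z hz) (hsubne z hz), hN, g1]
      linear_combination Bk z * hsub z hz
    · intro z hz
      obtain ⟨g0, g1, g2⟩ := hG z hz
      refine ⟨fun h => h0 z hz (by rw [hN, g1, h, mul_zero]), fun h => ?_⟩
      rw [h1 z hz (by rw [hN, g1]; exact mul_ne_zero g0 h), hN, hq, g1, g2, mul_div_mul_left _ _ g0]
  · have hb0 : -b ≠ 0 := by
      rw [neg_ne_zero]; rintro rfl; rw [norm_zero] at hb; linarith
    -- On the circle |q| = |N| ≠ 0, so bN dominates q when |b| > 1. For |a| < 1, q dominates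
    -- instead.
    have e : q - Polynomial.C b * N = Polynomial.C (-b) * N + q := by rw [map_neg]; ring
    have hcnt : diskRootCount (q - Polynomial.C b * N) = diskRootCount N := by
      rw [e, diskRootCount_add, diskRootCount_C_mul hb0]
      intro z hz
      have := norm_pos_iff.2 (hNc z hz)
      rw [hnc z hz, Polynomial.eval_mul, Polynomial.eval_C, norm_mul, norm_neg]
      nlinarith
    rw [← hcnt]
    refine takesValueExactly_bmaPole h0 h1 hc fun h => ?_
    have h2 := congrArg (fun p => ‖Polynomial.eval 1 p‖) (sub_eq_zero.1 h)
    simp only [Polynomial.eval_mul, Polynomial.eval_C, norm_mul] at h2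
    rw [hnc 1 norm_one] at h2
    have := norm_pos_iff.2 (hNc 1 norm_one)
    nlinarith
  · exact takesValueExactly_bmaPole_infty h0 h1 hc hN0
  · have hcnt : diskRootCount (q - Polynomial.C a * N) = S.card := by
      have e : q - Polynomial.C a * N = q + Polynomial.C (-a) * N := by rw [map_neg]; ring
      rw [e, diskRootCount_add, hcountq]
      intro z hz
      have := norm_pos_iff.2 (hNc z hz)
      rw [hnc z hz, Polynomial.eval_mul, Polynomial.eval_C, norm_mul, norm_neg]
      nlinarith
    rw [← hcnt]
    refine takesValueExactly_bmaPole h0 h1 hc fun h => ?_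
    have h2 := congrArg (fun p => ‖Polynomial.eval 1 p‖) (sub_eq_zero.1 h)
    simp only [Polynomial.eval_mul, Polynomial.eval_C, norm_mul] at h2
    rw [hnc 1 norm_one] at h2
    have := norm_pos_iff.2 (hNc 1 norm_one)
    nlinarith


/-! ### Vertices at infinity -/

theorem exists_norm_gt_of_mem_sectorSet {c : ℂ × ℝ × ℝ} (hc : c.2.2 = Real.pi) {ε : ℝ} (hε : 0 < ε) :
    ∃ w ∈ sectorSet c ε, ‖c.1‖ < ‖w‖ := by
  set u := Complex.exp (c.2.1 * Complex.I) with hu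
  have hun : ‖u‖ = 1 := norm_exp_real_mul_I _
  have hu0 : u ≠ 0 := Complex.exp_ne_zero _
  set p := c.1 / u with hp
  have hpn : ‖p‖ = ‖c.1‖ := by rw [hp, norm_div, hun, div_one]
  set s := min (ε / 2) 1 with hs
  have hs0 : 0 < s := lt_min (by linarith) one_pos
  have hs1 : s ≤ 1 := min_le_right _ _
  have hsε : s ≤ ε / 2 := min_le_left _ _
  -- Moving by s along the edge, on the side where p · s' ≥ 0, gains s² in the squared norm. Lifting
  -- by y into the half plane costs at most 2‖p‖y ≤ s²/2.
  set y := s ^ 2 / (4 * (‖p‖ + 1)) with hy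
  have hp0 := norm_nonneg p
  have hy0 : 0 < y := by positivity
  have hy1 : y * (4 * (‖p‖ + 1)) = s ^ 2 := by rw [hy]; field_simp
  have hy2 : y ≤ s / 4 := by nlinarith
  obtain ⟨s', hs', hps⟩ : ∃ s' : ℝ, |s'| = s ∧ 0 ≤ p.re * s' := by
    rcases le_total 0 p.re with h | h
    · exact ⟨s, abs_of_pos hs0, mul_nonneg h hs0.le⟩
    · exact ⟨-s, by rw [abs_neg, abs_of_pos hs0], by nlinarith⟩
  have hss : s' ^ 2 = s ^ 2 := by rw [← sq_abs, hs']
  set x : ℂ := ⟨s', y⟩ with hx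
  have hxn : ‖x‖ < ε := by
    have := Complex.norm_le_abs_re_add_abs_im x
    have h1 : |x.re| = s := hs'
    have h2 : |x.im| = y := abs_of_pos hy0
    linarith
  have hcπ : 0 < c.2.2 := by rw [hc]; exact Real.pi_pos
  refine ⟨cornerMap c x, cornerMap_mem_sectorSet hcπ (show 0 < x.im from hy0) ?_, ?_⟩
  · rwa [hc, div_self Real.pi_ne_zero, Real.rpow_one]
  · have e : cornerMap c x = u * (p + x) := by
      rw [cornerMap_of_eq_pi hc, hp, mul_add, mul_div_cancel₀ _ hu0]
    rw [e, norm_mul, hun, one_mul, ← hpn]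
    refine lt_of_pow_lt_pow_left₀ 2 (norm_nonneg _) ?_
    rw [← Complex.normSq_eq_norm_sq, ← Complex.normSq_eq_norm_sq, Complex.normSq_apply, Complex.normSq_apply]
    have h1 : (p + x).re = p.re + s' := rfl
    have h2 : (p + x).im = p.im + y := rfl
    rw [h1, h2]
    have h3 := Complex.abs_im_le_norm p
    have h4 := neg_abs_le p.im
    nlinarith [sq_nonneg y]

theorem isOpen_outer {Ω : Set ℂ} (hΩ : IsOpen Ω) (R : ℝ) : IsOpen {w : ℂ | w ∈ Ω ∧ R < ‖w‖} :=
  hΩ.inter (isOpen_lt continuous_const continuous_norm)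

/-- The components of the part of a polygon outside of a large disk are unbounded. -/
theorem exists_norm_gt_of_outer {Ω : Set ℂ} (hΩ : IsPolygon Ω) {R : ℝ} (hR0 : 0 ≤ R)
    (hR : ∀ c ∈ corners Ω, R < ‖c.1‖ → c.2.2 = Real.pi) {w₀ : ℂ} (hw₀ : w₀ ∈ Ω ∧ R < ‖w₀‖) (M : ℝ) :
    ∃ w ∈ connectedComponentIn {w : ℂ | w ∈ Ω ∧ R < ‖w‖} w₀, M < ‖w‖ := by
  by_contra! hM
  set X := {w : ℂ | w ∈ Ω ∧ R < ‖w‖} with hX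
  set C := connectedComponentIn X w₀ with hC
  have hw₀C : w₀ ∈ C := mem_connectedComponentIn hw₀
  have hCX : C ⊆ X := connectedComponentIn_subset _ _
  have habs : ∀ s : Set ℂ, IsPreconnected s → s ⊆ X → (s ∩ C).Nonempty → s ⊆ C := by
    rintro s hs hsX ⟨w, hws, hwC⟩
    have := hs.subset_connectedComponentIn hws hsX
    rwa [← connectedComponentIn_eq hwC] at this
  have hcomp : IsCompact (closure C) :=
    (isCompact_closedBall (0 : ℂ) M).of_isClosed_subset isClosed_closure
      (closure_minimal (fun w hw => mem_closedBall_zero_iff.2 (hM w hw)) Metric.isClosed_closedBall)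
  -- A bounded component has a point p of largest norm in its closure. If p lies in Ω, scaling
  -- enlarges the norm; otherwise p is the apex of a flat corner whose sector lies in the component
  -- and reaches farther out.
  obtain ⟨p, hpC, hmax⟩ := hcomp.exists_isMaxOn ⟨w₀, subset_closure hw₀C⟩ continuous_norm.continuousOn
  have hmax' : ∀ w ∈ C, ‖w‖ ≤ ‖p‖ := fun w hw => hmax (subset_closure hw)
  have hpR : R < ‖p‖ := hw₀.2.trans_le (hmax' w₀ hw₀C)
  by_cases hpΩ : p ∈ Ω
  · obtain ⟨ε, hε, hεX⟩ := Metric.isOpen_iff.1 (isOpen_outer hΩ.isOpen R) p ⟨hpΩ, hpR⟩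
    have h1 : Metric.ball p ε ⊆ C := by
      refine habs _ (convex_ball _ _).isPreconnected hεX ?_
      obtain ⟨w, hw1, hw2⟩ := Metric.mem_closure_iff.1 hpC ε hε
      exact ⟨w, by rw [Metric.mem_ball, dist_comm]; exact hw2, hw1⟩
    have hp0 : 0 < ‖p‖ := hR0.trans_lt hpR
    set η := ε / (2 * ‖p‖) with hη
    have hη0 : 0 < η := by positivity
    have h2 : ((1 + η : ℝ) : ℂ) * p ∈ Metric.ball p ε := by
      have : ((1 + η : ℝ) : ℂ) * p - p = (η : ℂ) * p := by push_cast; ring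
      rw [Metric.mem_ball, dist_eq_norm, this, norm_mul, Complex.norm_real, Real.norm_of_nonneg hη0.le, hη]
      have : ε / (2 * ‖p‖) * ‖p‖ = ε / 2 := by field_simp
      linarith
    have h3 := hmax' _ (h1 h2)
    rw [norm_mul, Complex.norm_real, Real.norm_of_nonneg (by linarith)] at h3
    nlinarith
  · have hpf : p ∈ frontier Ω := by
      rw [hΩ.isOpen.frontier_eq]
      exact ⟨closure_mono (fun w hw => (hCX hw).1) hpC, hpΩ⟩
    obtain ⟨ε, hε, hloc⟩ := hΩ.exists_corner_of_mem hpf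
    set δ := min ε (‖p‖ - R) with hδ
    have hδ0 : 0 < δ := lt_min hε (by linarith)
    obtain ⟨w, hwC, hw⟩ := Metric.mem_closure_iff.1 hpC δ hδ0
    rw [dist_comm] at hw
    obtain ⟨c, hc, hcp, hm, hsub⟩ := hloc w (hCX hwC).1 (hw.trans_le (min_le_left _ _))
    have hπ := hR c hc (by rw [hcp]; exact hpR)
    have h1 : sectorSet c δ ⊆ C := by
      refine habs _ (isPreconnected_sectorSet c δ) (fun v hv => ⟨hsub (sectorSet_mono (min_le_left _ _) hv), ?_⟩)
        ⟨w, mem_sectorSet_of_dist_lt hm (by rw [hcp]; exact hw), hwC⟩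
      have h2 := dist_lt_of_mem_sectorSet hv
      rw [hcp, dist_comm, dist_eq_norm] at h2
      have h3 := norm_sub_norm_le p v
      have h4 : δ ≤ ‖p‖ - R := min_le_right _ _
      linarith
    obtain ⟨v, hv, hvn⟩ := exists_norm_gt_of_mem_sectorSet hπ hδ0
    rw [hcp] at hvn
    exact absurd (hmax' v (h1 hv)) (not_le.2 hvn)

/-- Away from the points at which it tends to `∞`, the map is bounded. -/
theorem exists_bound_off_poleSet {f : ℂ → ℂ} {Ω : Set ℂ} (hΩ : IsPolygon Ω) (hf : IsConformalFromDisk f Ω)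
    {U : ℂ → Set ℂ} (hU : ∀ a ∈ poleSet f, IsOpen (U a) ∧ a ∈ U a) :
    ∃ M : ℝ, ∀ z ∈ Metric.ball (0 : ℂ) 1, M < ‖f z‖ → ∃ a ∈ poleSet f, z ∈ U a := by
  have hcomp : IsCompact (Metric.closedBall (0 : ℂ) 1 \ ⋃ a ∈ poleSet f, U a) :=
    (isCompact_closedBall (0 : ℂ) 1).diff (isOpen_biUnion fun a ha => (hU a ha).1)
  have key : ∃ M : ℝ, ∀ z ∈ (Metric.closedBall (0 : ℂ) 1 \ ⋃ a ∈ poleSet f, U a), z ∈ Metric.ball (0 : ℂ) 1 →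
      ‖f z‖ ≤ M := by
    refine hcomp.induction_on (p := fun s => ∃ M : ℝ, ∀ z ∈ s, z ∈ Metric.ball (0 : ℂ) 1 → ‖f z‖ ≤ M)
      ⟨0, by simp⟩ ?_ ?_ ?_
    · rintro s t hst ⟨M, hM⟩
      exact ⟨M, fun z hz => hM z (hst hz)⟩
    · rintro s t ⟨M, hM⟩ ⟨M', hM'⟩
      refine ⟨max M M', ?_⟩
      rintro z (hz | hz) hzb
      · exact (hM z hz hzb).trans (le_max_left _ _)
      · exact (hM' z hz hzb).trans (le_max_right _ _)
    · rintro ζ ⟨hζ, hζU⟩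
      have hlim : ∃ p, Tendsto f (𝓝[Metric.ball 0 1] ζ) (𝓝 p) := by
        rw [mem_closedBall_zero_iff] at hζ
        rcases hζ.lt_or_eq with h | h
        · exact ⟨f ζ, hf.differentiableOn.continuousOn ζ (mem_ball_zero_iff.2 h)⟩
        · rcases isPrevertex_or_tendsto_cobounded hΩ hf h with ⟨c, hc, hp⟩ | hp
          · exact ⟨c.1, hp.tendsto_apex hc.2.1.1⟩
          · exact absurd (Set.mem_biUnion (show ζ ∈ poleSet f from ⟨h, hp⟩) (hU ζ ⟨h, hp⟩).2) hζU
      obtain ⟨p, hp⟩ := hlim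
      have h1 : ∀ᶠ z in 𝓝 ζ, z ∈ Metric.ball (0 : ℂ) 1 → ‖f z‖ < ‖p‖ + 1 :=
        eventually_nhdsWithin_iff.1 (hp.norm.eventually (gt_mem_nhds (by linarith)))
      exact ⟨_, nhdsWithin_le_nhds h1, ‖p‖ + 1, fun z hz hzb => (hz hzb).le⟩
  obtain ⟨M, hM⟩ := key
  refine ⟨M, fun z hz hzM => ?_⟩
  by_contra! hcon
  refine absurd (hM z ⟨Metric.ball_subset_closedBall hz, ?_⟩ hz) (not_le.2 hzM)
  simp only [Set.mem_iUnion, not_exists]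
  exact hcon

/-- The vertices at infinity correspond to the points of the circle at which the map tends to `∞`. -/
theorem eventually_card_outerComponents {f : ℂ → ℂ} {Ω : Set ℂ} (hΩ : IsPolygon Ω)
    (hf : IsConformalFromDisk f Ω) :
    ∀ᶠ R : ℝ in atTop, ENat.card (OuterComponents Ω R) = (poleSet f).encard := by
  obtain ⟨U, hU, hUd⟩ := (finite_poleSet hΩ hf).t2_separation
  obtain ⟨M₀, hM₀⟩ := exists_bound_off_poleSet hΩ hf (U := U) fun a _ => ⟨(hU a).2, (hU a).1⟩
  obtain ⟨E, hEf, hE1, -⟩ := hΩ.exists_exceptional_set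
  obtain ⟨M₁, hM₁⟩ := hEf.isBounded.exists_norm_le
  filter_upwards [eventually_ge_atTop M₀, eventually_ge_atTop M₁, eventually_ge_atTop 0] with R hR₀ hR₁ hR
  have hflat : ∀ c ∈ corners Ω, R < ‖c.1‖ → c.2.2 = Real.pi := by
    intro c hc hcR
    by_contra hπ
    linarith [hM₁ c.1 (hE1 c hc hπ)]
  set X := {w : ℂ | w ∈ Ω ∧ R < ‖w‖} with hX
  set g := Function.invFunOn f (Metric.ball 0 1) with hg
  have hnear : ∀ a ∈ poleSet f, ∃ ε > 0, Metric.ball a ε ⊆ U a ∧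
      ∀ z ∈ Metric.ball a ε ∩ Metric.ball 0 1, R < ‖f z‖ := by
    intro a ha
    obtain ⟨ε, hε, h1⟩ := Metric.mem_nhds_iff.1
      (Filter.inter_mem ((hU a).2.mem_nhds (hU a).1) (eventually_le_norm_near ha.2 (R + 1)))
    refine ⟨ε, hε, fun z hz => (h1 hz).1, fun z hz => ?_⟩
    have := (h1 hz.1).2 hz.2
    linarith
  choose! ε hε hεU hεR using hnear
  have hV : ∀ a ∈ poleSet f, IsPreconnected (f '' (Metric.ball a (ε a) ∩ Metric.ball 0 1)) ∧
      f '' (Metric.ball a (ε a) ∩ Metric.ball 0 1) ⊆ X := by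
    intro a ha
    refine ⟨?_, ?_⟩
    · exact ((convex_ball _ _).inter (convex_ball _ _)).isPreconnected.image f
        (hf.differentiableOn.continuousOn.mono Set.inter_subset_right)
    · rintro _ ⟨z, hz, rfl⟩
      exact ⟨hf.mem_image hz.2, hεR a ha z hz⟩
  have hpt : ∀ a ∈ poleSet f, ∃ z, z ∈ Metric.ball a (ε a) ∩ Metric.ball 0 1 := by
    intro a ha
    have := neBot_nhdsWithin_ball ha.1
    have h1 : ∀ᶠ z in 𝓝[Metric.ball 0 1] a, z ∈ Metric.ball a (ε a) ∩ Metric.ball 0 1 := by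
      filter_upwards [nhdsWithin_le_nhds (Metric.ball_mem_nhds a (hε a ha)), self_mem_nhdsWithin]
        with z h1 h2 using ⟨h1, h2⟩
    exact h1.exists
  choose! ζ hζ using hpt
  -- Each pole goes to the component containing the image of its small half neighbourhood.
  -- Injectivity: the inverse image of a component is connected and covered by the disjoint sets U.
  -- Surjectivity: a component is unbounded, so its inverse image enters one of the neighbourhoods.
  let φ : poleSet f → OuterComponents Ω R := fun a =>
    ConnectedComponents.mk ⟨f (ζ a), (hV a a.2).2 ⟨ζ a, hζ a a.2, rfl⟩⟩
  have hφ : Function.Bijective φ := by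
    constructor
    · rintro ⟨a, ha⟩ ⟨b, hb⟩ hab
      have h1 := ConnectedComponents.coe_eq_coe.1 hab
      set x : X := ⟨f (ζ a), (hV a ha).2 ⟨ζ a, hζ a ha, rfl⟩⟩ with hx
      set y : X := ⟨f (ζ b), (hV b hb).2 ⟨ζ b, hζ b hb, rfl⟩⟩ with hy
      have h2 : y ∈ connectedComponent x := by
        have h3 : connectedComponent x = connectedComponent y := h1
        rw [h3]
        exact mem_connectedComponent
      have hpre : IsPreconnected ((fun w : X => g w) '' connectedComponent x) := by
        refine isPreconnected_connectedComponent.image _ ?_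
        have h4 : Continuous fun w : X => g w :=
          (hf.differentiableOn_inv.continuousOn).comp_continuous continuous_subtype_val fun w => w.2.1
        exact h4.continuousOn
      have hcov : ((fun w : X => g w) '' connectedComponent x) ⊆ U a ∪ ⋃ b ∈ poleSet f \ {a}, U b := by
        rintro _ ⟨w, -, rfl⟩
        obtain ⟨d, hd, hwd⟩ := hM₀ (g w) (hf.inv_mem w.2.1) (by
          have h4 : f (g w) = w := hf.apply_inv w.2.1
          rw [h4]
          exact hR₀.trans_lt w.2.2)
        by_cases hda : d = a
        · exact Or.inl (hda ▸ hwd)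
        · exact Or.inr (Set.mem_biUnion ⟨hd, hda⟩ hwd)
      have hdis : Disjoint (U a) (⋃ b ∈ poleSet f \ {a}, U b) := by
        rw [Set.disjoint_iUnion₂_right]
        rintro d ⟨hd, hda⟩
        exact hUd ha hd (fun h => hda h.symm)
      have hsub := hpre.subset_left_of_subset_union (hU a).2 (isOpen_biUnion fun b _ => (hU b).2) hdis hcov
        ⟨g x, ⟨x, mem_connectedComponent, rfl⟩, by
          have h4 : g x = ζ a := hf.inv_apply (hζ a ha).2
          rw [h4]
          exact hεU a ha (hζ a ha).1⟩
      have h5 : g y ∈ U a := hsub ⟨y, h2, rfl⟩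
      have h6 : g y = ζ b := hf.inv_apply (hζ b hb).2
      rw [h6] at h5
      by_contra hne
      exact Set.disjoint_left.1 (hUd ha hb fun h => hne (Subtype.ext h)) h5 (hεU b hb (hζ b hb).1)
    · intro y
      obtain ⟨x, rfl⟩ := ConnectedComponents.surjective_coe y
      obtain ⟨M, hM⟩ := exists_bound_off_poleSet hΩ hf (U := fun a => Metric.ball a (ε a)) fun a ha =>
        ⟨Metric.isOpen_ball, Metric.mem_ball_self (hε a ha)⟩
      obtain ⟨w, hwC, hwM⟩ := exists_norm_gt_of_outer hΩ hR hflat x.2 M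
      have hwX : w ∈ X := connectedComponentIn_subset _ _ hwC
      have hfg : f (g w) = w := hf.apply_inv hwX.1
      obtain ⟨a, ha, hwa⟩ := hM (g w) (hf.inv_mem hwX.1) (by rw [hfg]; exact hwM)
      refine ⟨⟨a, ha⟩, ?_⟩
      have h1 : f '' (Metric.ball a (ε a) ∩ Metric.ball 0 1) ⊆ connectedComponentIn X x := by
        have h2 := (hV a ha).1.subset_connectedComponentIn
          (show w ∈ _ from ⟨g w, ⟨hwa, hf.inv_mem hwX.1⟩, hfg⟩) (hV a ha).2
        rwa [← connectedComponentIn_eq hwC] at h2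
      have h2 := h1 ⟨ζ a, hζ a ha, rfl⟩
      rw [connectedComponentIn_eq_image x.2] at h2
      obtain ⟨v, hv, hve⟩ := h2
      refine ConnectedComponents.coe_eq_coe.2 ?_
      have h3 : v = ⟨f (ζ a), (hV a ha).2 ⟨ζ a, hζ a ha, rfl⟩⟩ := Subtype.ext hve
      rw [← h3]
      exact (connectedComponent_eq hv).symm
  rw [← ENat.card_congr (Equiv.ofBijective φ hφ)]
  rfl

/-! ### Counting the vertices -/

/-- Each corner has exactly one prevertex, and a point of the circle is the prevertex of at most one
corner. -/
theorem encard_corners_eq {f : ℂ → ℂ} {Ω : Set ℂ} (hΩ : IsPolygon Ω) (hf : IsConformalFromDisk f Ω)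
    (P : ℝ → Prop) : {c ∈ corners Ω | P c.2.2}.encard =
      {ζ | ∃ c ∈ corners Ω, P c.2.2 ∧ IsPrevertex f c ζ}.encard := by
  have h := fun c (hc : c ∈ corners Ω) => exists_isPrevertex hΩ hf hc
  choose! a ha using h
  have himg : {ζ | ∃ c ∈ corners Ω, P c.2.2 ∧ IsPrevertex f c ζ} = a '' {c ∈ corners Ω | P c.2.2} := by
    ext ζ
    constructor
    · rintro ⟨c, hc, hP, h⟩
      exact ⟨c, ⟨hc, hP⟩, (ha c hc).unique hc h⟩
    · rintro ⟨c, ⟨hc, hP⟩, rfl⟩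
      exact ⟨c, hc, hP, ha c hc⟩
  rw [himg, Set.InjOn.encard_image]
  rintro c ⟨hc, -⟩ c' ⟨hc', -⟩ hcc
  exact (ha c hc).corner_unique hc hc' (hcc ▸ ha c' hc')


theorem setOf_prevertex_eq {f : ℂ → ℂ} {Ω : Set ℂ} (hΩ : IsPolygon Ω) (hf : IsConformalFromDisk f Ω)
    {γ : ℂ → ℝ} (hK : ∀ ζ ∈ poleSet f, γ ζ < 0)
    (hγ : ∀ c ∈ corners Ω, ∀ ζ, IsPrevertex f c ζ → γ ζ = c.2.2 / Real.pi - 1) :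
    {ζ | ∃ c ∈ corners Ω, Real.pi < c.2.2 ∧ IsPrevertex f c ζ} = {ζ | ‖ζ‖ = 1 ∧ 0 < γ ζ} ∧
    {ζ | ∃ c ∈ corners Ω, c.2.2 < Real.pi ∧ IsPrevertex f c ζ} ∪ poleSet f = {ζ | ‖ζ‖ = 1 ∧ γ ζ < 0} ∧
    Disjoint {ζ | ∃ c ∈ corners Ω, c.2.2 < Real.pi ∧ IsPrevertex f c ζ} (poleSet f) := by
  have hpi := Real.pi_pos
  refine ⟨?_, ?_, ?_⟩
  · ext ζ
    constructor
    · rintro ⟨c, hc, hcπ, h⟩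
      refine ⟨h.1, ?_⟩
      rw [hγ c hc ζ h, sub_pos, lt_div_iff₀ hpi, one_mul]
      exact hcπ
    · rintro ⟨h1, h2⟩
      rcases isPrevertex_or_tendsto_cobounded hΩ hf h1 with ⟨c, hc, h⟩ | h
      · refine ⟨c, hc, ?_, h⟩
        rwa [hγ c hc ζ h, sub_pos, lt_div_iff₀ hpi, one_mul] at h2
      · linarith [hK ζ ⟨h1, h⟩]
  · ext ζ
    constructor
    · rintro (⟨c, hc, hcπ, h⟩ | h)
      · refine ⟨h.1, ?_⟩
        rw [hγ c hc ζ h, sub_neg, div_lt_iff₀ hpi, one_mul]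
        exact hcπ
      · exact ⟨h.1, hK ζ h⟩
    · rintro ⟨h1, h2⟩
      rcases isPrevertex_or_tendsto_cobounded hΩ hf h1 with ⟨c, hc, h⟩ | h
      · refine Or.inl ⟨c, hc, ?_, h⟩
        rwa [hγ c hc ζ h, sub_neg, div_lt_iff₀ hpi, one_mul] at h2
      · exact Or.inr ⟨h1, h⟩
  · rw [Set.disjoint_left]
    rintro ζ ⟨c, hc, -, h⟩ h'
    exact h.not_tendsto_cobounded hc.2.1.1 h'.2

theorem theorem4p12 (f : ℂ → ℂ) (Ω : Set ℂ) (hΩ : IsPolygon Ω) (hf : IsConformalFromDisk f Ω) :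
    ∃ k m : ℕ,
      HasConvexVertexCount Ω (k + 1) ∧ HasConcaveVertexCount Ω m ∧
      (∃ Bk Bm : ℂ → ℂ, IsFiniteBlaschkeProduct k Bk ∧ IsFiniteBlaschkeProduct m Bm ∧
        (∀ z ∈ Metric.ball (0 : ℂ) 1, ¬ (Bk z = 0 ∧ Bm z = 0)) ∧
        (∀ z ∈ Metric.ball (0 : ℂ) 1, Bm z - z * Bk z ≠ 0 ∧
          deriv (deriv f) z / deriv f z = 2 * Bk z / (Bm z - z * Bk z)) ∧
        (∀ z ∈ Metric.ball (0 : ℂ) 1,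
          (Bk z = 0 → bmaPole f z = OnePoint.infty) ∧
          (Bk z ≠ 0 → bmaPole f z = ((Bm z / Bk z : ℂ) : OnePoint ℂ)))) ∧
      (∀ b : ℂ, 1 < ‖b‖ → TakesValueExactly (bmaPole f) (Metric.ball 0 1) (b : OnePoint ℂ) k) ∧
      TakesValueExactly (bmaPole f) (Metric.ball 0 1) OnePoint.infty k ∧
      (∀ a : ℂ, ‖a‖ < 1 → TakesValueExactly (bmaPole f) (Metric.ball 0 1) (a : OnePoint ℂ) m) := by
  obtain ⟨γ, hγ, hfin, hK, hc⟩ := exists_angleIndex hΩ hf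
  have hfin₁ : {ζ : ℂ | ‖ζ‖ = 1 ∧ 0 < γ ζ}.Finite := hfin.subset fun ζ h => ⟨h.1, h.2.ne'⟩
  have hfin₂ : {ζ : ℂ | ‖ζ‖ = 1 ∧ γ ζ < 0}.Finite := hfin.subset fun ζ h => ⟨h.1, h.2.ne⟩
  -- The nodes of positive index are the prevertices of concave corners. Those of negative index are
  -- the prevertices of convex corners and the points where f tends to ∞.
  set S := hfin₁.toFinset with hSd
  set S' := hfin₂.toFinset with hSd'
  have hS : ∀ a ∈ S, ‖a‖ = 1 ∧ 0 < γ a := fun a ha => hfin₁.mem_toFinset.1 ha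
  have hS' : ∀ a ∈ S', ‖a‖ = 1 ∧ γ a < 0 := fun a ha => hfin₂.mem_toFinset.1 ha
  have hd : Disjoint S S' := Finset.disjoint_left.2 fun a ha ha' => by
    linarith [(hS a ha).2, (hS' a ha').2]
  obtain ⟨hsum, hF⟩ := schwarzChristoffel hf.differentiableOn hf.injOn hγ (T := S ∪ S')
    (fun ζ hζ => by
      rcases Finset.mem_union.1 hζ with h | h
      exacts [(hS ζ h).1, (hS' ζ h).1])
    (fun ζ h1 h2 => by
      by_contra hne
      refine h2 (Finset.mem_union.2 ?_)
      rcases lt_or_gt_of_ne hne with h | h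
      exacts [Or.inr (hfin₂.mem_toFinset.2 ⟨h1, h⟩), Or.inl (hfin₁.mem_toFinset.2 ⟨h1, h⟩)])
  obtain ⟨k, hk, hrest⟩ := exists_blaschke_of_partialFractions hd hS hS' hsum
    (fun z hz => deriv_ne_zero_of_injOn Metric.isOpen_ball hf.differentiableOn hf.injOn hz) hF
  obtain ⟨e1, e2, e3⟩ := setOf_prevertex_eq hΩ hf hK hc
  refine ⟨k, S.card, ?_, ?_, hrest⟩
  · filter_upwards [eventually_card_outerComponents hΩ hf] with R hR
    have h1 : (finiteConvexVertices Ω).encard = _ := encard_corners_eq hΩ hf fun β => β < Real.pi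
    rw [hR, h1, ← Set.encard_union_eq e3, e2, hfin₂.encard_eq_coe_toFinset_card, hk]
  · have h1 : (concaveVertices Ω).encard = _ := encard_corners_eq hΩ hf fun β => Real.pi < β
    rw [HasConcaveVertexCount, h1, e1, hfin₁.encard_eq_coe_toFinset_card]
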